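/- Let $\alpha>0$, $\gamma\ge 0$, $\omega\in\mathbb{R}$, $N>0$, $\rho\in(0,1)$, $\nu\in[0,1]$. Write $$E^{\gamma}_{\alpha,\rho}(z)=\sum_{j=0}^\infty\frac{(\gamma)_j}{\Gamma(\alpha j+\rho)}\frac{z^j}{j!},\qquad (\mathcal I^{\gamma}_{\alpha,\rho,\omega,0^+}f)(t)=\int_0^t (t-\tau)^{\rho-1}E^{\gamma}_{\alpha,\rho}(\omega(t-\tau)^\alpha)f(\tau)\,d\tau ,$$ with $(\gamma)_j$ the Pochhammer symbol and $\mathcal I^{0}_{\alpha,0,\omega,0^+}$ the identity, and let $${}^C\mathcal D^{\gamma,\rho,\nu}_{\alpha,\omega,0^+}f=\mathcal I^{-\gamma\nu}_{\alpha,\nu(1-\rho),\omega,0^+}\,\mathcal I^{-\gamma(1-\nu)}_{\alpha,(1-\nu)(1-\rho),\omega,0^+}\,\frac{df}{dt}$$ be the regularized Hilfer-Prabhakar derivative (acting in $t$). Let $g:\mathbb{R}\to\mathbb{C}$ be continuous and integrable, and let its Fourier transform $g^*(k)=\int_{-\infty}^\infty g(x)e^{ikx}\,dx$ be integrable. Consider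 the Cauchy problem $${}^C\mathcal D^{\gamma,\rho,\nu}_{\alpha,\omega,0^+}\psi(x,t)=N\frac{\partial^2}{\partial x^2}\psi(x,t)\quad(x\in\mathbb{R},\ t>0),\qquad \psi(x,0)=g(x),\qquad \lim_{|x|\to\infty}\psi(x,t)=0\quad(t\ge 0).$$ A solution is a function $\psi:\mathbb{R}\times[0,\infty)\to\mathbb{C}$ that satisfies these three conditions, is bounded on $\mathbb{R}\times[0,T]$ for every $T>0$, is absolutely continuous in $t$ on $[0,T]$ for every $x$ and $T>0$, is $C^2$ in $x$ for every $t>0$, has $\partial_t\psi$ locally integrable on $\mathbb{R}\times[0,\infty)$, and for which the two fractional integrals in ${}^C\mathcal D^{\gamma,\rho,\nu}_{\alpha,\omega,0^+}\psi(x,\cdot)(t)$ converge absolutely for all $x$ and all $t>0$. Then the problem has exactly one solution, and it is given by $$\psi(x,t)=\frac1{2\pi}\int_{-\infty}^{\infty}\sum_{n=0}^\infty e^{-ikx}\,E^{\gamma n}_{\alpha,\rho n+1}(\omega t^\alpha)\,(-Nk^2)^n\,t^{\rho n}\,g^*(k)\,dk\qquad(x\in\mathbb{R},\ t\ge 0),$$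 where the series converges for every $k$ and its sum is an integrable function of $k$. -/

import Mathlib

open MeasureTheory Filter Set
open scoped Topology

noncomputable section

/-- The three-parameter Mittag-Leffler (Prabhakar) function
`E_{α,ρ}^γ(z) = ∑_j (γ)_j z^j / (Γ(α j + ρ) j!)`, where `(γ)_j = γ (γ+1) ⋯ (γ+j-1)`.
(For `ρ = 0` the term `j = 0` is `1/Γ(0) = 0`, which is also its value in Mathlib.) -/
def mittagLeffler (α ρ γ z : ℝ) : ℝ :=
  ∑' j : ℕ, (ascPochhammer ℝ j).eval γ / Real.Gamma (α * j + ρ) * (z ^ j / (j.factorial : ℝ))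

/-- The Prabhakar kernel `e_{α,ρ,ω}^γ(t) = t^{ρ-1} E_{α,ρ}^γ(ω t^α)`, for `t > 0`. -/
def prabhakarKernel (α ρ γ ω t : ℝ) : ℝ :=
  t ^ (ρ - 1) * mittagLeffler α ρ γ (ω * t ^ α)

/-- The integral that defines the Prabhakar fractional integral of `f` at `t` converges
absolutely. -/
def PrabhakarIntegrable (α ρ γ ω : ℝ) (f : ℝ → ℂ) (t : ℝ) : Prop :=
  IntervalIntegrable (fun τ => (prabhakarKernel α ρ γ ω (t - τ) : ℂ) * f τ) volume 0 t

/-- The Prabhakar fractional integral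
`(I_{α,ρ,ω,0+}^γ f)(t) = ∫_0^t (t-τ)^{ρ-1} E_{α,ρ}^γ(ω (t-τ)^α) f(τ) dτ` for `ρ > 0`.
At the limiting order `ρ = 0` the first term of the kernel series, `t^{ρ-1}/Γ(ρ)`, degenerates
to the Dirac mass, which contributes `f t`; in particular `I_{α,0,ω,0+}^0` is the identity. -/
def prabhakarIntegral (α ρ γ ω : ℝ) (f : ℝ → ℂ) (t : ℝ) : ℂ :=
  (if ρ = 0 then f t else 0) +
    ∫ τ in (0 : ℝ)..t, (prabhakarKernel α ρ γ ω (t - τ) : ℂ) * f τ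

/-- The regularized Hilfer-Prabhakar derivative
`I_{α,ν(1-ρ),ω,0+}^{-γν} I_{α,(1-ν)(1-ρ),ω,0+}^{-γ(1-ν)} f'` of `f` at `t`. -/
def regHilferPrabhakar (α ω γ ρ ν : ℝ) (f : ℝ → ℂ) (t : ℝ) : ℂ :=
  prabhakarIntegral α (ν * (1 - ρ)) (-γ * ν) ω
    (prabhakarIntegral α ((1 - ν) * (1 - ρ)) (-γ * (1 - ν)) ω (deriv f)) t

/-- The two integrals in the regularized Hilfer-Prabhakar derivative of `f` converge at `t`. -/
def RegHilferPrabhakarExists (α ω γ ρ ν : ℝ) (f : ℝ → ℂ) (t : ℝ) : Prop :=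
  PrabhakarIntegrable α ((1 - ν) * (1 - ρ)) (-γ * (1 - ν)) ω (deriv f) t ∧
  PrabhakarIntegrable α (ν * (1 - ρ)) (-γ * ν) ω
    (prabhakarIntegral α ((1 - ν) * (1 - ρ)) (-γ * (1 - ν)) ω (deriv f)) t

/-- The Fourier transform `g*(k) = ∫ g(x) e^{ikx} dx`. -/
def fourierStar (g : ℝ → ℂ) (k : ℝ) : ℂ :=
  ∫ x : ℝ, g x * Complex.exp (Complex.I * k * x)

/-- `ψ x t` is a solution on `ℝ × [0, ∞)` of the Cauchy problem
`ᶜD_{α,ω,0+}^{γ,ρ,ν} ψ = N ∂²ψ/∂x²` for `t > 0`, with `ψ(x,0) = g(x)` and `ψ(x,t) → 0` as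
`|x| → ∞`. -/
structure IsHeatSolution (α ω γ ρ ν N : ℝ) (g : ℝ → ℂ) (ψ : ℝ → ℝ → ℂ) : Prop where
  /-- Absolute continuity in time, up to the initial time. -/
  abs_cont : ∀ x T : ℝ, 0 < T → AbsolutelyContinuousOnInterval (ψ x) 0 T
  /-- `∂ψ/∂t` is locally integrable on `ℝ × [0, ∞)`. -/
  time_deriv_integrable : ∀ R T : ℝ, 0 < R → 0 < T →
    IntegrableOn (fun p : ℝ × ℝ => deriv (ψ p.1) p.2) (Icc (-R) R ×ˢ Ioc 0 T)
  /-- `ψ` is bounded on every strip `ℝ × [0, T]`. -/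
  bounded : ∀ T : ℝ, ∃ C : ℝ, ∀ x : ℝ, ∀ t ∈ Icc 0 T, ‖ψ x t‖ ≤ C
  /-- `ψ` is twice continuously differentiable in space. -/
  space_smooth : ∀ t : ℝ, 0 < t → ContDiff ℝ 2 (fun x => ψ x t)
  deriv_exists : ∀ x t : ℝ, 0 < t → RegHilferPrabhakarExists α ω γ ρ ν (ψ x) t
  equation : ∀ x t : ℝ, 0 < t →
    regHilferPrabhakar α ω γ ρ ν (ψ x) t = N * iteratedDeriv 2 (fun y => ψ y t) x
  initial : ∀ x : ℝ, ψ x 0 = g x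
  vanishing : ∀ t : ℝ, 0 ≤ t → Tendsto (fun x => ψ x t) (cocompact ℝ) (𝓝 0)

/-- The `n`-th term
`e^{-ikx} E_{α,ρn+1}^{γn}(ω t^α) (-N k²)^n t^{ρn} g*(k)` of the integrand. -/
def heatTerm (α ω γ ρ N : ℝ) (g : ℝ → ℂ) (x t k : ℝ) (n : ℕ) : ℂ :=
  Complex.exp (-Complex.I * k * x) * (mittagLeffler α (ρ * n + 1) (γ * n) (ω * t ^ α) : ℂ)
    * (-N * k ^ 2 : ℂ) ^ n * ((t ^ (ρ * n) : ℝ) : ℂ) * fourierStar g k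

/-- `ψ(x,t) = (1/2π) ∫ ∑_n e^{-ikx} E_{α,ρn+1}^{γn}(ω t^α) (-N k²)^n t^{ρn} g*(k) dk`. -/
def heatSolution (α ω γ ρ N : ℝ) (g : ℝ → ℂ) (x t : ℝ) : ℂ :=
  1 / (2 * Real.pi) * ∫ k : ℝ, ∑' n : ℕ, heatTerm α ω γ ρ N g x t k n

end

/-! Fourier transformation in `x` reduces the problem to one memory equation for each frequency,
with rate `l = N k²`. Its algebra is that of Laplace transforms, although no Laplace transform is
taken: with `x = s^{-ρ}` and `y = s^{-α}`, a double power series `A(x, y)` with geometrically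
bounded coefficients (`IsTame`) and an order `σ > 0` define a convergent series of Riemann-Liouville
kernels (`seriesKernel`), and convolution of kernels is multiplication of power series
(`IsTame.causalConv_seriesKernel`). A Prabhakar kernel corresponds to the binomial series `P_c(y) =
(1 - ω y)^{-c}`. The mode with rate `l` corresponds to `H = 1 / (1 + l x P_γ) = 1 - x Q` with `Q = l
P_γ H`; in time, the relaxation function is one minus the primitive of the decay kernel `q` of `Q`.
The identity `P_{-γ} Q = l H` is the equation of the mode.

Existence needs bounds on `q` that are uniform in `l ≥ 0`. For `γ = 0` the kernel is the resolvent
of `l t^{ρ-1}/Γ(ρ)`: it is nonnegative (`resolvent_pos`) and has integral at most one. For general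
`γ` it is a perturbation by convolution with a kernel `m` that does not depend on `l`; an
exponential weight makes the norm of `m` at most `1/2`, which bounds `q` in `L¹(0, T)`
(`exists_integral_abs_decayKernel_le`). An Euler identity writes `t q(t)` as a primitive of
convolutions of already bounded functions, so `q = O(1/t)` uniformly in `l`
(`exists_mul_abs_decayKernel_le`). Together the two bounds control fractional integrals of `q`; in
particular `l` times the relaxation function is bounded at each `t > 0`. Hence `k² ψ*` is
integrable, which gives two derivatives in `x`, and all exchanges of integrals are licensed by
Fubini's theorem and dominated convergence.

For uniqueness, a difference `w` of two solutions is only known to be bounded, so it is not Fourier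
transformed but tested. Convolution with the Prabhakar kernel of order `ρ` inverts the fractional
derivative and gives `∫ φ w = κ * ∫ φ'' w` with `κ` equal to `N` times that kernel, for compactly
supported and, by cutoffs, for integrable `φ` with two integrable derivatives. For `φ` the Fourier
integral of an amplitude supported in `[-B, B]`, each application of `d²/dx²` costs at most a factor
`(3B)²`; an exponential weight makes the weighted norm of `κ` smaller than half the inverse of this
factor, and iteration forces `∫ φ w = 0` (`IsWeakNull.exists_weight`). Such `φ` include approximate
identities, so `w = 0` (`IsWeakNull.eq_zero`). -/

noncomputable section

/-! ### Riemann-Liouville kernels: Beta integral and growth in the order -/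

/-- The Riemann-Liouville kernel `t^{β-1} / Γ(β)`. -/
def rlKernel (β t : ℝ) : ℝ := t ^ (β - 1) / Real.Gamma β

/-- Causal convolution `∫_0^t f(t-s) g(s) ds`. -/
def causalConv {E : Type*} [NormedAddCommGroup E] [NormedSpace ℝ E] (f : ℝ → ℝ) (g : ℝ → E)
    (t : ℝ) : E :=
  ∫ s in (0 : ℝ)..t, f (t - s) • g s

lemma rlKernel_nonneg {β t : ℝ} (hβ : 0 < β) (ht : 0 ≤ t) : 0 ≤ rlKernel β t :=
  div_nonneg (Real.rpow_nonneg ht _) (Real.Gamma_pos_of_pos hβ).le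

lemma rlKernel_pos {β t : ℝ} (hβ : 0 < β) (ht : 0 < t) : 0 < rlKernel β t :=
  div_pos (Real.rpow_pos_of_pos ht _) (Real.Gamma_pos_of_pos hβ)

lemma integral_rpow_mul_rpow {a b t : ℝ} (ha : 0 < a) (hb : 0 < b) (ht : 0 < t) :
    ∫ s in (0 : ℝ)..t, (t - s) ^ (a - 1) * s ^ (b - 1) =
      t ^ (a + b - 1) * (Real.Gamma a * Real.Gamma b / Real.Gamma (a + b)) := by
  have h := Complex.betaIntegral_scaled (b : ℂ) (a : ℂ) ht
  rw [Complex.betaIntegral_eq_Gamma_mul_div _ _ (by simpa) (by simpa)] at h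
  have h2 : ∫ x in (0 : ℝ)..t, (x : ℂ) ^ ((b : ℂ) - 1) * ((t : ℂ) - x) ^ ((a : ℂ) - 1) =
      ((∫ s in (0 : ℝ)..t, (t - s) ^ (a - 1) * s ^ (b - 1) : ℝ) : ℂ) := by
    rw [← intervalIntegral.integral_ofReal]
    rw [intervalIntegral.integral_of_le ht.le, intervalIntegral.integral_of_le ht.le]
    refine setIntegral_congr_fun measurableSet_Ioc fun x hx => ?_
    rw [Complex.ofReal_mul, Complex.ofReal_cpow (sub_nonneg.2 hx.2), Complex.ofReal_cpow hx.1.le]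
    push_cast
    ring
  rw [h2] at h
  have h3 : (t : ℂ) ^ ((b : ℂ) + a - 1) *
      (Complex.Gamma b * Complex.Gamma a / Complex.Gamma (b + a)) =
      ((t ^ (a + b - 1) * (Real.Gamma a * Real.Gamma b / Real.Gamma (a + b)) : ℝ) : ℂ) := by
    rw [Complex.ofReal_mul, Complex.ofReal_cpow ht.le, Complex.ofReal_div, Complex.ofReal_mul,
      ← Complex.Gamma_ofReal, ← Complex.Gamma_ofReal, ← Complex.Gamma_ofReal]
    push_cast
    rw [add_comm (b : ℂ) a, mul_comm (Complex.Gamma b)]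
  rw [h3] at h
  exact_mod_cast h

lemma integrable_rlKernel_mul {a b t : ℝ} (ha : 0 < a) (hb : 0 < b) (ht : 0 < t) :
    IntervalIntegrable (fun s => rlKernel a (t - s) * rlKernel b s) volume 0 t := by
  have h : IntervalIntegrable (fun s => (t - s) ^ (a - 1) * s ^ (b - 1)) volume 0 t := by
    -- A non-integrable function has integral zero by convention, whereas the Beta integral is
    -- positive.
    by_contra hc
    have := intervalIntegral.integral_undef hc
    rw [integral_rpow_mul_rpow ha hb ht] at this
    have hp : 0 < t ^ (a + b - 1) * (Real.Gamma a * Real.Gamma b / Real.Gamma (a + b)) := by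
      have := Real.Gamma_pos_of_pos ha
      have := Real.Gamma_pos_of_pos hb
      have := Real.Gamma_pos_of_pos (add_pos ha hb)
      positivity
    exact hp.ne' this
  refine (h.const_mul ((Real.Gamma a)⁻¹ * (Real.Gamma b)⁻¹)).congr fun s _ => ?_
  simp only [rlKernel]
  ring

lemma causalConv_rlKernel {a b t : ℝ} (ha : 0 < a) (hb : 0 < b) (ht : 0 < t) :
    ∫ s in (0 : ℝ)..t, rlKernel a (t - s) * rlKernel b s = rlKernel (a + b) t := by
  have h : ∀ s, rlKernel a (t - s) * rlKernel b s =
      ((Real.Gamma a)⁻¹ * (Real.Gamma b)⁻¹) * ((t - s) ^ (a - 1) * s ^ (b - 1)) := by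
    intro s
    simp only [rlKernel]
    ring
  simp_rw [h]
  rw [intervalIntegral.integral_const_mul, integral_rpow_mul_rpow ha hb ht, rlKernel]
  have := (Real.Gamma_pos_of_pos ha).ne'
  have := (Real.Gamma_pos_of_pos hb).ne'
  field_simp

/-- A lower bound for the Gamma function with a free parameter. -/
lemma inv_Gamma_le {β X : ℝ} (hβ : 0 < β) (hX : 0 < X) :
    (Real.Gamma β)⁻¹ ≤ β * Real.exp X * X ^ (-β) := by
  -- Only the part of the Gamma integral over `(X, ∞)` is kept, where `x^β ≥ X^β`. The parameter `X`
  -- stays free, so that `X^{-β}` can beat any given geometric growth.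
  have h1 : X ^ β * Real.exp (-X) ≤ Real.Gamma (β + 1) := by
    rw [Real.Gamma_eq_integral (by linarith)]
    have hint := Real.GammaIntegral_convergent (s := β + 1) (by linarith)
    have hint2 : IntegrableOn (fun x : ℝ => Real.exp (-x)) (Ioi X) :=
      integrableOn_exp_neg_Ioi X
    calc X ^ β * Real.exp (-X) = ∫ x in Ioi X, X ^ β * Real.exp (-x) := by
          rw [integral_const_mul, integral_exp_neg_Ioi]
      _ ≤ ∫ x in Ioi X, Real.exp (-x) * x ^ (β + 1 - 1) := by
          refine setIntegral_mono_on (hint2.const_mul _)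
            (hint.mono_set (Ioi_subset_Ioi hX.le)) measurableSet_Ioi fun x hx => ?_
          rw [mul_comm, add_sub_cancel_right]
          gcongr
          exact le_of_lt hx
      _ ≤ _ := by
          refine setIntegral_mono_set hint ?_ (Ioi_subset_Ioi hX.le).eventuallyLE
          filter_upwards [ae_restrict_mem measurableSet_Ioi] with x hx
          exact mul_nonneg (Real.exp_nonneg _) (Real.rpow_nonneg (le_of_lt hx) _)
  rw [Real.Gamma_add_one hβ.ne'] at h1
  have hG := Real.Gamma_pos_of_pos hβ
  have hXb : 0 < X ^ β := Real.rpow_pos_of_pos hX β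
  rw [Real.rpow_neg hX.le, inv_le_iff_one_le_mul₀ hG]
  rw [Real.exp_neg] at h1
  have he := Real.exp_pos X
  rw [← div_eq_mul_inv, div_le_iff₀ he] at h1
  calc (1 : ℝ) = X ^ β * (X ^ β)⁻¹ := (mul_inv_cancel₀ hXb.ne').symm
    _ ≤ (β * Real.Gamma β * Real.exp X) * (X ^ β)⁻¹ := by gcongr
    _ = _ := by ring

/-- Geometric domination of the terms of a double power series of Riemann-Liouville kernels. -/
lemma pow_mul_rlKernel_le {ρ α : ℝ} (hρ : 0 < ρ) (hα : 0 < α) {M σ T : ℝ} (hM : 0 ≤ M)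
    (hσ : 0 < σ) :
    ∃ D : ℝ, 0 ≤ D ∧ ∀ p : ℕ × ℕ, ∀ t : ℝ, 0 < t → t ≤ T →
      M ^ (p.1 + p.2) * rlKernel (ρ * p.1 + α * p.2 + σ) t
        ≤ D * (1 / 2) ^ (p.1 + p.2) * t ^ (σ - 1) := by
  -- `X` is taken so large that each unit of `n` or `j` contributes a factor at most `1/4`. Half of
  -- this decay absorbs the linear factor `ρ n + α j + σ` from `inv_Gamma_le`, bounded by a multiple
  -- of `2^{n+j}`; the other half is the asserted `(1/2)^{n+j}`.
  have key : ∀ c : ℝ, 0 < c → ∀ᶠ X : ℝ in atTop, M * (T / X) ^ c ≤ 1 / 4 := by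
    intro c hc
    have h1 : Tendsto (fun X : ℝ => T / X) atTop (𝓝 0) := tendsto_const_nhds.div_atTop tendsto_id
    have h2 : Tendsto (fun X : ℝ => M * (T / X) ^ c) atTop (𝓝 (M * 0 ^ c)) :=
      ((h1.rpow_const (Or.inr hc.le))).const_mul M
    rw [Real.zero_rpow hc.ne', mul_zero] at h2
    exact (h2.eventually (gt_mem_nhds (by norm_num : (0 : ℝ) < 1 / 4))).mono fun _ h => h.le
  obtain ⟨X, hX1, hX2, hX0⟩ := ((key ρ hρ).and ((key α hα).and (eventually_gt_atTop 0))).exists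
  refine ⟨Real.exp X * X ^ (-σ) * (ρ + α + σ), by positivity, ?_⟩
  rintro ⟨n, j⟩ t ht htT
  simp only
  have hβ : 0 < ρ * n + α * j + σ := by positivity
  have e1 : t ^ (ρ * n + α * j + σ - 1) = (t ^ ρ) ^ n * (t ^ α) ^ j * t ^ (σ - 1) := by
    rw [← Real.rpow_natCast (t ^ ρ), ← Real.rpow_natCast (t ^ α), ← Real.rpow_mul ht.le,
      ← Real.rpow_mul ht.le, ← Real.rpow_add ht, ← Real.rpow_add ht]
    ring_nf
  have e2 : X ^ (-(ρ * n + α * j + σ)) = ((X ^ ρ) ^ n)⁻¹ * ((X ^ α) ^ j)⁻¹ * X ^ (-σ) := by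
    rw [← Real.rpow_natCast (X ^ ρ), ← Real.rpow_natCast (X ^ α), ← Real.rpow_mul hX0.le,
      ← Real.rpow_mul hX0.le, ← Real.rpow_neg hX0.le, ← Real.rpow_neg hX0.le,
      ← Real.rpow_add hX0, ← Real.rpow_add hX0]
    ring_nf
  have hq : ∀ c : ℝ, 0 < c → M * (T / X) ^ c ≤ 1 / 4 → M * (t / X) ^ c ≤ 1 / 4 := by
    intro c hc h
    refine le_trans ?_ h
    gcongr
  have hn : (M * (t / X) ^ ρ) ^ n ≤ (1 / 4) ^ n := by
    gcongr
    exact hq ρ hρ hX1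
  have hj : (M * (t / X) ^ α) ^ j ≤ (1 / 4) ^ j := by
    gcongr
    exact hq α hα hX2
  have two : ∀ m : ℕ, (m : ℝ) ≤ 2 ^ m := fun m => by exact_mod_cast (Nat.lt_two_pow_self).le
  have hlin : ρ * n + α * j + σ ≤ (ρ + α + σ) * 2 ^ (n + j) := by
    have h1 : (n : ℝ) ≤ 2 ^ (n + j) := (two n).trans (pow_le_pow_right₀ (by norm_num) (by omega))
    have h2 : (j : ℝ) ≤ 2 ^ (n + j) := (two j).trans (pow_le_pow_right₀ (by norm_num) (by omega))
    have h3 : (1 : ℝ) ≤ 2 ^ (n + j) := one_le_pow₀ (by norm_num)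
    nlinarith
  calc M ^ (n + j) * rlKernel (ρ * n + α * j + σ) t
      = M ^ (n + j) * ((t ^ ρ) ^ n * (t ^ α) ^ j * t ^ (σ - 1)) *
          (Real.Gamma (ρ * n + α * j + σ))⁻¹ := by
        rw [rlKernel, e1, div_eq_mul_inv]; ring
    _ ≤ M ^ (n + j) * ((t ^ ρ) ^ n * (t ^ α) ^ j * t ^ (σ - 1)) *
          ((ρ * n + α * j + σ) * Real.exp X * X ^ (-(ρ * n + α * j + σ))) := by
        gcongr
        exact inv_Gamma_le hβ hX0
    _ = (Real.exp X * X ^ (-σ)) * (ρ * n + α * j + σ) *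
          ((M * (t / X) ^ ρ) ^ n * (M * (t / X) ^ α) ^ j) * t ^ (σ - 1) := by
        rw [e2, Real.div_rpow ht.le hX0.le, Real.div_rpow ht.le hX0.le, mul_pow, mul_pow,
          div_pow, div_pow, pow_add]
        field_simp
    _ ≤ (Real.exp X * X ^ (-σ)) * ((ρ + α + σ) * 2 ^ (n + j)) *
          ((1 / 4) ^ n * (1 / 4) ^ j) * t ^ (σ - 1) := by
        gcongr
    _ = _ := by
        rw [← pow_add, show (1 / 4 : ℝ) = (1 / 2) * (1 / 2) by norm_num, mul_pow]
        have : (2 : ℝ) ^ (n + j) * (1 / 2) ^ (n + j) = 1 := by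
          rw [← mul_pow]; norm_num
        linear_combination (Real.exp X * X ^ (-σ) * (ρ + α + σ) * (1 / 2) ^ (n + j) *
          t ^ (σ - 1)) * this

lemma summable_half_pow_prod : Summable fun p : ℕ × ℕ => (1 / 2 : ℝ) ^ (p.1 + p.2) := by
  have h : Summable fun n : ℕ => (1 / 2 : ℝ) ^ n := summable_geometric_two
  simpa [pow_add] using h.mul_of_nonneg h (fun n => by positivity) (fun n => by positivity)

/-! ### Double power series and the calculus of their kernels -/

open PowerSeries in
/-- The coefficient of `x^n y^j` of a power series in `x` over power series in `y`. -/
def biCoeff (A : PowerSeries (PowerSeries ℝ)) (p : ℕ × ℕ) : ℝ := coeff p.2 (coeff p.1 A)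

/-- At most geometric growth of the coefficients. -/
def IsTame (A : PowerSeries (PowerSeries ℝ)) : Prop :=
  ∃ C M : ℝ, 0 ≤ C ∧ 1 ≤ M ∧ ∀ p : ℕ × ℕ, |biCoeff A p| ≤ C * M ^ (p.1 + p.2)

/-- The function `∑ a_{nj} t^{ρn+αj+σ-1} / Γ(ρn+αj+σ)` of `t`, with Laplace transform
`s^{-σ} A(s^{-ρ}, s^{-α})`. -/
def seriesKernel (ρ α : ℝ) (A : PowerSeries (PowerSeries ℝ)) (σ t : ℝ) : ℝ :=
  ∑' p : ℕ × ℕ, biCoeff A p * rlKernel (ρ * p.1 + α * p.2 + σ) t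

/-- Makes the Cauchy product of double series available: pairs of bi-indices can be resummed along
`sigmaAntidiagonalEquivProd`. -/
instance : Finset.HasAntidiagonal (ℕ × ℕ) where
  antidiagonal m := (Finset.HasAntidiagonal.antidiagonal m.1 ×ˢ Finset.HasAntidiagonal.antidiagonal m.2).map
    (Equiv.prodProdProdComm ℕ ℕ ℕ ℕ).toEmbedding
  mem_antidiagonal {m a} := by
    obtain ⟨⟨a, b⟩, ⟨c, d⟩⟩ := a
    obtain ⟨m, n⟩ := m
    simp [Prod.ext_iff]

lemma sum_antidiagonal_prod (m : ℕ × ℕ) (f : (ℕ × ℕ) × (ℕ × ℕ) → ℝ) :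
    ∑ z ∈ Finset.HasAntidiagonal.antidiagonal m, f z =
      ∑ k ∈ Finset.HasAntidiagonal.antidiagonal m.1, ∑ l ∈ Finset.HasAntidiagonal.antidiagonal m.2,
        f ((k.1, l.1), (k.2, l.2)) := by
  rw [← Finset.sum_product' (Finset.HasAntidiagonal.antidiagonal m.1) (Finset.HasAntidiagonal.antidiagonal m.2)
    (fun k l => f ((k.1, l.1), (k.2, l.2)))]
  exact Finset.sum_map _ _ _

lemma biCoeff_mul (A B : PowerSeries (PowerSeries ℝ)) (m : ℕ × ℕ) :
    biCoeff (A * B) m = ∑ z ∈ Finset.HasAntidiagonal.antidiagonal m, biCoeff A z.1 * biCoeff B z.2 := by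
  rw [sum_antidiagonal_prod, biCoeff, PowerSeries.coeff_mul, map_sum]
  refine Finset.sum_congr rfl fun k _ => ?_
  rw [PowerSeries.coeff_mul]
  rfl

lemma biCoeff_add (A B : PowerSeries (PowerSeries ℝ)) (p : ℕ × ℕ) :
    biCoeff (A + B) p = biCoeff A p + biCoeff B p := by simp [biCoeff]

lemma biCoeff_sub (A B : PowerSeries (PowerSeries ℝ)) (p : ℕ × ℕ) :
    biCoeff (A - B) p = biCoeff A p - biCoeff B p := by simp [biCoeff]

/-- The constant double power series. -/
def biConst (a : ℝ) : PowerSeries (PowerSeries ℝ) := PowerSeries.C (PowerSeries.C a)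

lemma biCoeff_biConst_mul (a : ℝ) (A : PowerSeries (PowerSeries ℝ)) (p : ℕ × ℕ) :
    biCoeff (biConst a * A) p = a * biCoeff A p := by simp [biCoeff, biConst]

lemma biCoeff_rescale (l : ℝ) (A : PowerSeries (PowerSeries ℝ)) (p : ℕ × ℕ) :
    biCoeff (PowerSeries.rescale (PowerSeries.C l) A) p = l ^ p.1 * biCoeff A p := by
  simp [biCoeff, PowerSeries.coeff_rescale, ← map_pow]

namespace IsTame

variable {A B : PowerSeries (PowerSeries ℝ)}

lemma add (hA : IsTame A) (hB : IsTame B) : IsTame (A + B) := by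
  obtain ⟨C, M, hC, hM, h⟩ := hA
  obtain ⟨C', M', hC', hM', h'⟩ := hB
  refine ⟨C + C', max M M', by positivity, le_max_of_le_left hM, fun p => ?_⟩
  rw [biCoeff_add, add_mul]
  refine (abs_add_le _ _).trans (add_le_add ((h p).trans ?_) ((h' p).trans ?_))
  · gcongr; exact le_max_left _ _
  · gcongr; exact le_max_right _ _

lemma mul (hA : IsTame A) (hB : IsTame B) : IsTame (A * B) := by
  obtain ⟨C, M, hC, hM, h⟩ := hA
  obtain ⟨C', M', hC', hM', h'⟩ := hB
  -- The factor `2` pays for the number of terms of the Cauchy product, `(p.1 + 1) (p.2 + 1) ≤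
  -- 2^{p.1 + p.2}`.
  refine ⟨C * C', 2 * max M M', by positivity, ?_, fun p => ?_⟩
  · nlinarith [le_max_left M M']
  have two : ∀ m : ℕ, ((m : ℝ) + 1) ≤ 2 ^ m := fun m => by exact_mod_cast Nat.lt_two_pow_self
  have hcard : ((Finset.HasAntidiagonal.antidiagonal p).card : ℝ) ≤ 2 ^ (p.1 + p.2) := by
    have : (Finset.HasAntidiagonal.antidiagonal p).card = (p.1 + 1) * (p.2 + 1) := by
      change ((Finset.HasAntidiagonal.antidiagonal p.1 ×ˢ Finset.HasAntidiagonal.antidiagonal p.2).map _).card = _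
      simp
    rw [this, pow_add]
    push_cast
    exact mul_le_mul (two _) (two _) (by positivity) (by positivity)
  rw [biCoeff_mul]
  refine (Finset.abs_sum_le_sum_abs _ _).trans ?_
  have hterm : ∀ z ∈ Finset.HasAntidiagonal.antidiagonal p, |biCoeff A z.1 * biCoeff B z.2| ≤
      C * C' * max M M' ^ (p.1 + p.2) := by
    intro z hz
    rw [Finset.HasAntidiagonal.mem_antidiagonal] at hz
    rw [abs_mul, ← hz]
    calc |biCoeff A z.1| * |biCoeff B z.2|
        ≤ (C * M ^ (z.1.1 + z.1.2)) * (C' * M' ^ (z.2.1 + z.2.2)) := by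
          gcongr
          · exact h _
          · exact h' _
      _ ≤ (C * max M M' ^ (z.1.1 + z.1.2)) * (C' * max M M' ^ (z.2.1 + z.2.2)) := by
          gcongr
          · exact le_max_left _ _
          · exact le_max_right _ _
      _ = _ := by simp only [Prod.fst_add, Prod.snd_add]; ring
  refine (Finset.sum_le_card_nsmul _ _ _ hterm).trans ?_
  rw [nsmul_eq_mul, mul_pow]
  calc _ ≤ (2 : ℝ) ^ (p.1 + p.2) * (C * C' * max M M' ^ (p.1 + p.2)) := by gcongr
    _ = _ := by ring

lemma biConst (a : ℝ) : IsTame (biConst a) := by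
  refine ⟨|a|, 1, abs_nonneg _, le_rfl, fun p => ?_⟩
  simp only [biCoeff, _root_.biConst, PowerSeries.coeff_C, one_pow, mul_one]
  split_ifs
  · rw [PowerSeries.coeff_C]; split_ifs <;> simp
  · simp

lemma one : IsTame 1 := by simpa [_root_.biConst] using biConst 1

lemma sub (hA : IsTame A) (hB : IsTame B) : IsTame (A - B) := by
  have h : A - B = A + _root_.biConst (-1) * B := by simp [_root_.biConst, sub_eq_add_neg]
  rw [h]
  exact hA.add ((biConst _).mul hB)

lemma X : IsTame PowerSeries.X := by
  refine ⟨1, 1, zero_le_one, le_rfl, fun p => ?_⟩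
  simp only [biCoeff, PowerSeries.coeff_X, one_pow, mul_one]
  split_ifs
  · rw [PowerSeries.coeff_one]; split_ifs <;> simp
  · simp

lemma CX : IsTame (PowerSeries.C PowerSeries.X) := by
  refine ⟨1, 1, zero_le_one, le_rfl, fun p => ?_⟩
  simp only [biCoeff, PowerSeries.coeff_C, one_pow, mul_one]
  split_ifs
  · rw [PowerSeries.coeff_X]; split_ifs <;> simp
  · simp

lemma rescale (hA : IsTame A) (l : ℝ) : IsTame (PowerSeries.rescale (PowerSeries.C l) A) := by
  obtain ⟨C, M, hC, hM, h⟩ := hA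
  refine ⟨C, M * max 1 |l|, hC, ?_, fun p => ?_⟩
  · nlinarith [le_max_left 1 |l|]
  rw [biCoeff_rescale, abs_mul, abs_pow, mul_pow]
  calc |l| ^ p.1 * |biCoeff A p| ≤ max 1 |l| ^ (p.1 + p.2) * (C * M ^ (p.1 + p.2)) := by
        gcongr
        · calc |l| ^ p.1 ≤ max 1 |l| ^ p.1 := by gcongr; exact le_max_right _ _
            _ ≤ _ := pow_le_pow_right₀ (le_max_left _ _) (by omega)
        · exact h p
    _ = _ := by ring

end IsTame

/-- A dilation with `|l| ≤ Λ` only replaces the growth rate `M` by `M * max 1 Λ`, so one constant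
serves all such `l`. This uniformity gives continuity in the rate and the time jointly. -/
lemma rlKernel_term_bound {ρ α : ℝ} (hρ : 0 < ρ) (hα : 0 < α)
    {A : PowerSeries (PowerSeries ℝ)} (hA : IsTame A) {σ : ℝ} (hσ : 0 < σ) (Λ T : ℝ) :
    ∃ D : ℝ, 0 ≤ D ∧ ∀ l t : ℝ, |l| ≤ Λ → 0 < t → t ≤ T → ∀ p : ℕ × ℕ,
      |biCoeff (PowerSeries.rescale (PowerSeries.C l) A) p *
        rlKernel (ρ * p.1 + α * p.2 + σ) t| ≤ D * (1 / 2) ^ (p.1 + p.2) * t ^ (σ - 1) := by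
  obtain ⟨C, M, hC, hM, h⟩ := hA
  obtain ⟨D, hD, hb⟩ := pow_mul_rlKernel_le hρ hα (M := M * max 1 Λ) (by positivity) hσ
  refine ⟨C * D, by positivity, fun l t hl ht htT p => ?_⟩
  have hpos : 0 ≤ rlKernel (ρ * p.1 + α * p.2 + σ) t := rlKernel_nonneg (by positivity) ht.le
  rw [biCoeff_rescale, abs_mul, abs_mul, abs_pow, abs_of_nonneg hpos]
  have h1 : |l| ^ p.1 ≤ max 1 Λ ^ (p.1 + p.2) := by
    calc |l| ^ p.1 ≤ max 1 Λ ^ p.1 := by gcongr; exact hl.trans (le_max_right _ _)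
      _ ≤ _ := pow_le_pow_right₀ (le_max_left _ _) (by omega)
  calc |l| ^ p.1 * |biCoeff A p| * rlKernel (ρ * p.1 + α * p.2 + σ) t
      ≤ max 1 Λ ^ (p.1 + p.2) * (C * M ^ (p.1 + p.2)) *
          rlKernel (ρ * p.1 + α * p.2 + σ) t := by
        gcongr
        exact h p
    _ = C * ((M * max 1 Λ) ^ (p.1 + p.2) * rlKernel (ρ * p.1 + α * p.2 + σ) t) := by
        rw [mul_pow]; ring
    _ ≤ C * (D * (1 / 2) ^ (p.1 + p.2) * t ^ (σ - 1)) := by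
        exact mul_le_mul_of_nonneg_left (hb p t ht htT) hC
    _ = _ := by ring

lemma rescale_C_one (A : PowerSeries (PowerSeries ℝ)) :
    PowerSeries.rescale (PowerSeries.C (1 : ℝ)) A = A := by
  simp

namespace IsTame

variable {ρ α : ℝ} {A B : PowerSeries (PowerSeries ℝ)} {σ τ : ℝ}

lemma summable (hA : IsTame A) (hρ : 0 < ρ) (hα : 0 < α) (hσ : 0 < σ) {t : ℝ} (ht : 0 < t) :
    Summable fun p : ℕ × ℕ => biCoeff A p * rlKernel (ρ * p.1 + α * p.2 + σ) t := by
  obtain ⟨D, -, hb⟩ := rlKernel_term_bound hρ hα hA hσ 1 t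
  refine Summable.of_norm_bounded ((summable_half_pow_prod.mul_left D).mul_right (t ^ (σ - 1)))
    fun p => ?_
  have := hb 1 t (by simp) ht le_rfl p
  rwa [rescale_C_one] at this

lemma hasSum (hA : IsTame A) (hρ : 0 < ρ) (hα : 0 < α) (hσ : 0 < σ) {t : ℝ} (ht : 0 < t) :
    HasSum (fun p : ℕ × ℕ => biCoeff A p * rlKernel (ρ * p.1 + α * p.2 + σ) t)
      (seriesKernel ρ α A σ t) :=
  (hA.summable hρ hα hσ ht).hasSum

lemma seriesKernel_bound (hA : IsTame A) (hρ : 0 < ρ) (hα : 0 < α) (hσ : 0 < σ)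
    (T : ℝ) :
    ∃ D : ℝ, 0 ≤ D ∧ ∀ t : ℝ, 0 < t → t ≤ T → |seriesKernel ρ α A σ t| ≤ D * t ^ (σ - 1) := by
  obtain ⟨D, hD, hb⟩ := rlKernel_term_bound hρ hα hA hσ 1 T
  refine ⟨D * ∑' p : ℕ × ℕ, (1 / 2 : ℝ) ^ (p.1 + p.2), by positivity, fun t ht htT => ?_⟩
  have h2 := (summable_half_pow_prod.mul_left D).mul_right (t ^ (σ - 1))
  rw [← Real.norm_eq_abs]
  refine (tsum_of_norm_bounded (f := fun p : ℕ × ℕ =>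
    biCoeff A p * rlKernel (ρ * p.1 + α * p.2 + σ) t) h2.hasSum fun p => ?_).trans_eq ?_
  · have := hb 1 t (by simp) ht htT p
    rwa [rescale_C_one] at this
  · rw [tsum_mul_right, tsum_mul_left]

lemma seriesKernel_add (hA : IsTame A) (hB : IsTame B) (hρ : 0 < ρ) (hα : 0 < α) (hσ : 0 < σ)
    {t : ℝ} (ht : 0 < t) :
    seriesKernel ρ α (A + B) σ t = seriesKernel ρ α A σ t + seriesKernel ρ α B σ t := by
  rw [← ((hA.hasSum hρ hα hσ ht).add (hB.hasSum hρ hα hσ ht)).tsum_eq]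
  simp only [seriesKernel, biCoeff_add, add_mul]

lemma seriesKernel_sub (hA : IsTame A) (hB : IsTame B) (hρ : 0 < ρ) (hα : 0 < α) (hσ : 0 < σ)
    {t : ℝ} (ht : 0 < t) :
    seriesKernel ρ α (A - B) σ t = seriesKernel ρ α A σ t - seriesKernel ρ α B σ t := by
  rw [← ((hA.hasSum hρ hα hσ ht).sub (hB.hasSum hρ hα hσ ht)).tsum_eq]
  simp only [seriesKernel, biCoeff_sub, sub_mul]

/-- Convolution of series kernels is multiplication of the power series. -/
lemma causalConv_seriesKernel (hA : IsTame A) (hB : IsTame B) (hρ : 0 < ρ) (hα : 0 < α)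
    (hσ : 0 < σ) (hτ : 0 < τ) {t : ℝ} (ht : 0 < t) :
    causalConv (seriesKernel ρ α A σ) (seriesKernel ρ α B τ) t =
      seriesKernel ρ α (A * B) (σ + τ) t := by
  set d : ℕ × ℕ → ℝ := fun p => ρ * p.1 + α * p.2 with hd
  have hdn : ∀ p, 0 ≤ d p := fun p => by positivity
  set F : (ℕ × ℕ) × (ℕ × ℕ) → ℝ → ℝ := fun z s =>
    (biCoeff A z.1 * biCoeff B z.2) * (rlKernel (d z.1 + σ) (t - s) * rlKernel (d z.2 + τ) s)
    with hF
  have hFint : ∀ z, Integrable (F z) (volume.restrict (Ioc 0 t)) := fun z =>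
    ((intervalIntegrable_iff_integrableOn_Ioc_of_le ht.le).1
      (integrable_rlKernel_mul (by have := hdn z.1; positivity)
        (by have := hdn z.2; positivity) ht)).const_mul _
  have hker : ∀ z : (ℕ × ℕ) × (ℕ × ℕ),
      ∫ s in Ioc 0 t, rlKernel (d z.1 + σ) (t - s) * rlKernel (d z.2 + τ) s =
        rlKernel (d (z.1 + z.2) + (σ + τ)) t := by
    intro z
    rw [← intervalIntegral.integral_of_le ht.le, causalConv_rlKernel
      (by have := hdn z.1; positivity) (by have := hdn z.2; positivity) ht]
    congr 1
    simp only [hd, Prod.fst_add, Prod.snd_add]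
    push_cast
    ring
  have hFval : ∀ z, ∫ s in Ioc 0 t, F z s =
      (biCoeff A z.1 * biCoeff B z.2) * rlKernel (d (z.1 + z.2) + (σ + τ)) t := by
    intro z
    rw [← hker z, ← integral_const_mul]
  have hFnorm : ∀ z, ∫ s in Ioc 0 t, ‖F z s‖ =
      |biCoeff A z.1 * biCoeff B z.2| * rlKernel (d (z.1 + z.2) + (σ + τ)) t := by
    intro z
    rw [← hker z, ← integral_const_mul]
    refine setIntegral_congr_fun measurableSet_Ioc fun s hs => ?_
    have h1 : 0 ≤ rlKernel (d z.1 + σ) (t - s) :=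
      rlKernel_nonneg (by have := hdn z.1; positivity) (by linarith [hs.2])
    have h2 : 0 ≤ rlKernel (d z.2 + τ) s :=
      rlKernel_nonneg (by have := hdn z.2; positivity) hs.1.le
    rw [Real.norm_eq_abs, abs_mul, abs_of_nonneg (mul_nonneg h1 h2)]
  -- By the Beta integral each `L¹` norm is a coefficient times a kernel whose order is the sum of
  -- the two orders, so the geometric domination applies at the bi-index `z.1 + z.2`.
  have hsumm : Summable fun z => ∫ s in Ioc 0 t, ‖F z s‖ := by
    obtain ⟨C, M, hC, hM, h⟩ := hA
    obtain ⟨C', M', hC', hM', h'⟩ := hB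
    obtain ⟨D, hD, hb⟩ := pow_mul_rlKernel_le hρ hα (M := max M M') (by positivity)
      (T := t) (add_pos hσ hτ)
    have hs := (((summable_half_pow_prod.mul_of_nonneg summable_half_pow_prod
      (fun p => by positivity) (fun p => by positivity)).mul_left (C * C' * D)).mul_right
        (t ^ (σ + τ - 1)))
    refine Summable.of_norm_bounded hs fun z => ?_
    rw [hFnorm, Real.norm_eq_abs, abs_mul, abs_abs, abs_of_nonneg
      (rlKernel_nonneg (by have := hdn (z.1 + z.2); positivity) ht.le : 0 ≤ rlKernel _ t), abs_mul]
    calc |biCoeff A z.1| * |biCoeff B z.2| * rlKernel (d (z.1 + z.2) + (σ + τ)) t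
        ≤ (C * max M M' ^ (z.1.1 + z.1.2)) * (C' * max M M' ^ (z.2.1 + z.2.2)) *
          rlKernel (d (z.1 + z.2) + (σ + τ)) t := by
          have := rlKernel_nonneg (β := d (z.1 + z.2) + (σ + τ))
            (by have := hdn (z.1 + z.2); positivity) ht.le
          gcongr
          · exact (h _).trans (by gcongr; exact le_max_left _ _)
          · exact (h' _).trans (by gcongr; exact le_max_right _ _)
      _ = C * C' * (max M M' ^ ((z.1 + z.2).1 + (z.1 + z.2).2) *
          rlKernel (d (z.1 + z.2) + (σ + τ)) t) := by
          simp only [Prod.fst_add, Prod.snd_add]; ring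
      _ ≤ C * C' * (D * (1 / 2) ^ ((z.1 + z.2).1 + (z.1 + z.2).2) * t ^ (σ + τ - 1)) := by
          exact mul_le_mul_of_nonneg_left (hb (z.1 + z.2) t ht le_rfl) (by positivity)
      _ = _ := by simp only [Prod.fst_add, Prod.snd_add]; ring
  have hmain := hasSum_integral_of_summable_integral_norm hFint hsumm
  have hLHS : causalConv (seriesKernel ρ α A σ) (seriesKernel ρ α B τ) t =
      ∫ s in Ioc 0 t, ∑' z, F z s := by
    -- The expansions are valid only at positive arguments, so both ends `s = 0` and `s = t` are
    -- discarded.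
    rw [causalConv, intervalIntegral.integral_of_le ht.le, integral_Ioc_eq_integral_Ioo,
      integral_Ioc_eq_integral_Ioo]
    refine setIntegral_congr_fun measurableSet_Ioo fun s hs => ?_
    have h1 := hA.summable hρ hα hσ (sub_pos.2 hs.2)
    have h2 := hB.summable hρ hα hτ hs.1
    simp only [smul_eq_mul, seriesKernel]
    rw [tsum_mul_tsum_of_summable_norm h1.norm h2.norm]
    refine tsum_congr fun z => ?_
    simp only [hF, hd]
    ring
  rw [hLHS, ← hmain.tsum_eq]
  simp_rw [hFval]
  -- Pairs of bi-indices with the same sum share the same kernel; collecting them produces the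
  -- coefficients of the product.
  rw [← Finset.HasAntidiagonal.sigmaAntidiagonalEquivProd.tsum_eq]
  have hs2 : Summable fun z : (ℕ × ℕ) × (ℕ × ℕ) =>
      (biCoeff A z.1 * biCoeff B z.2) * rlKernel (d (z.1 + z.2) + (σ + τ)) t := by
    have := hmain.summable
    simpa only [hFval] using this
  have hs3 := (Finset.HasAntidiagonal.sigmaAntidiagonalEquivProd (A := ℕ × ℕ)).summable_iff.2 hs2
  refine (hs3.tsum_sigma' (fun n => (hasSum_fintype _).summable)).trans ?_
  rw [seriesKernel]
  refine tsum_congr fun m => ?_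
  rw [tsum_fintype, biCoeff_mul, Finset.sum_mul]
  rw [← Finset.sum_coe_sort (Finset.HasAntidiagonal.antidiagonal m)]
  refine Finset.sum_congr rfl fun z _ => ?_
  have hz := Finset.HasAntidiagonal.mem_antidiagonal.1 z.2
  change biCoeff A z.1.1 * biCoeff B z.1.2 * rlKernel (d (z.1.1 + z.1.2) + (σ + τ)) t = _
  rw [hz]

end IsTame

lemma tsum_eq_tsum_comp_of_injective {κ ι : Type*} {e : κ → ι} (he : Function.Injective e) {f : ι → ℝ}
    (h : ∀ i, i ∉ range e → f i = 0) : ∑' i, f i = ∑' k, f (e k) :=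
  (he.tsum_eq (fun i hi => by_contra fun hc => hi (h i hc))).symm

section shifts

variable {ρ α : ℝ} (A : PowerSeries (PowerSeries ℝ)) (σ t : ℝ)

lemma seriesKernel_biConst_mul (a : ℝ) :
    seriesKernel ρ α (biConst a * A) σ t = a * seriesKernel ρ α A σ t := by
  simp only [seriesKernel, biCoeff_biConst_mul, mul_assoc, tsum_mul_left]

/-- The variable `x` stands for `s^{-ρ}`, that is, for a fractional integration of order `ρ`. After
the index shift the missing terms have coefficient zero. -/
lemma seriesKernel_X_mul :
    seriesKernel ρ α (PowerSeries.X * A) σ t = seriesKernel ρ α A (σ + ρ) t := by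
  have he : Function.Injective (fun p : ℕ × ℕ => (p.1 + 1, p.2)) := by
    rintro ⟨a, b⟩ ⟨c, d⟩ h
    simpa using h
  rw [seriesKernel, tsum_eq_tsum_comp_of_injective he]
  · refine tsum_congr fun p => ?_
    simp only [biCoeff, PowerSeries.coeff_succ_X_mul]
    push_cast
    ring_nf
  · rintro ⟨n, j⟩ hn
    rcases n with _ | n
    · simp [biCoeff]
    · exact absurd ⟨(n, j), rfl⟩ hn

lemma seriesKernel_Y_mul :
    seriesKernel ρ α (PowerSeries.C PowerSeries.X * A) σ t = seriesKernel ρ α A (σ + α) t := by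
  have he : Function.Injective (fun p : ℕ × ℕ => (p.1, p.2 + 1)) := by
    rintro ⟨a, b⟩ ⟨c, d⟩ h
    simpa using h
  rw [seriesKernel, tsum_eq_tsum_comp_of_injective he]
  · refine tsum_congr fun p => ?_
    simp only [biCoeff, PowerSeries.coeff_C_mul, PowerSeries.coeff_succ_X_mul]
    push_cast
    ring_nf
  · rintro ⟨n, j⟩ hn
    rcases j with _ | j
    · simp [biCoeff]
    · exact absurd ⟨(n, j), rfl⟩ hn

lemma seriesKernel_one : seriesKernel ρ α 1 σ t = rlKernel σ t := by
  rw [seriesKernel, tsum_eq_single (0, 0)]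
  · simp [biCoeff]
  · rintro ⟨n, j⟩ h
    have : biCoeff 1 (n, j) = 0 := by
      simp only [biCoeff, PowerSeries.coeff_one]
      split_ifs with h1
      · rw [PowerSeries.coeff_one, if_neg]
        rintro rfl
        exact h (by simp [h1])
      · simp
    rw [this, zero_mul]

end shifts

lemma continuousOn_rlKernel (β : ℝ) : ContinuousOn (rlKernel β) (Ioi 0) := fun t ht =>
  ((Real.continuousAt_rpow_const t _ (Or.inl (ne_of_gt ht))).div_const _).continuousWithinAt

/-- Joint continuity of a series kernel in the time and a dilation parameter. -/
lemma IsTame.continuousOn_rescale {A : PowerSeries (PowerSeries ℝ)} (hA : IsTame A) {ρ α σ : ℝ}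
    (hρ : 0 < ρ) (hα : 0 < α) (hσ : 0 < σ) :
    ContinuousOn (fun z : ℝ × ℝ =>
      seriesKernel ρ α (PowerSeries.rescale (PowerSeries.C z.1) A) σ z.2) {z | 0 < z.2} := by
  intro z hz
  have hz : 0 < z.2 := hz
  -- A neighbourhood bounded in the dilation parameter and bounded away from `t = 0`, on which the
  -- geometric majorant is uniform.
  set s : Set (ℝ × ℝ) := {w | |w.1| < |z.1| + 1 ∧ z.2 / 2 < w.2 ∧ w.2 < z.2 + 1} with hs
  have hso : IsOpen s := by
    have h1 : Continuous fun w : ℝ × ℝ => |w.1| := by fun_prop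
    exact (isOpen_lt h1 continuous_const).inter
      ((isOpen_lt continuous_const continuous_snd).inter (isOpen_lt continuous_snd continuous_const))
  have hzs : z ∈ s := ⟨by linarith, by linarith, by linarith⟩
  obtain ⟨D, hD, hb⟩ := rlKernel_term_bound hρ hα hA hσ (|z.1| + 1) (z.2 + 1)
  have hcpt : ∃ K : ℝ, ∀ w ∈ s, w.2 ^ (σ - 1) ≤ K := by
    have hc : ContinuousOn (fun t : ℝ => t ^ (σ - 1)) (Icc (z.2 / 2) (z.2 + 1)) := fun t ht =>
      (Real.continuousAt_rpow_const t _ (Or.inl (by linarith [ht.1]))).continuousWithinAt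
    obtain ⟨K, hK⟩ := isCompact_Icc.bddAbove_image hc
    exact ⟨K, fun w hw => hK ⟨w.2, ⟨hw.2.1.le, hw.2.2.le⟩, rfl⟩⟩
  obtain ⟨K, hK⟩ := hcpt
  have hcont : ContinuousOn (fun z : ℝ × ℝ =>
      seriesKernel ρ α (PowerSeries.rescale (PowerSeries.C z.1) A) σ z.2) s := by
    refine continuousOn_tsum (u := fun p : ℕ × ℕ => D * (1 / 2) ^ (p.1 + p.2) * K) ?_
      ((summable_half_pow_prod.mul_left D).mul_right K) ?_
    · intro p
      simp only [biCoeff_rescale]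
      refine ContinuousOn.mul (by fun_prop) ?_
      exact (continuousOn_rlKernel _).comp continuousOn_snd fun w hw => by
        have : z.2 / 2 < w.2 := hw.2.1
        exact lt_trans (by linarith) this
    · intro p w hw
      have hw2 : 0 < w.2 := lt_trans (by linarith) hw.2.1
      refine (hb w.1 w.2 hw.1.le hw2 hw.2.2.le p).trans ?_
      gcongr
      exact hK w hw
  exact (hcont.continuousAt (hso.mem_nhds hzs)).continuousWithinAt

lemma IsTame.continuousOn_seriesKernel {A : PowerSeries (PowerSeries ℝ)} (hA : IsTame A)
    {ρ α σ : ℝ} (hρ : 0 < ρ) (hα : 0 < α) (hσ : 0 < σ) :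
    ContinuousOn (seriesKernel ρ α A σ) (Ioi 0) := by
  have h := (hA.continuousOn_rescale hρ hα hσ).comp
    (f := fun t : ℝ => ((1 : ℝ), t)) (s := Ioi 0) (by fun_prop) (fun t ht => ht)
  simpa only [Function.comp_def, rescale_C_one] using h

/-- Multiplication by `t` is, up to a shift of the order, a derivation on the power series. -/
lemma mul_seriesKernel {A B : PowerSeries (PowerSeries ℝ)} {ρ α σ t : ℝ}
    (hρ : 0 < ρ) (hα : 0 < α) (hσ : 0 < σ) (ht : 0 < t)
    (h : ∀ p : ℕ × ℕ, biCoeff B p = (ρ * p.1 + α * p.2 + σ) * biCoeff A p) :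
    t * seriesKernel ρ α A σ t = seriesKernel ρ α B (σ + 1) t := by
  rw [seriesKernel, seriesKernel, ← tsum_mul_left]
  refine tsum_congr fun p => ?_
  have hβ : 0 < ρ * p.1 + α * p.2 + σ := by positivity
  -- `t · t^{β-1}/Γ(β) = β · t^β/Γ(β+1)`, because `Γ(β+1) = β Γ(β)`.
  rw [h p, rlKernel, rlKernel, ← add_assoc, Real.Gamma_add_one hβ.ne', add_sub_cancel_right]
  have hG := (Real.Gamma_pos_of_pos hβ).ne'
  rw [Real.rpow_sub_one ht.ne']
  field_simp

/-! ### Binomial series and the algebra of the resolvent -/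

/-- The binomial series `(1 - ω y)^{-c} = ∑ (c)_j ω^j y^j / j!`. -/
def pochSeries (ω c : ℝ) : PowerSeries ℝ :=
  PowerSeries.mk fun j => (ascPochhammer ℝ j).eval c / (j.factorial : ℝ) * ω ^ j

lemma ascPochhammer_eval_div_factorial (c : ℝ) (j : ℕ) :
    (ascPochhammer ℝ j).eval c / (j.factorial : ℝ) = (-1) ^ j * Ring.choose (-c) j := by
  have h := Ring.factorial_nsmul_multichoose_eq_ascPochhammer c j
  rw [Polynomial.ascPochhammer_smeval_eq_eval, nsmul_eq_mul] at h
  rw [← h, mul_div_cancel_left₀ _ (by positivity), Ring.choose_neg]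
  simp only [Units.smul_def, Int.cast_negOnePow_natCast, zsmul_eq_mul]
  rw [Ring.multichoose_eq, ← mul_assoc, ← mul_pow]
  simp

lemma pochSeries_eq (ω c : ℝ) :
    pochSeries ω c = PowerSeries.rescale (-ω) (PowerSeries.binomialSeries ℝ (-c)) := by
  ext j
  rw [pochSeries, PowerSeries.coeff_mk, ascPochhammer_eval_div_factorial, PowerSeries.coeff_rescale,
    PowerSeries.binomialSeries_coeff, neg_pow ω, smul_eq_mul]
  ring

/-- The Chu-Vandermonde identity, inherited from the binomial series. It is the source of the
semigroup law of the Prabhakar kernels. -/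
lemma pochSeries_add (ω b c : ℝ) : pochSeries ω (b + c) = pochSeries ω b * pochSeries ω c := by
  rw [pochSeries_eq, pochSeries_eq, pochSeries_eq, neg_add, PowerSeries.binomialSeries_add, map_mul]

lemma pochSeries_zero (ω : ℝ) : pochSeries ω 0 = 1 := by
  rw [pochSeries_eq, neg_zero, PowerSeries.binomialSeries_zero, map_one]

/-- Reduces the growth of `(c)_j / j!` to a natural parameter, where the quotient is a binomial
coefficient and is bounded by a power of two. -/
lemma abs_ascPochhammer_eval_le (c : ℝ) (j : ℕ) :
    |(ascPochhammer ℝ j).eval c| ≤ (ascPochhammer ℝ j).eval (⌈|c|⌉₊ : ℝ) := by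
  induction j with
  | zero => simp
  | succ j ih =>
    rw [ascPochhammer_succ_eval, ascPochhammer_succ_eval, abs_mul]
    have h1 : |c + j| ≤ (⌈|c|⌉₊ : ℝ) + j := by
      refine (abs_add_le _ _).trans ?_
      rw [Nat.abs_cast]
      gcongr
      exact Nat.le_ceil _
    exact mul_le_mul ih h1 (abs_nonneg _) ((abs_nonneg _).trans ih)

lemma abs_coeff_pochSeries_le (ω c : ℝ) (j : ℕ) :
    |PowerSeries.coeff j (pochSeries ω c)| ≤ 2 ^ (⌈|c|⌉₊ + j) * |ω| ^ j := by
  rw [pochSeries, PowerSeries.coeff_mk, abs_mul, abs_pow, abs_div, Nat.abs_cast]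
  gcongr
  rw [div_le_iff₀ (by positivity)]
  refine (abs_ascPochhammer_eval_le c j).trans ?_
  rw [← ascPochhammer_eval_cast, ascPochhammer_nat_eq_ascFactorial]
  rcases j with _ | j
  · simp; exact one_le_pow₀ (by norm_num)
  have h2 : (⌈|c|⌉₊).ascFactorial (j + 1) ≤ 2 ^ (⌈|c|⌉₊ + (j + 1)) * (j + 1).factorial := by
    rw [Nat.ascFactorial_eq_factorial_mul_choose', mul_comm]
    gcongr
    exact (Nat.choose_le_two_pow _ _).trans (Nat.pow_le_pow_right (by norm_num) (by omega))
  exact_mod_cast h2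

/-- The double power series `∑ P_{c+γn}(y) x^n`. -/
def pochFamily (ω γ c : ℝ) : PowerSeries (PowerSeries ℝ) :=
  PowerSeries.mk fun n => pochSeries ω (c + γ * n)

/-- The coefficient bound is exponential in `⌈|c + γ n|⌉ + j`, and this exponent grows at most
linearly in `n + j`. -/
lemma isTame_pochFamily (ω c : ℝ) {γ : ℝ} (hγ : 0 ≤ γ) : IsTame (pochFamily ω γ c) := by
  refine ⟨2 ^ (⌈|c|⌉₊ + 1), 2 ^ (⌈γ⌉₊ + 1) * (1 + |ω|), by positivity, ?_, fun p => ?_⟩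
  · exact one_le_mul_of_one_le_of_one_le (one_le_pow₀ (by norm_num)) (by simp)
  rw [biCoeff, pochFamily, PowerSeries.coeff_mk]
  refine (abs_coeff_pochSeries_le _ _ _).trans ?_
  have hceil : ⌈|c + γ * p.1|⌉₊ ≤ ⌈|c|⌉₊ + ⌈γ⌉₊ * p.1 := by
    refine Nat.ceil_le.2 ((abs_add_le _ _).trans ?_)
    push_cast
    rw [abs_mul, abs_of_nonneg hγ, Nat.abs_cast]
    gcongr
    · exact Nat.le_ceil _
    · exact Nat.le_ceil _
  calc (2 : ℝ) ^ (⌈|c + γ * p.1|⌉₊ + p.2) * |ω| ^ p.2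
      ≤ 2 ^ ((⌈|c|⌉₊ + 1) + (⌈γ⌉₊ + 1) * (p.1 + p.2)) * (1 + |ω|) ^ (p.1 + p.2) := by
        refine mul_le_mul (pow_le_pow_right₀ (by norm_num) ?_) ?_ (by positivity) (by positivity)
        · nlinarith [Nat.zero_le (⌈γ⌉₊ * p.2)]
        · calc |ω| ^ p.2 ≤ (1 + |ω|) ^ p.2 := by gcongr; linarith
            _ ≤ _ := pow_le_pow_right₀ (by simp) (by omega)
    _ = _ := by rw [pow_add, pow_mul, mul_pow]; ring

lemma isTame_C_pochSeries (ω c : ℝ) : IsTame (PowerSeries.C (pochSeries ω c)) := by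
  refine ⟨2 ^ ⌈|c|⌉₊, 2 * (1 + |ω|), by positivity, by nlinarith [abs_nonneg ω], fun p => ?_⟩
  rw [biCoeff, PowerSeries.coeff_C]
  split_ifs with h
  · refine (abs_coeff_pochSeries_le _ _ _).trans ?_
    rw [h, zero_add, pow_add, mul_assoc, ← mul_pow]
    gcongr
    linarith
  · simp; positivity

/-- The double power series of `1 / (1 + l x (1 - ω y)^{-γ})`. -/
def resolventSeries (ω γ l : ℝ) : PowerSeries (PowerSeries ℝ) :=
  PowerSeries.rescale (PowerSeries.C (-l)) (pochFamily ω γ 0)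

lemma isTame_resolventSeries (ω l : ℝ) {γ : ℝ} (hγ : 0 ≤ γ) : IsTame (resolventSeries ω γ l) :=
  (isTame_pochFamily ω 0 hγ).rescale _

lemma coeff_resolventSeries (ω γ l : ℝ) (n : ℕ) :
    PowerSeries.coeff n (resolventSeries ω γ l) =
      PowerSeries.C ((-l) ^ n) * pochSeries ω (γ * n) := by
  simp [resolventSeries, pochFamily, PowerSeries.coeff_rescale]

/-- Since `P_{γ(n+1)} = P_γ P_{γn}`, the series is the geometric series in `-l x P_γ(y)`, and the
product telescopes. -/
lemma resolventSeries_mul (ω γ l : ℝ) :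
    resolventSeries ω γ l *
      (1 + biConst l * PowerSeries.X * PowerSeries.C (pochSeries ω γ)) = 1 := by
  have h : resolventSeries ω γ l * (biConst l * PowerSeries.X * PowerSeries.C (pochSeries ω γ)) =
      PowerSeries.X * (PowerSeries.C (PowerSeries.C l * pochSeries ω γ) * resolventSeries ω γ l) := by
    rw [map_mul, biConst]; ring
  rw [mul_add, mul_one, h]
  ext1 n
  rcases n with _ | n
  · have h0 := coeff_resolventSeries ω γ l 0
    rw [map_add, h0, PowerSeries.coeff_zero_X_mul]
    simp [pochSeries_zero]
  · rw [map_add, PowerSeries.coeff_succ_X_mul, PowerSeries.coeff_C_mul, coeff_resolventSeries,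
      coeff_resolventSeries, PowerSeries.coeff_one, if_neg (by omega)]
    have h1 : pochSeries ω (γ * ((n + 1 : ℕ) : ℝ)) = pochSeries ω γ * pochSeries ω (γ * n) := by
      rw [← pochSeries_add]; congr 1; push_cast; ring
    rw [h1, pow_succ, map_mul, map_neg]
    ring

/-- `P_b(y) / (1 + l x P_γ(y))` as a dilated family. -/
lemma C_pochSeries_mul_resolventSeries (ω γ b l : ℝ) :
    PowerSeries.C (pochSeries ω b) * resolventSeries ω γ l =
      PowerSeries.rescale (PowerSeries.C (-l)) (pochFamily ω γ b) := by
  ext1 n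
  rw [PowerSeries.coeff_C_mul, coeff_resolventSeries, PowerSeries.coeff_rescale, pochFamily,
    PowerSeries.coeff_mk, pochSeries_add, map_pow]
  ring

/-- The geometric series `∑ ω^{j+1} y^j`. -/
def geomSeries (ω : ℝ) : PowerSeries ℝ := PowerSeries.mk fun j => ω ^ (j + 1)

lemma isTame_C_geomSeries (ω : ℝ) : IsTame (PowerSeries.C (geomSeries ω)) := by
  refine ⟨|ω|, 1 + |ω|, abs_nonneg _, by simp, fun p => ?_⟩
  rw [biCoeff, PowerSeries.coeff_C]
  split_ifs with h
  · rw [geomSeries, PowerSeries.coeff_mk, h, zero_add, abs_pow, pow_succ']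
    gcongr
    linarith
  · simp; positivity

/-- `y d/dy P_c = c y G P_c` for the binomial series `P_c` and `G = ω / (1 - ω y)`. -/
lemma nat_mul_coeff_pochSeries (ω c : ℝ) (j : ℕ) :
    (j : ℝ) * PowerSeries.coeff j (pochSeries ω c) =
      c * PowerSeries.coeff j (PowerSeries.X * geomSeries ω * pochSeries ω c) := by
  -- The relation `(1 - ω y) G = ω`. It expresses the coefficient of `y G P_c` at `j + 1` as `ω`
  -- times that of `P_c + y G P_c` at `j`, which matches the recursion `(c)_{j+1} = (c)_j (c + j)`.
  have hG : geomSeries ω = PowerSeries.C ω + PowerSeries.C ω * PowerSeries.X * geomSeries ω := by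
    ext1 j
    rw [mul_assoc, map_add, PowerSeries.coeff_C_mul]
    rcases j with _ | j
    · simp [geomSeries]
    · rw [PowerSeries.coeff_succ_X_mul, PowerSeries.coeff_C, if_neg (by omega)]
      simp [geomSeries, pow_succ']
  induction j with
  | zero => simp [mul_assoc]
  | succ j ih =>
    have h1 : PowerSeries.X * geomSeries ω * pochSeries ω c =
        PowerSeries.X * (PowerSeries.C ω * (pochSeries ω c +
          PowerSeries.X * geomSeries ω * pochSeries ω c)) := by
      conv_lhs => rw [hG]
      ring
    rw [h1, PowerSeries.coeff_succ_X_mul, PowerSeries.coeff_C_mul, map_add, mul_left_comm,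
      mul_add, ← ih, pochSeries, PowerSeries.coeff_mk, PowerSeries.coeff_mk,
      ascPochhammer_succ_eval, Nat.factorial_succ]
    push_cast
    field_simp
    ring

/-- The double power series of `l x P_γ / (x (1 + l x P_γ))`. -/
def decaySeries (ω γ l : ℝ) : PowerSeries (PowerSeries ℝ) :=
  biConst l * (PowerSeries.C (pochSeries ω γ) * resolventSeries ω γ l)

/-- The binomial series without its constant term, divided by `y`. -/
def pochTail (ω c : ℝ) : PowerSeries ℝ :=
  PowerSeries.mk fun j => PowerSeries.coeff (j + 1) (pochSeries ω c)

lemma isTame_C_pochTail (ω c : ℝ) : IsTame (PowerSeries.C (pochTail ω c)) := by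
  obtain ⟨C, M, hC, hM, h⟩ := isTame_C_pochSeries ω c
  refine ⟨C * M, M, by positivity, hM, fun p => ?_⟩
  have h1 := h (p.1, p.2 + 1)
  simp only [biCoeff, PowerSeries.coeff_C] at h1 ⊢
  split_ifs at h1 ⊢ with hp
  · rw [pochTail, PowerSeries.coeff_mk]
    refine h1.trans_eq ?_
    ring
  · simp; positivity

lemma pochSeries_eq_one_add (ω c : ℝ) :
    pochSeries ω c = 1 + PowerSeries.X * pochTail ω c := by
  ext1 j
  rcases j with _ | j
  · rw [map_add, PowerSeries.coeff_zero_X_mul]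
    simp [pochSeries]
  · rw [map_add, PowerSeries.coeff_succ_X_mul, PowerSeries.coeff_one, if_neg (by omega), pochTail,
      PowerSeries.coeff_mk, zero_add]

lemma isTame_decaySeries (ω l : ℝ) {γ : ℝ} (hγ : 0 ≤ γ) : IsTame (decaySeries ω γ l) :=
  (IsTame.biConst l).mul ((isTame_C_pochSeries ω γ).mul (isTame_resolventSeries ω l hγ))

/-- The resolvent identity `H + l x P_γ H = 1`, in the form that makes the relaxation function one
minus a primitive. -/
lemma resolventSeries_eq (ω γ l : ℝ) :
    resolventSeries ω γ l = 1 - PowerSeries.X * decaySeries ω γ l := by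
  have h := resolventSeries_mul ω γ l
  rw [decaySeries]
  linear_combination h

/-- The equation of a single mode: in time, the fractional integral of order `1 - ρ` and parameter
`-γ` of the decay kernel is `l` times the relaxation function. -/
lemma pochSeries_neg_mul_decaySeries (ω γ l : ℝ) :
    PowerSeries.C (pochSeries ω (-γ)) * decaySeries ω γ l = biConst l * resolventSeries ω γ l := by
  have h : PowerSeries.C (pochSeries ω (-γ)) * PowerSeries.C (pochSeries ω γ) = 1 := by
    rw [← map_mul, ← pochSeries_add, neg_add_cancel, pochSeries_zero, map_one]
  rw [decaySeries]
  linear_combination (biConst l * resolventSeries ω γ l) * h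

/-- Comparison of the series for general `γ` with the series for `γ = 0`. -/
lemma decaySeries_eq (ω γ l : ℝ) :
    decaySeries ω γ l = decaySeries ω 0 l +
      PowerSeries.C PowerSeries.X * (PowerSeries.C (pochTail ω γ) * decaySeries ω 0 l) -
      PowerSeries.X * (PowerSeries.C PowerSeries.X *
        ((PowerSeries.C (pochTail ω γ) * decaySeries ω 0 l) * decaySeries ω γ l)) := by
  have h1 := resolventSeries_mul ω γ l
  have h0 := resolventSeries_mul ω 0 l
  have hP : PowerSeries.C (pochSeries ω γ) =
      1 + PowerSeries.C PowerSeries.X * PowerSeries.C (pochTail ω γ) := by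
    rw [pochSeries_eq_one_add, map_add, map_one, map_mul]
  simp only [decaySeries]
  rw [pochSeries_zero, map_one] at *
  set H := resolventSeries ω γ l
  set H0 := resolventSeries ω 0 l
  rw [hP] at h1 ⊢
  set Z := PowerSeries.C PowerSeries.X * PowerSeries.C (pochTail ω γ) with hZ
  linear_combination (-biConst l * H * (1 + Z)) * h0 + (biConst l * H0 * (1 + Z)) * h1 +
    (biConst l * H0 - biConst l ^ 2 * H * H0 * PowerSeries.X * (1 + Z)) * hZ

lemma coeff_decaySeries (ω γ l : ℝ) (n : ℕ) :
    PowerSeries.coeff n (decaySeries ω γ l) =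
      PowerSeries.C (l * (-l) ^ n) * pochSeries ω (γ + γ * n) := by
  rw [decaySeries, biConst, PowerSeries.coeff_C_mul, PowerSeries.coeff_C_mul,
    coeff_resolventSeries, pochSeries_add, map_mul]
  ring

/-- `Q - x Q² = Q H`, and all `n + 1` terms in the `n`-th coefficient of `Q H` coincide because `P_b
P_c = P_{b+c}`. Thus `Q H` is the derivative of `x Q` in `x`. -/
lemma succ_mul_coeff_decaySeries (ω γ l : ℝ) (n : ℕ) :
    PowerSeries.coeff n
      (decaySeries ω γ l - PowerSeries.X * (decaySeries ω γ l * decaySeries ω γ l)) =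
      PowerSeries.C (n + 1 : ℝ) * PowerSeries.coeff n (decaySeries ω γ l) := by
  have h5 : decaySeries ω γ l - PowerSeries.X * (decaySeries ω γ l * decaySeries ω γ l) =
      decaySeries ω γ l * resolventSeries ω γ l := by
    rw [resolventSeries_eq]; ring
  rw [h5, PowerSeries.coeff_mul, coeff_decaySeries]
  have h : ∀ z ∈ Finset.HasAntidiagonal.antidiagonal n,
      PowerSeries.coeff z.1 (decaySeries ω γ l) * PowerSeries.coeff z.2 (resolventSeries ω γ l) =
      PowerSeries.C (l * (-l) ^ n) * pochSeries ω (γ + γ * n) := by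
    intro z hz
    rw [Finset.HasAntidiagonal.mem_antidiagonal] at hz
    rw [coeff_decaySeries, coeff_resolventSeries, ← hz, pow_add]
    have : γ + γ * ((z.1 + z.2 : ℕ) : ℝ) = (γ + γ * z.1) + γ * z.2 := by push_cast; ring
    rw [this, pochSeries_add ω (γ + γ * z.1)]
    simp only [map_mul]
    ring
  rw [Finset.sum_congr rfl h, Finset.sum_const, Finset.Nat.card_antidiagonal, nsmul_eq_mul]
  congr 1
  simp

/-- The power series of `t q(t)`, where `q` is the kernel of `decaySeries`. -/
lemma biCoeff_euler (ω γ l ρ α : ℝ) (p : ℕ × ℕ) :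
    biCoeff ((biConst ρ + biConst (α * γ) *
        (PowerSeries.C PowerSeries.X * PowerSeries.C (geomSeries ω))) *
      (decaySeries ω γ l - PowerSeries.X * (decaySeries ω γ l * decaySeries ω γ l))) p =
      (ρ * p.1 + α * p.2 + ρ) * biCoeff (decaySeries ω γ l) p := by
  obtain ⟨n, j⟩ := p
  have hd := succ_mul_coeff_decaySeries ω γ l n
  have hcoeff := coeff_decaySeries ω γ l n
  generalize decaySeries ω γ l - PowerSeries.X * (decaySeries ω γ l * decaySeries ω γ l) = E at *
  simp only [biCoeff]
  rw [add_mul, map_add, map_add, biConst, biConst, mul_assoc (PowerSeries.C (PowerSeries.C (α * γ))),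
    PowerSeries.coeff_C_mul, PowerSeries.coeff_C_mul, ← map_mul, PowerSeries.coeff_C_mul,
    PowerSeries.coeff_C_mul, PowerSeries.coeff_C_mul, hd, hcoeff]
  -- The exponent `γ + γ n = γ (n + 1)` makes the `y`-derivative produce the same factor `n + 1` as
  -- the `x`-derivative, so both act through `Q - x Q²`.
  have h1 := nat_mul_coeff_pochSeries ω (γ + γ * n) j
  have h2 : PowerSeries.X * geomSeries ω * (PowerSeries.C (n + 1 : ℝ) *
      (PowerSeries.C (l * (-l) ^ n) * pochSeries ω (γ + γ * n))) =
      PowerSeries.C ((n + 1 : ℝ) * (l * (-l) ^ n)) *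
        (PowerSeries.X * geomSeries ω * pochSeries ω (γ + γ * n)) := by
    simp only [map_mul]; ring
  rw [h2, PowerSeries.coeff_C_mul, PowerSeries.coeff_C_mul, PowerSeries.coeff_C_mul]
  linear_combination (-(α * (l * (-l) ^ n))) * h1

/-! ### Causal convolution on a bounded time interval -/

section causal

variable {E : Type*} [NormedAddCommGroup E] [NormedSpace ℝ E]

/-- Truncation of a function to `(0, T]`. -/
def trunc {F : Type*} [Zero F] (T : ℝ) (f : ℝ → F) : ℝ → F := indicator (Ioc 0 T) f

lemma integrable_trunc {F : Type*} [NormedAddCommGroup F] {T : ℝ} {f : ℝ → F} (hf : IntegrableOn f (Ioc 0 T)) :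
    Integrable (trunc T f) := hf.integrable_indicator measurableSet_Ioc

lemma trunc_conv_integrand {T t : ℝ} (htT : t ≤ T) (f : ℝ → ℝ) (g : ℝ → E) (s : ℝ)  :
    trunc T f (t - s) • trunc T g s = indicator (Ioo 0 t) (fun s => f (t - s) • g s) s := by
  unfold trunc
  by_cases h : s ∈ Ioo 0 t
  · have h1 : t - s ∈ Ioc 0 T := ⟨by linarith [h.2], by linarith [h.1]⟩
    have h2 : s ∈ Ioc 0 T := ⟨h.1, by linarith [h.2]⟩
    rw [indicator_of_mem h1, indicator_of_mem h2, indicator_of_mem h]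
  · rw [indicator_of_notMem h]
    by_cases h1 : t - s ∈ Ioc 0 T
    · rw [indicator_of_notMem (s := Ioc 0 T) (a := s), smul_zero]
      exact fun h2 => h ⟨h2.1, by linarith [h1.1]⟩
    · rw [indicator_of_notMem h1, zero_smul]

/-- Up to time `T` only values on `(0, T]` enter, so the theory of convolution of integrable
functions on the line applies to functions that are merely integrable on `(0, T]`. -/
lemma causalConv_eq_convolution {T t : ℝ} (ht : 0 ≤ t) (htT : t ≤ T) (f : ℝ → ℝ) (g : ℝ → E) :
    causalConv f g t =
      convolution (trunc T f) (trunc T g) (ContinuousLinearMap.lsmul ℝ ℝ) volume t := by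
  rw [convolution_eq_swap]
  simp only [ContinuousLinearMap.lsmul_apply, trunc_conv_integrand htT f g]
  rw [integral_indicator measurableSet_Ioo, causalConv, intervalIntegral.integral_of_le ht,
    integral_Ioc_eq_integral_Ioo]

lemma integrableOn_causalConv {T : ℝ} {f : ℝ → ℝ} {g : ℝ → E} (hf : IntegrableOn f (Ioc 0 T))
    (hg : IntegrableOn g (Ioc 0 T)) : IntegrableOn (causalConv f g) (Ioc 0 T) := by
  have h := (Integrable.integrable_convolution (ContinuousLinearMap.lsmul ℝ ℝ)
    (integrable_trunc hf) (integrable_trunc hg)).integrableOn (s := Ioc 0 T)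
  refine h.congr_fun (fun t ht => ?_) measurableSet_Ioc
  exact (causalConv_eq_convolution ht.1.le ht.2 f g).symm

lemma ae_intervalIntegrable_causalConv {T : ℝ} {f : ℝ → ℝ} {g : ℝ → E}
    (hf : IntegrableOn f (Ioc 0 T)) (hg : IntegrableOn g (Ioc 0 T)) :
    ∀ᵐ t, t ∈ Ioc 0 T → IntervalIntegrable (fun s => f (t - s) • g s) volume 0 t := by
  filter_upwards [Integrable.ae_convolution_exists (ContinuousLinearMap.lsmul ℝ ℝ)
    (integrable_trunc hf) (integrable_trunc hg)] with t h ht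
  have h2 := h.integrable_swap
  simp only [ContinuousLinearMap.lsmul_apply, trunc_conv_integrand ht.2 f g] at h2
  rw [integrable_indicator_iff measurableSet_Ioo] at h2
  exact (intervalIntegrable_iff_integrableOn_Ioo_of_le ht.1.le).2 h2

lemma norm_causalConv_le {t : ℝ} (ht : 0 ≤ t) (f : ℝ → ℝ) (g : ℝ → E) :
    ‖causalConv f g t‖ ≤ causalConv (fun s => |f s|) (fun s => ‖g s‖) t := by
  refine (intervalIntegral.norm_integral_le_integral_norm ht).trans_eq ?_
  simp only [norm_smul, Real.norm_eq_abs, causalConv, smul_eq_mul]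

/-- Young's inequality in `L¹`: the integral of a convolution of nonnegative functions is the
product of their integrals. -/
lemma integral_norm_causalConv_le {T : ℝ} {f : ℝ → ℝ} {g : ℝ → E}
    (hf : IntegrableOn f (Ioc 0 T)) (hg : IntegrableOn g (Ioc 0 T)) :
    ∫ t in Ioc 0 T, ‖causalConv f g t‖ ≤ (∫ t in Ioc 0 T, |f t|) * ∫ t in Ioc 0 T, ‖g t‖ := by
  have hf' : Integrable (trunc T fun s => |f s|) := integrable_trunc hf.abs
  have hg' : Integrable (trunc T fun s => ‖g s‖) := integrable_trunc hg.norm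
  have h1 := integral_convolution (ContinuousLinearMap.lsmul ℝ ℝ) hf' hg' (μ := volume)
    (ν := volume)
  have h2 := Integrable.integrable_convolution (ContinuousLinearMap.lsmul ℝ ℝ) hf' hg'
  have hnn : ∀ t, 0 ≤ convolution (trunc T fun s => |f s|) (trunc T fun s => ‖g s‖)
      (ContinuousLinearMap.lsmul ℝ ℝ) volume t := fun t => by
    refine integral_nonneg fun s => ?_
    simp only [ContinuousLinearMap.lsmul_apply, smul_eq_mul, Pi.zero_apply]
    exact mul_nonneg (indicator_nonneg (fun _ _ => abs_nonneg _) _)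
      (indicator_nonneg (fun _ _ => norm_nonneg _) _)
  calc ∫ t in Ioc 0 T, ‖causalConv f g t‖
      ≤ ∫ t in Ioc 0 T, convolution (trunc T fun s => |f s|) (trunc T fun s => ‖g s‖)
          (ContinuousLinearMap.lsmul ℝ ℝ) volume t := by
        refine setIntegral_mono_on (integrableOn_causalConv hf hg).norm h2.integrableOn
          measurableSet_Ioc fun t ht => ?_
        rw [← causalConv_eq_convolution ht.1.le ht.2]
        exact norm_causalConv_le ht.1.le f g
    _ ≤ ∫ t, convolution (trunc T fun s => |f s|) (trunc T fun s => ‖g s‖)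
          (ContinuousLinearMap.lsmul ℝ ℝ) volume t :=
        setIntegral_le_integral h2 (Eventually.of_forall hnn)
    _ = _ := by
        rw [h1]
        simp only [ContinuousLinearMap.lsmul_apply, smul_eq_mul, trunc,
          integral_indicator measurableSet_Ioc]

/-- Dominated convergence as the weight grows. A large weight takes the place of a small time
interval, both in the perturbation argument for general `γ` and in the uniqueness proof. -/
lemma exists_integral_exp_mul_le {T : ℝ} {f : ℝ → ℝ} (hf : IntegrableOn f (Ioc 0 T)) {ε : ℝ}
    (hε : 0 < ε) : ∃ b : ℝ, 0 ≤ b ∧ ∫ t in Ioc 0 T, Real.exp (-b * t) * |f t| ≤ ε := by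
  have h : Tendsto (fun n : ℕ => ∫ t in Ioc 0 T, Real.exp (-(n : ℝ) * t) * |f t|) atTop
      (𝓝 (∫ t in Ioc 0 T, (0 : ℝ))) := by
    refine tendsto_integral_of_dominated_convergence (fun t => |f t|) (fun n => ?_) hf.abs
      (fun n => ?_) ?_
    · exact (by fun_prop : Continuous fun t : ℝ => Real.exp (-(n : ℝ) * t)).aestronglyMeasurable.mul
        hf.abs.aestronglyMeasurable
    · filter_upwards [ae_restrict_mem measurableSet_Ioc] with t ht
      rw [norm_mul, Real.norm_eq_abs, Real.abs_exp, Real.norm_eq_abs, abs_abs]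
      refine mul_le_of_le_one_left (abs_nonneg _) (Real.exp_le_one_iff.2 ?_)
      nlinarith [ht.1, (Nat.cast_nonneg n : (0 : ℝ) ≤ n)]
    · filter_upwards [ae_restrict_mem measurableSet_Ioc] with t ht
      have h1 : Tendsto (fun n : ℕ => -(n : ℝ) * t) atTop atBot := by
        have := (tendsto_natCast_atTop_atTop (R := ℝ)).atTop_mul_const ht.1
        simpa only [neg_mul, Function.comp_def] using tendsto_neg_atTop_atBot.comp this
      simpa using (Real.tendsto_exp_atBot.comp h1).mul_const |f t|
  rw [integral_zero] at h
  obtain ⟨n, hn⟩ := (h.eventually (gt_mem_nhds hε)).exists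
  exact ⟨n, Nat.cast_nonneg n, hn.le⟩

lemma causalConv_congr_ae {t T : ℝ} (ht : 0 ≤ t) (htT : t ≤ T) (f : ℝ → ℝ) {g g' : ℝ → E}
    (h : ∀ᵐ s, s ∈ Ioc 0 T → g s = g' s) : causalConv f g t = causalConv f g' t := by
  refine intervalIntegral.integral_congr_ae ?_
  filter_upwards [h] with s hs hst
  rw [uIoc_of_le ht] at hst
  rw [hs ⟨hst.1, hst.2.trans htT⟩]

lemma causalConv_congr_left {t : ℝ} (ht : 0 ≤ t) {f f' : ℝ → ℝ} (g : ℝ → E)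
    (h : ∀ s, 0 < s → s ≤ t → f s = f' s) : causalConv f g t = causalConv f' g t := by
  rw [causalConv, causalConv, intervalIntegral.integral_of_le ht,
    intervalIntegral.integral_of_le ht, integral_Ioc_eq_integral_Ioo,
    integral_Ioc_eq_integral_Ioo]
  refine setIntegral_congr_fun measurableSet_Ioo fun s hs => ?_
  simp only [h (t - s) (by linarith [hs.2]) (by linarith [hs.1])]

lemma causalConv_assoc [CompleteSpace E] {T : ℝ} {f₁ f₂ : ℝ → ℝ} {g : ℝ → E}
    (h₁ : IntegrableOn f₁ (Ioc 0 T)) (h₂ : IntegrableOn f₂ (Ioc 0 T))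
    (hg : IntegrableOn g (Ioc 0 T)) :
    ∀ᵐ t, t ∈ Ioc 0 T →
      causalConv f₁ (causalConv f₂ g) t = causalConv (causalConv f₁ f₂) g t := by
  have i1 := integrable_trunc h₁
  have i2 := integrable_trunc h₂
  have ig := integrable_trunc hg
  have h2g := Integrable.integrable_convolution (ContinuousLinearMap.mul ℝ ℝ) i2.norm ig.norm
  filter_upwards [Integrable.ae_convolution_exists (ContinuousLinearMap.mul ℝ ℝ) i1.norm h2g]
    with t h ht
  have key := convolution_assoc (ContinuousLinearMap.lsmul ℝ ℝ) (ContinuousLinearMap.lsmul ℝ ℝ)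
    (ContinuousLinearMap.lsmul ℝ ℝ) (ContinuousLinearMap.lsmul ℝ ℝ) (f := trunc T f₁)
    (g := trunc T f₂) (k := trunc T g) (μ := volume) (ν := volume) (x₀ := t)
    (fun x y z => smul_assoc x y z)
    i1.aestronglyMeasurable i2.aestronglyMeasurable ig.aestronglyMeasurable
    (Integrable.ae_convolution_exists _ i1 i2)
    (Integrable.ae_convolution_exists _ i2.norm ig.norm) h
  -- Truncating the inner convolution at `T` is harmless: it vanishes for `s ≤ 0` anyway, and for `s
  -- > T ≥ t` the outer factor vanishes.
  have e1 : ∀ s, trunc T f₁ (t - s) • trunc T (causalConv f₂ g) s =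
      trunc T f₁ (t - s) • convolution (trunc T f₂) (trunc T g)
        (ContinuousLinearMap.lsmul ℝ ℝ) volume s := by
    intro s
    by_cases hs : s ∈ Ioc 0 T
    · rw [trunc, trunc, indicator_of_mem hs, causalConv_eq_convolution hs.1.le hs.2, trunc]
    · by_cases hs0 : s ≤ 0
      · have : convolution (trunc T f₂) (trunc T g) (ContinuousLinearMap.lsmul ℝ ℝ) volume s = 0 := by
          rw [convolution_eq_swap]
          refine integral_eq_zero_of_ae (Eventually.of_forall fun u => ?_)
          simp only [ContinuousLinearMap.lsmul_apply, Pi.zero_apply]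
          have hT : (0 : ℝ) ≤ T := ht.1.le.trans ht.2
          rw [trunc_conv_integrand (hs0.trans hT), Ioo_eq_empty (not_lt.2 hs0), indicator_empty]
        rw [this, trunc, trunc, indicator_of_notMem hs]
      · have hts : t - s ∉ Ioc 0 T := fun hc => by
          rw [mem_Ioc, not_and_or, not_lt, not_le] at hs
          rcases hs with hs | hs
          · exact hs0 hs
          · linarith [hc.1, ht.2]
        rw [trunc, indicator_of_notMem hts, zero_smul, zero_smul]
  have e2 : ∀ s, trunc T (causalConv f₁ f₂) (t - s) • trunc T g s =
      convolution (trunc T f₁) (trunc T f₂)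
        (ContinuousLinearMap.lsmul ℝ ℝ) volume (t - s) • trunc T g s := by
    intro s
    by_cases hs : s ∈ Ioc 0 T
    · by_cases hts : t - s ∈ Ioc 0 T
      · rw [trunc, indicator_of_mem hts, causalConv_eq_convolution hts.1.le hts.2]
      · have h0 : t - s ≤ 0 := by
          by_contra hc
          exact hts ⟨not_le.1 hc, by linarith [hs.1, ht.2]⟩
        have : convolution (trunc T f₁) (trunc T f₂) (ContinuousLinearMap.lsmul ℝ ℝ) volume
            (t - s) = 0 := by
          rw [convolution_eq_swap]
          refine integral_eq_zero_of_ae (Eventually.of_forall fun u => ?_)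
          simp only [ContinuousLinearMap.lsmul_apply, Pi.zero_apply]
          have hT : (0 : ℝ) ≤ T := ht.1.le.trans ht.2
          rw [trunc_conv_integrand (h0.trans hT), Ioo_eq_empty (not_lt.2 h0), indicator_empty]
        rw [this, trunc, indicator_of_notMem hts]
    · have : trunc T g s = 0 := indicator_of_notMem hs _
      rw [this, smul_zero, smul_zero]
  rw [causalConv_eq_convolution ht.1.le ht.2, causalConv_eq_convolution ht.1.le ht.2,
    convolution_eq_swap, convolution_eq_swap]
  rw [convolution_eq_swap, convolution_eq_swap] at key
  simp only [ContinuousLinearMap.lsmul_apply] at key ⊢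
  simp_rw [e1, e2]
  exact key.symm

/-- The weight is multiplicative, `e^{-bt} = e^{-b(t-s)} e^{-bs}`, so it distributes over the two
factors. -/
lemma exp_smul_causalConv (b t : ℝ) (f : ℝ → ℝ) (g : ℝ → E) :
    Real.exp (-b * t) • causalConv f g t =
      causalConv (fun s => Real.exp (-b * s) * f s) (fun s => Real.exp (-b * s) • g s) t := by
  rw [causalConv, causalConv, ← intervalIntegral.integral_smul]
  refine intervalIntegral.integral_congr fun s _ => ?_
  simp only [smul_smul]
  congr 1
  rw [show -b * t = -b * (t - s) + -b * s by ring, Real.exp_add]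
  ring

lemma integrableOn_exp_smul {T b : ℝ} {g : ℝ → E} (hg : IntegrableOn g (Ioc 0 T)) :
    IntegrableOn (fun s => Real.exp (-b * s) • g s) (Ioc 0 T) := by
  have h : IntegrableOn (fun s => Real.exp (-b * s) • g s) (Icc 0 T) :=
    IntegrableOn.continuousOn_smul (by rwa [integrableOn_Icc_iff_integrableOn_Ioc]) (by fun_prop)
      isCompact_Icc
  exact h.mono_set Ioc_subset_Icc_self

/-- Young's inequality for the exponentially weighted `L¹` norm. -/
lemma integral_exp_norm_causalConv_le {T b : ℝ} {f : ℝ → ℝ} {g : ℝ → E}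
    (hf : IntegrableOn f (Ioc 0 T)) (hg : IntegrableOn g (Ioc 0 T)) :
    ∫ t in Ioc 0 T, Real.exp (-b * t) * ‖causalConv f g t‖ ≤
      (∫ t in Ioc 0 T, Real.exp (-b * t) * |f t|) *
        ∫ t in Ioc 0 T, Real.exp (-b * t) * ‖g t‖ := by
  have h := integral_norm_causalConv_le (integrableOn_exp_smul (b := b) hf)
    (integrableOn_exp_smul (b := b) hg)
  simp only [smul_eq_mul] at h
  simp only [← exp_smul_causalConv, norm_smul, abs_mul, Real.norm_eq_abs, Real.abs_exp] at h
  exact h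

end causal

/-! ### Positivity of the resolvent of a Riemann-Liouville kernel -/

lemma integral_rlKernel_sub {β t t₀ : ℝ} (hβ : 0 < β) :
    ∫ s in t..t₀, rlKernel β (t₀ - s) = rlKernel (β + 1) (t₀ - t) := by
  rw [intervalIntegral.integral_comp_sub_left (fun s => rlKernel β s), sub_self]
  simp only [rlKernel]
  rw [intervalIntegral.integral_div, integral_rpow (Or.inl (by linarith)), sub_add_cancel,
    Real.zero_rpow hβ.ne', Real.Gamma_add_one hβ.ne', add_sub_cancel_right]
  have := (Real.Gamma_pos_of_pos hβ).ne'
  field_simp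
  simp

/-- `(t₀ - s) t - t₀ (t - s) = s (t₀ - t) ≥ 0`, and the exponent `ρ - 1` is negative. This
monotonicity of the ratio of shifted kernels is what makes the resolvent positive. -/
lemma rlKernel_log_convex {ρ s t t₀ : ℝ} (hρ : 0 < ρ) (hρ1 : ρ < 1) (hs : 0 < s) (hst : s < t)
    (htt : t ≤ t₀) :
    rlKernel ρ (t₀ - s) * rlKernel ρ t ≤ rlKernel ρ t₀ * rlKernel ρ (t - s) := by
  have ht : 0 < t := hs.trans hst
  simp only [rlKernel, div_mul_div_comm]
  have hG := Real.Gamma_pos_of_pos hρ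
  gcongr ?_ / _
  rw [← Real.mul_rpow (by linarith) ht.le, ← Real.mul_rpow (by linarith) (by linarith)]
  refine Real.rpow_le_rpow_of_nonpos (mul_pos (by linarith) (by linarith)) ?_ (by linarith)
  nlinarith

lemma intervalIntegrable_rlKernel_mul {ρ D t : ℝ} {r : ℝ → ℝ} (hρ : 0 < ρ) (ht : 0 < t)
    (hc : ContinuousOn r (Ioi 0)) (hD : ∀ s, 0 < s → s ≤ t → |r s| ≤ D * rlKernel ρ s) :
    IntervalIntegrable (fun s => rlKernel ρ (t - s) * r s) volume 0 t := by
  rw [intervalIntegrable_iff_integrableOn_Ioo_of_le ht.le]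
  have h := (intervalIntegrable_iff_integrableOn_Ioo_of_le ht.le).1
    ((integrable_rlKernel_mul hρ hρ ht).const_mul D)
  refine h.mono' ?_ ?_
  · refine ContinuousOn.aestronglyMeasurable ?_ measurableSet_Ioo
    refine ContinuousOn.mul ?_ (hc.mono fun s hs => hs.1)
    exact (continuousOn_rlKernel ρ).comp (by fun_prop) fun s hs => sub_pos.2 hs.2
  · filter_upwards [ae_restrict_mem measurableSet_Ioo] with s hs
    have h0 := rlKernel_nonneg hρ (sub_pos.2 hs.2).le
    rw [norm_mul, Real.norm_eq_abs, abs_of_nonneg h0, Real.norm_eq_abs]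
    calc _ ≤ rlKernel ρ (t - s) * (D * rlKernel ρ s) := by
          gcongr; exact hD s hs.1 hs.2.le
      _ = _ := by ring

/-- The resolvent of a multiple of the kernel `t^{ρ-1}/Γ(ρ)`, `0 < ρ < 1`, is positive. -/
lemma resolvent_pos {ρ l : ℝ} {r : ℝ → ℝ} (hρ : 0 < ρ) (hρ1 : ρ < 1) (hl : 0 < l)
    (hc : ContinuousOn r (Ioi 0))
    (hb : ∀ T, 0 < T → ∃ D, 0 ≤ D ∧ ∀ s, 0 < s → s ≤ T → |r s| ≤ D * rlKernel ρ s)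
    (heq : ∀ t, 0 < t → r t + l * ∫ s in (0 : ℝ)..t, rlKernel ρ (t - s) * r s = l * rlKernel ρ t)
    {t : ℝ} (ht : 0 < t) : 0 < r t := by
  have hint : ∀ t, 0 < t → IntervalIntegrable (fun s => rlKernel ρ (t - s) * r s) volume 0 t := by
    intro t ht
    obtain ⟨D, -, hD⟩ := hb t ht
    exact intervalIntegrable_rlKernel_mul hρ ht hc hD
  -- Near zero the convolution term is `O(t^{2ρ-1})`, which is negligible against `t^{ρ-1}`.
  obtain ⟨δ, hδ, hsmall⟩ : ∃ δ, 0 < δ ∧ ∀ t, 0 < t → t < δ → 0 < r t := by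
    obtain ⟨D, hD0, hD⟩ := hb 1 one_pos
    have h1 : Tendsto (fun t : ℝ => D * (t ^ ρ * (Real.Gamma ρ / Real.Gamma (ρ + ρ)))) (𝓝 0)
        (𝓝 0) := by
      have h : Tendsto (fun t : ℝ => t ^ ρ) (𝓝 0) (𝓝 (0 ^ ρ)) :=
        (Real.continuous_rpow_const hρ.le).tendsto 0
      rw [Real.zero_rpow hρ.ne'] at h
      simpa using (h.mul_const (Real.Gamma ρ / Real.Gamma (ρ + ρ))).const_mul D
    obtain ⟨δ, hδ, hδ2⟩ := Metric.eventually_nhds_iff.1 (h1.eventually (gt_mem_nhds one_pos))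
    refine ⟨min δ 1, by positivity, fun t ht htδ => ?_⟩
    have h2 := hδ2 (y := t) (by
      rw [dist_zero_right, Real.norm_eq_abs, abs_of_pos ht]; exact htδ.trans_le (min_le_left _ _))
    have ht1 : t ≤ 1 := (htδ.trans_le (min_le_right _ _)).le
    have h3 : ∫ s in (0 : ℝ)..t, rlKernel ρ (t - s) * r s ≤ D * rlKernel (ρ + ρ) t := by
      rw [← causalConv_rlKernel hρ hρ ht, ← intervalIntegral.integral_const_mul]
      refine intervalIntegral.integral_mono_on_of_le_Ioo ht.le (hint t ht)
        ((integrable_rlKernel_mul hρ hρ ht).const_mul D) fun s hs => ?_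
      have h0 := rlKernel_nonneg hρ (sub_pos.2 hs.2).le
      calc _ ≤ rlKernel ρ (t - s) * (D * rlKernel ρ s) := by
            gcongr
            exact (le_abs_self _).trans (hD s hs.1 (hs.2.le.trans ht1))
        _ = _ := by ring
    have h4 : D * rlKernel (ρ + ρ) t < rlKernel ρ t := by
      have hG := Real.Gamma_pos_of_pos hρ
      have e : D * rlKernel (ρ + ρ) t =
          D * (t ^ ρ * (Real.Gamma ρ / Real.Gamma (ρ + ρ))) * rlKernel ρ t := by
        simp only [rlKernel]
        rw [show ρ + ρ - 1 = ρ + (ρ - 1) by ring, Real.rpow_add ht]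
        field_simp
      rw [e]
      exact mul_lt_of_lt_one_left (rlKernel_pos hρ ht) h2
    have h5 := heq t ht
    nlinarith
  by_contra hneg
  rw [not_lt] at hneg
  -- If positivity fails, there is a smallest point `t₀` with `r t₀ ≤ 0`. The cut at `δ / 2` keeps
  -- the set closed and away from the singularity at zero.
  set Z : Set ℝ := {s | s ∈ Icc (δ / 2) t ∧ r s ≤ 0} with hZ
  have hδt : δ ≤ t := by
    by_contra hc2
    exact absurd (hsmall t ht (not_le.1 hc2)) (not_lt.2 hneg)
  have hZne : Z.Nonempty := ⟨t, ⟨by linarith, le_rfl⟩, hneg⟩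
  have hZcl : IsClosed Z := by
    have : Z = Icc (δ / 2) t ∩ r ⁻¹' Iic 0 := rfl
    rw [this]
    exact (hc.mono fun s hs => lt_of_lt_of_le (by linarith) hs.1).preimage_isClosed_of_isClosed
      isClosed_Icc isClosed_Iic
  have hZbd : BddBelow Z := ⟨δ / 2, fun s hs => hs.1.1⟩
  set t₀ := sInf Z with ht₀
  have hmem : t₀ ∈ Z := hZcl.csInf_mem hZne hZbd
  have ht₀pos : 0 < t₀ := lt_of_lt_of_le (by linarith) hmem.1.1
  have hpos : ∀ s, 0 < s → s < t₀ → 0 < r s := by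
    intro s hs hst
    by_cases hsδ : s < δ
    · exact hsmall s hs hsδ
    · by_contra hc2
      have : s ∈ Z := ⟨⟨by linarith [not_lt.1 hsδ], hst.le.trans hmem.1.2⟩, not_lt.1 hc2⟩
      exact absurd (csInf_le hZbd this) (not_le.2 hst)
  -- The equation at `s`, multiplied by the kernel at `t₀`, is compared with the equation at `t₀`,
  -- multiplied by the kernel at `s`. As `r > 0` on `(0, s)`, `rlKernel_log_convex` disposes of the
  -- integrals over `(0, s)`; as `r t₀ ≤ 0`, only the integral over `(s, t₀)` is left.
  have key : ∀ s, 0 < s → s < t₀ →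
      rlKernel ρ t₀ * r s ≤ l * rlKernel ρ s * ∫ u in s..t₀, rlKernel ρ (t₀ - u) * r u := by
    intro s hs hst
    have e1 := heq s hs
    have e0 := heq t₀ ht₀pos
    have hi := hint t₀ ht₀pos
    have hi1 : IntervalIntegrable (fun u => rlKernel ρ (t₀ - u) * r u) volume 0 s :=
      hi.mono_set (by rw [uIcc_of_le hs.le, uIcc_of_le ht₀pos.le]; exact Icc_subset_Icc_right hst.le)
    have hi2 : IntervalIntegrable (fun u => rlKernel ρ (t₀ - u) * r u) volume s t₀ :=
      hi.mono_set (by rw [uIcc_of_le hst.le, uIcc_of_le ht₀pos.le]; exact Icc_subset_Icc_left hs.le)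
    rw [← intervalIntegral.integral_add_adjacent_intervals hi1 hi2] at e0
    have hle : rlKernel ρ s * ∫ u in (0 : ℝ)..s, rlKernel ρ (t₀ - u) * r u ≤
        rlKernel ρ t₀ * ∫ u in (0 : ℝ)..s, rlKernel ρ (s - u) * r u := by
      rw [← intervalIntegral.integral_const_mul, ← intervalIntegral.integral_const_mul]
      refine intervalIntegral.integral_mono_on_of_le_Ioo hs.le (hi1.const_mul _)
        ((hint s hs).const_mul _) fun u hu => ?_
      have h1 := rlKernel_log_convex hρ hρ1 hu.1 hu.2 hst.le
      have h2 := hpos u hu.1 (hu.2.trans hst)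
      nlinarith
    have h0 := rlKernel_pos hρ hs
    have hr0 := hmem.2
    set I1 := ∫ u in (0 : ℝ)..s, rlKernel ρ (t₀ - u) * r u
    set I2 := ∫ u in s..t₀, rlKernel ρ (t₀ - u) * r u
    set I3 := ∫ u in (0 : ℝ)..s, rlKernel ρ (s - u) * r u
    have f1 := mul_le_mul_of_nonneg_left hle hl.le
    have f2 : rlKernel ρ s * (l * rlKernel ρ t₀) ≤ rlKernel ρ s * (l * (I1 + I2)) :=
      mul_le_mul_of_nonneg_left (by linarith) h0.le
    have f3 : rlKernel ρ t₀ * (r s + l * I3) = rlKernel ρ t₀ * (l * rlKernel ρ s) := by rw [e1]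
    nlinarith
  have hk0 := rlKernel_pos hρ ht₀pos
  -- On a short interval `[t₀ - d, t₀]` the kernel has small mass. At a maximum point `s` of `r` on
  -- it, `key` bounds `rlKernel ρ t₀ * r s` by a strictly smaller multiple of `r s > 0`, a
  -- contradiction.
  have hlim : Tendsto (fun d : ℝ => l * rlKernel ρ (t₀ / 2) * rlKernel (ρ + 1) d) (𝓝 0) (𝓝 0) := by
    have h : Tendsto (fun t : ℝ => t ^ ρ) (𝓝 0) (𝓝 (0 ^ ρ)) :=
      (Real.continuous_rpow_const hρ.le).tendsto 0
    rw [Real.zero_rpow hρ.ne'] at h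
    simpa [rlKernel] using (h.div_const (Real.Gamma (ρ + 1))).const_mul (l * rlKernel ρ (t₀ / 2))
  obtain ⟨η, hη, hη2⟩ := Metric.eventually_nhds_iff.1 (hlim.eventually (gt_mem_nhds hk0))
  set d := min (η / 2) (t₀ / 2) with hd
  have hdpos : 0 < d := by positivity
  have hdt : d ≤ t₀ / 2 := min_le_right _ _
  obtain ⟨s, hs, hmax⟩ := isCompact_Icc.exists_isMaxOn (nonempty_Icc.2 (by linarith : t₀ - d ≤ t₀))
    (hc.mono fun s (hs : s ∈ Icc (t₀ - d) t₀) => lt_of_lt_of_le (by linarith : (0 : ℝ) < t₀ - d) hs.1)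
  have hrs : 0 < r s := lt_of_lt_of_le (hpos (t₀ - d) (by linarith) (by linarith))
    (hmax ⟨le_rfl, by linarith⟩)
  have hs0 : 0 < s := lt_of_lt_of_le (by linarith) hs.1
  have hst : s < t₀ := lt_of_le_of_ne hs.2 fun h => by
    rw [h] at hrs
    exact absurd hmem.2 (not_le.2 hrs)
  have hk := key s hs0 hst
  have hI : ∫ u in s..t₀, rlKernel ρ (t₀ - u) * r u ≤ rlKernel (ρ + 1) (t₀ - s) * r s := by
    rw [← integral_rlKernel_sub hρ, ← intervalIntegral.integral_mul_const]
    refine intervalIntegral.integral_mono_on_of_le_Ioo hst.le ?_ ?_ fun u hu => ?_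
    · exact (hint t₀ ht₀pos).mono_set
        (by rw [uIcc_of_le hst.le, uIcc_of_le ht₀pos.le]; exact Icc_subset_Icc_left hs0.le)
    · have h1 : IntervalIntegrable (rlKernel ρ) volume (t₀ - s) (t₀ - t₀) :=
        (intervalIntegral.intervalIntegrable_rpow' (by linarith)).div_const _
      have := h1.comp_sub_left t₀
      simp only [sub_sub_cancel] at this
      exact this.mul_const _
    · have h0 := rlKernel_nonneg hρ (sub_pos.2 hu.2).le
      gcongr
      exact hmax ⟨by linarith [hs.1, hu.1], hu.2.le⟩
  have hks : rlKernel ρ s ≤ rlKernel ρ (t₀ / 2) := by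
    simp only [rlKernel]
    have hG := Real.Gamma_pos_of_pos hρ
    gcongr ?_ / _
    exact Real.rpow_le_rpow_of_nonpos (by linarith) (by linarith [hs.1]) (by linarith)
  have hη3 := hη2 (y := t₀ - s) (by
    rw [dist_zero_right, Real.norm_eq_abs, abs_of_pos (by linarith)]
    have : d ≤ η / 2 := min_le_left _ _
    linarith [hs.1])
  have hK1 : 0 ≤ rlKernel (ρ + 1) (t₀ - s) := rlKernel_nonneg (by linarith) (by linarith)
  have := calc rlKernel ρ t₀ * r s
      ≤ l * rlKernel ρ s * ∫ u in s..t₀, rlKernel ρ (t₀ - u) * r u := hk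
    _ ≤ l * rlKernel ρ s * (rlKernel (ρ + 1) (t₀ - s) * r s) := by
        have := rlKernel_pos hρ hs0
        gcongr
    _ ≤ l * rlKernel ρ (t₀ / 2) * (rlKernel (ρ + 1) (t₀ - s) * r s) := by
        gcongr
    _ = (l * rlKernel ρ (t₀ / 2) * rlKernel (ρ + 1) (t₀ - s)) * r s := by ring
    _ < rlKernel ρ t₀ * r s := by gcongr
  exact lt_irrefl _ this

/-! ### Bounds on the decay kernels, uniform in the rate -/

section bounds

variable {ρ α ω γ : ℝ}

lemma integrableOn_rpow_Ioc {σ T : ℝ} (hσ : 0 < σ) :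
    IntegrableOn (fun t : ℝ => t ^ (σ - 1)) (Ioc 0 T) := by
  rcases le_or_gt T 0 with h | h
  · simp [Ioc_eq_empty (not_lt.2 h)]
  · exact (intervalIntegrable_iff_integrableOn_Ioc_of_le h.le).1
      (intervalIntegral.intervalIntegrable_rpow' (by linarith))

lemma IsTame.integrableOn_seriesKernel {A : PowerSeries (PowerSeries ℝ)} (hA : IsTame A)
    (hρ : 0 < ρ) (hα : 0 < α) {σ : ℝ} (hσ : 0 < σ) (T : ℝ) :
    IntegrableOn (seriesKernel ρ α A σ) (Ioc 0 T) := by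
  obtain ⟨D, hD, hb⟩ := hA.seriesKernel_bound hρ hα hσ T
  refine ((integrableOn_rpow_Ioc (T := T) hσ).const_mul D).mono'
    (((hA.continuousOn_seriesKernel hρ hα hσ).mono fun t ht => ht.1).aestronglyMeasurable
      measurableSet_Ioc) ?_
  filter_upwards [ae_restrict_mem measurableSet_Ioc] with t ht
  exact hb t ht.1 ht.2

lemma seriesKernel_zero (σ t : ℝ) : seriesKernel ρ α 0 σ t = 0 := by
  simp [seriesKernel, biCoeff]

lemma decaySeries_zero_right (ω γ : ℝ) : decaySeries ω γ 0 = 0 := by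
  simp [decaySeries, biConst]

lemma decaySeries_zero_eq (ω l : ℝ) : decaySeries ω 0 l = biConst l * resolventSeries ω 0 l := by
  rw [decaySeries, pochSeries_zero, map_one, one_mul]

/-- For `γ = 0` the identity `Q + l x Q = l` says that the kernel is the resolvent of `l
t^{ρ-1}/Γ(ρ)`, to which `resolvent_pos` applies. -/
lemma pureDecay_nonneg (hρ : ρ ∈ Ioo (0 : ℝ) 1) (hα : 0 < α) {l t : ℝ} (hl : 0 ≤ l)
    (ht : 0 < t) : 0 ≤ seriesKernel ρ α (decaySeries ω 0 l) ρ t := by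
  rcases hl.eq_or_lt with rfl | hl
  · rw [decaySeries_zero_right, seriesKernel_zero]
  have hA := isTame_decaySeries ω l (le_refl (0 : ℝ))
  refine (resolvent_pos hρ.1 hρ.2 hl (hA.continuousOn_seriesKernel hρ.1 hα hρ.1) ?_ ?_ ht).le
  · intro T hT
    obtain ⟨D, hD, hb⟩ := hA.seriesKernel_bound hρ.1 hα hρ.1 T
    have hG := Real.Gamma_pos_of_pos hρ.1
    refine ⟨D * Real.Gamma ρ, by positivity, fun s hs hsT => (hb s hs hsT).trans_eq ?_⟩
    rw [rlKernel]
    field_simp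
  · intro t ht
    have h1 : ∫ s in (0 : ℝ)..t, rlKernel ρ (t - s) *
        seriesKernel ρ α (decaySeries ω 0 l) ρ s =
        seriesKernel ρ α (1 * decaySeries ω 0 l) (ρ + ρ) t := by
      rw [← IsTame.one.causalConv_seriesKernel hA hρ.1 hα hρ.1 hρ.1 ht]
      simp only [causalConv, seriesKernel_one, smul_eq_mul]
    have h2 : decaySeries ω 0 l + biConst l * (PowerSeries.X * decaySeries ω 0 l) = biConst l * 1 := by
      have := resolventSeries_eq ω 0 l
      rw [decaySeries_zero_eq] at this ⊢
      linear_combination biConst l * this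
    rw [h1, one_mul, ← seriesKernel_X_mul, ← seriesKernel_biConst_mul,
      ← hA.seriesKernel_add ((IsTame.biConst l).mul (IsTame.X.mul hA)) hρ.1 hα hρ.1 ht, h2,
      seriesKernel_biConst_mul, seriesKernel_one]

lemma rlKernel_one (t : ℝ) : rlKernel 1 t = 1 := by simp [rlKernel]

lemma integral_seriesKernel {A : PowerSeries (PowerSeries ℝ)} (hA : IsTame A) (hρ : 0 < ρ)
    (hα : 0 < α) {σ t : ℝ} (hσ : 0 < σ) (ht : 0 < t) :
    ∫ s in Ioc 0 t, seriesKernel ρ α A σ s = seriesKernel ρ α A (1 + σ) t := by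
  rw [← one_mul A, ← IsTame.one.causalConv_seriesKernel hA hρ hα one_pos hσ ht, causalConv,
    intervalIntegral.integral_of_le ht.le]
  simp only [seriesKernel_one, rlKernel_one, one_smul, one_mul]

/-- The relaxation function is one minus the primitive of the decay kernel. -/
lemma seriesKernel_resolventSeries (hρ : 0 < ρ) (hα : 0 < α) (hγ : 0 ≤ γ) (l : ℝ) {t : ℝ}
    (ht : 0 < t) :
    seriesKernel ρ α (resolventSeries ω γ l) 1 t =
      1 - ∫ s in Ioc 0 t, seriesKernel ρ α (decaySeries ω γ l) ρ s := by
  have hA := isTame_decaySeries ω l hγ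
  rw [integral_seriesKernel hA hρ hα hρ ht, resolventSeries_eq,
    IsTame.one.seriesKernel_sub (IsTame.X.mul hA) hρ hα one_pos ht, seriesKernel_one, rlKernel_one,
    seriesKernel_X_mul]

/-- One minus this integral is the relaxation function, and `l` times it is the convolution of the
nonnegative decay kernel with the positive kernel of order `1 - ρ`. -/
lemma integral_pureDecay_le_one (hρ : ρ ∈ Ioo (0 : ℝ) 1) (hα : 0 < α) {l t : ℝ} (hl : 0 ≤ l) :
    ∫ s in Ioc 0 t, seriesKernel ρ α (decaySeries ω 0 l) ρ s ≤ 1 := by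
  rcases le_or_gt t 0 with ht | ht
  · simp [Ioc_eq_empty (not_lt.2 ht)]
  rcases hl.eq_or_lt with rfl | hl
  · simp [decaySeries_zero_right, seriesKernel_zero]
  have h1 := seriesKernel_resolventSeries (ω := ω) hρ.1 hα le_rfl l ht
  have h2 : l * seriesKernel ρ α (resolventSeries ω 0 l) 1 t =
      causalConv (seriesKernel ρ α 1 (1 - ρ)) (seriesKernel ρ α (decaySeries ω 0 l) ρ) t := by
    rw [IsTame.one.causalConv_seriesKernel (isTame_decaySeries ω l le_rfl) hρ.1 hα
      (by linarith [hρ.2]) hρ.1 ht, one_mul, decaySeries_zero_eq, seriesKernel_biConst_mul,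
      sub_add_cancel]
  have h3 : 0 ≤ causalConv (seriesKernel ρ α 1 (1 - ρ))
      (seriesKernel ρ α (decaySeries ω 0 l) ρ) t := by
    rw [causalConv, intervalIntegral.integral_of_le ht.le]
    refine setIntegral_nonneg measurableSet_Ioc fun s hs => ?_
    rw [seriesKernel_one, smul_eq_mul]
    exact mul_nonneg (rlKernel_nonneg (by linarith [hρ.2]) (by linarith [hs.2]))
      (pureDecay_nonneg hρ hα hl.le hs.1)
  rw [← h2] at h3
  have h4 := nonneg_of_mul_nonneg_right h3 hl
  linarith

/-- The decay kernel as a perturbation of the decay kernel for `γ = 0`. -/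
lemma decayKernel_eq (hρ : 0 < ρ) (hα : 0 < α) (hγ : 0 ≤ γ) (l : ℝ) {t : ℝ} (ht : 0 < t) :
    seriesKernel ρ α (decaySeries ω γ l) ρ t = seriesKernel ρ α (decaySeries ω 0 l) ρ t +
      causalConv (seriesKernel ρ α (PowerSeries.C (pochTail ω γ)) α)
        (seriesKernel ρ α (decaySeries ω 0 l) ρ) t -
      causalConv (causalConv (seriesKernel ρ α (PowerSeries.C (pochTail ω γ)) α)
        (seriesKernel ρ α (decaySeries ω 0 l) ρ)) (seriesKernel ρ α (decaySeries ω γ l) ρ) t := by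
  have hM := isTame_C_pochTail ω γ
  have hR := isTame_decaySeries ω l (le_refl (0 : ℝ))
  have hQ := isTame_decaySeries ω l hγ
  have hMR := hM.mul hR
  have hMRQ := hMR.mul hQ
  have e1 : causalConv (causalConv (seriesKernel ρ α (PowerSeries.C (pochTail ω γ)) α)
        (seriesKernel ρ α (decaySeries ω 0 l) ρ)) (seriesKernel ρ α (decaySeries ω γ l) ρ) t =
      causalConv (seriesKernel ρ α (PowerSeries.C (pochTail ω γ) * decaySeries ω 0 l) (α + ρ))
        (seriesKernel ρ α (decaySeries ω γ l) ρ) t :=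
    causalConv_congr_left ht.le _ fun s hs _ => hM.causalConv_seriesKernel hR hρ hα hα hρ hs
  rw [e1, hMR.causalConv_seriesKernel hQ hρ hα (by positivity) hρ ht,
    hM.causalConv_seriesKernel hR hρ hα hα hρ ht, decaySeries_eq ω γ l]
  conv_lhs => rw [((hR.add (IsTame.CX.mul hMR))).seriesKernel_sub
    (IsTame.X.mul (IsTame.CX.mul hMRQ)) hρ hα hρ ht, hR.seriesKernel_add (IsTame.CX.mul hMR) hρ hα
    hρ ht, seriesKernel_X_mul, seriesKernel_Y_mul, seriesKernel_Y_mul]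
  rw [← decaySeries_eq ω γ l, add_comm ρ α, show ρ + ρ + α = α + ρ + ρ by ring]

/-- The decay kernels are bounded in `L¹(0, T)` uniformly in the rate. -/
lemma exists_integral_abs_decayKernel_le (hρ : ρ ∈ Ioo (0 : ℝ) 1) (hα : 0 < α) (hγ : 0 ≤ γ)
    (T : ℝ) : ∃ A : ℝ, 0 ≤ A ∧ ∀ l : ℝ, 0 ≤ l →
      ∫ t in Ioc 0 T, |seriesKernel ρ α (decaySeries ω γ l) ρ t| ≤ A := by
  have hM := isTame_C_pochTail ω γ
  have hm := hM.integrableOn_seriesKernel hρ.1 hα hα T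
  -- The weight depends only on the perturbing kernel, hence not on `l`.
  obtain ⟨b, hb, hκ⟩ := exists_integral_exp_mul_le hm (ε := 1 / 2) (by norm_num)
  refine ⟨Real.exp (b * T) * 3, by positivity, fun l hl => ?_⟩
  have hR := isTame_decaySeries ω l (le_refl (0 : ℝ))
  have hQ := isTame_decaySeries ω l hγ
  set m := seriesKernel ρ α (PowerSeries.C (pochTail ω γ)) α
  set r := seriesKernel ρ α (decaySeries ω 0 l) ρ with hr
  set q := seriesKernel ρ α (decaySeries ω γ l) ρ with hq
  have ir : IntegrableOn r (Ioc 0 T) := hR.integrableOn_seriesKernel hρ.1 hα hρ.1 T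
  have iq : IntegrableOn q (Ioc 0 T) := hQ.integrableOn_seriesKernel hρ.1 hα hρ.1 T
  have imr := integrableOn_causalConv hm ir
  have imrq := integrableOn_causalConv imr iq
  have wt : ∀ {f : ℝ → ℝ}, IntegrableOn f (Ioc 0 T) →
      IntegrableOn (fun t => Real.exp (-b * t) * |f t|) (Ioc 0 T) := fun hf =>
    integrableOn_exp_smul (b := b) hf.abs
  have h1 : ∫ t in Ioc 0 T, Real.exp (-b * t) * |r t| ≤ 1 := by
    refine le_trans ?_ (integral_pureDecay_le_one (ω := ω) (t := T) hρ hα hl)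
    refine setIntegral_mono_on (wt ir) ir measurableSet_Ioc fun t ht => ?_
    have hn : 0 ≤ r t := pureDecay_nonneg hρ hα hl ht.1
    rw [abs_of_nonneg hn]
    refine mul_le_of_le_one_left hn (Real.exp_le_one_iff.2 ?_)
    nlinarith [ht.1]
  have h2 := integral_exp_norm_causalConv_le (b := b) hm ir
  have h3 := integral_exp_norm_causalConv_le (b := b) imr iq
  simp only [Real.norm_eq_abs] at h2 h3
  have hsplit : ∫ t in Ioc 0 T, Real.exp (-b * t) * |q t| ≤
      (∫ t in Ioc 0 T, Real.exp (-b * t) * |r t|) +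
      (∫ t in Ioc 0 T, Real.exp (-b * t) * |causalConv m r t|) +
      ∫ t in Ioc 0 T, Real.exp (-b * t) * |causalConv (causalConv m r) q t| := by
    have i12 : IntegrableOn (fun t => Real.exp (-b * t) * |r t| +
        Real.exp (-b * t) * |causalConv m r t|) (Ioc 0 T) := (wt ir).add (wt imr)
    rw [← integral_add (wt ir) (wt imr), ← integral_add i12 (wt imrq)]
    refine setIntegral_mono_on (wt iq) (i12.add (wt imrq)) measurableSet_Ioc fun t ht => ?_
    have e := decayKernel_eq (ω := ω) hρ.1 hα hγ l ht.1
    rw [← mul_add, ← mul_add]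
    gcongr
    rw [hq, e]
    exact (abs_sub _ _).trans (add_le_add (abs_add_le _ _) le_rfl)
  have n : ∀ f : ℝ → ℝ, 0 ≤ ∫ t in Ioc 0 T, Real.exp (-b * t) * |f t| := fun f =>
    setIntegral_nonneg measurableSet_Ioc fun t _ => by positivity
  -- In weighted norms, `‖q‖ ≤ ‖r‖ + ‖m * r‖ + ‖m * r‖ ‖q‖ ≤ 1 + 1/2 + ‖q‖/2`, whence `‖q‖ ≤ 3`.
  have h4 : ∫ t in Ioc 0 T, Real.exp (-b * t) * |q t| ≤ 3 := by
    have n1 := n r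
    have n2 := n q
    have n3 := n m
    have n4 := n (causalConv m r)
    set a1 := ∫ t in Ioc 0 T, Real.exp (-b * t) * |r t|
    set a2 := ∫ t in Ioc 0 T, Real.exp (-b * t) * |q t|
    set a3 := ∫ t in Ioc 0 T, Real.exp (-b * t) * |m t|
    set a4 := ∫ t in Ioc 0 T, Real.exp (-b * t) * |causalConv m r t|
    have f1 : a3 * a1 ≤ 1 / 2 * 1 := mul_le_mul hκ h1 n1 (by norm_num)
    have f2 : a4 ≤ 1 / 2 := by linarith
    have f3 : a4 * a2 ≤ 1 / 2 * a2 := by gcongr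
    linarith
  calc ∫ t in Ioc 0 T, |q t|
      ≤ ∫ t in Ioc 0 T, Real.exp (b * T) * (Real.exp (-b * t) * |q t|) := by
        refine setIntegral_mono_on iq.abs ((wt iq).const_mul _) measurableSet_Ioc fun t ht => ?_
        rw [← mul_assoc, ← Real.exp_add]
        refine le_mul_of_one_le_left (abs_nonneg _) (Real.one_le_exp ?_)
        nlinarith [ht.2]
    _ = Real.exp (b * T) * ∫ t in Ioc 0 T, Real.exp (-b * t) * |q t| := integral_const_mul _ _
    _ ≤ _ := by gcongr

/-- The decay kernels are `O(1/t)` on `(0, T]` uniformly in the rate. -/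
lemma exists_mul_abs_decayKernel_le (hρ : ρ ∈ Ioo (0 : ℝ) 1) (hα : 0 < α) (hγ : 0 ≤ γ)
    (T : ℝ) : ∃ B : ℝ, 0 ≤ B ∧ ∀ l : ℝ, 0 ≤ l → ∀ t : ℝ, 0 < t → t ≤ T →
      t * |seriesKernel ρ α (decaySeries ω γ l) ρ t| ≤ B := by
  obtain ⟨A, hA0, hA⟩ := exists_integral_abs_decayKernel_le (ω := ω) hρ hα hγ T
  have hG := isTame_C_geomSeries ω
  set w := seriesKernel ρ α (PowerSeries.C (geomSeries ω)) α with hw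
  have iw : IntegrableOn w (Ioc 0 T) := hG.integrableOn_seriesKernel hρ.1 hα hα T
  set W := ∫ t in Ioc 0 T, |w t| with hW
  have hW0 : 0 ≤ W := setIntegral_nonneg measurableSet_Ioc fun t _ => abs_nonneg _
  refine ⟨ρ * (A + A * A) + |α * γ| * (W * (A + A * A)), by
    have := hρ.1; positivity, fun l hl t ht htT => ?_⟩
  have hQ := isTame_decaySeries ω l hγ
  set Q := decaySeries ω γ l with hQdef
  set q := seriesKernel ρ α Q ρ with hq
  have iq : IntegrableOn q (Ioc 0 T) := hQ.integrableOn_seriesKernel hρ.1 hα hρ.1 T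
  have hS : IsTame (Q - PowerSeries.X * (Q * Q)) := hQ.sub (IsTame.X.mul (hQ.mul hQ))
  set S := Q - PowerSeries.X * (Q * Q) with hSdef
  have is : IntegrableOn (seriesKernel ρ α S ρ) (Ioc 0 T) :=
    hS.integrableOn_seriesKernel hρ.1 hα hρ.1 T
  have hsbd : ∫ t in Ioc 0 T, |seriesKernel ρ α S ρ t| ≤ A + A * A := by
    have iqq := integrableOn_causalConv iq iq
    have hqq := integral_norm_causalConv_le iq iq
    simp only [Real.norm_eq_abs] at hqq
    calc ∫ t in Ioc 0 T, |seriesKernel ρ α S ρ t|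
        ≤ ∫ t in Ioc 0 T, (|q t| + |causalConv q q t|) := by
          refine setIntegral_mono_on is.abs (iq.abs.add iqq.abs) measurableSet_Ioc fun s hs => ?_
          rw [hSdef, hQ.seriesKernel_sub (IsTame.X.mul (hQ.mul hQ)) hρ.1 hα hρ.1 hs.1,
            seriesKernel_X_mul, ← hQ.causalConv_seriesKernel hQ hρ.1 hα hρ.1 hρ.1 hs.1]
          exact abs_sub _ _
      _ = (∫ t in Ioc 0 T, |q t|) + ∫ t in Ioc 0 T, |causalConv q q t| :=
          integral_add iq.abs iqq.abs
      _ ≤ A + A * A := by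
          have h1 := hA l hl
          have h0 : 0 ≤ ∫ t in Ioc 0 T, |q t| :=
            setIntegral_nonneg measurableSet_Ioc fun t _ => abs_nonneg _
          have : (∫ t in Ioc 0 T, |q t|) * (∫ t in Ioc 0 T, |q t|) ≤ A * A :=
            mul_le_mul h1 h1 h0 hA0
          linarith
  have prim : ∀ {f : ℝ → ℝ}, IntegrableOn f (Ioc 0 T) →
      |∫ s in Ioc 0 t, f s| ≤ ∫ s in Ioc 0 T, |f s| := fun {f} hf => by
    refine (abs_integral_le_integral_abs).trans ?_
    exact setIntegral_mono_set hf.abs (Eventually.of_forall fun _ => abs_nonneg _)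
      (Ioc_subset_Ioc_right htT).eventuallyLE
  have hGS := hG.mul hS
  have hC1 : IsTame (biConst ρ * S) := (IsTame.biConst ρ).mul hS
  have hC2 : IsTame (biConst (α * γ) * (PowerSeries.C PowerSeries.X *
      (PowerSeries.C (geomSeries ω) * S))) := (IsTame.biConst _).mul (IsTame.CX.mul hGS)
  -- The Euler identity writes `t q(t)` as the kernel of order `ρ + 1` of `(ρ + αγ y G) S` with `S =
  -- Q - x Q²`. The extra order one is a primitive, so `L¹` bounds suffice: the kernel `q - q * q`
  -- of `S` has norm at most `A + A²`, and its convolution with `w` at most `W (A + A²)`.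
  have hE := mul_seriesKernel hρ.1 hα hρ.1 ht (biCoeff_euler ω γ l ρ α)
  have hE2 : (biConst ρ + biConst (α * γ) *
        (PowerSeries.C PowerSeries.X * PowerSeries.C (geomSeries ω))) * S =
      biConst ρ * S + biConst (α * γ) * (PowerSeries.C PowerSeries.X *
        (PowerSeries.C (geomSeries ω) * S)) := by ring
  have hq' : t * |q t| = |t * q t| := by rw [abs_mul, abs_of_pos ht]
  have hρ1 : 0 < ρ + 1 := by linarith [hρ.1]
  rw [hq', hq, hQdef, hE, ← hQdef, ← hSdef, hE2, hC1.seriesKernel_add hC2 hρ.1 hα hρ1 ht,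
    seriesKernel_biConst_mul, seriesKernel_biConst_mul, seriesKernel_Y_mul,
    show ρ + 1 + α = 1 + (α + ρ) by ring, add_comm ρ 1,
    ← integral_seriesKernel hS hρ.1 hα hρ.1 ht,
    ← integral_seriesKernel hGS hρ.1 hα (by linarith [hρ.1]) ht]
  refine (abs_add_le _ _).trans ?_
  rw [abs_mul, abs_mul, abs_of_pos hρ.1]
  have hρ0 := hρ.1
  have b1 := (prim is).trans hsbd
  have iws := integrableOn_causalConv iw is
  have hws := integral_norm_causalConv_le iw is
  simp only [Real.norm_eq_abs] at hws
  have e2 : ∫ s in Ioc 0 t, seriesKernel ρ α (PowerSeries.C (geomSeries ω) * S) (α + ρ) s =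
      ∫ s in Ioc 0 t, causalConv w (seriesKernel ρ α S ρ) s :=
    setIntegral_congr_fun measurableSet_Ioc fun s hs =>
      (hG.causalConv_seriesKernel hS hρ.1 hα hα hρ.1 hs.1).symm
  have b2 := (prim iws).trans (hws.trans (mul_le_mul_of_nonneg_left hsbd hW0))
  rw [e2]
  gcongr

end bounds

/-! ### Mittag-Leffler series and Prabhakar integrals as series kernels -/

section link

variable {ρ α ω γ : ℝ}

lemma prabhakarKernel_eq_tsum {t : ℝ} (ht : 0 < t) (σ c : ℝ) :
    prabhakarKernel α σ c ω t =
      ∑' j : ℕ, PowerSeries.coeff j (pochSeries ω c) * rlKernel (α * j + σ) t := by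
  rw [prabhakarKernel, mittagLeffler, ← tsum_mul_left]
  refine tsum_congr fun j => ?_
  rw [pochSeries, PowerSeries.coeff_mk, rlKernel, mul_pow, ← Real.rpow_natCast (t ^ α),
    ← Real.rpow_mul ht.le, show α * j + σ - 1 = (σ - 1) + α * j by ring, Real.rpow_add ht]
  ring

lemma prabhakarKernel_eq_seriesKernel {t : ℝ} (ht : 0 < t) (σ c : ℝ) :
    prabhakarKernel α σ c ω t = seriesKernel ρ α (PowerSeries.C (pochSeries ω c)) σ t := by
  have he : Function.Injective (fun j : ℕ => ((0 : ℕ), j)) := fun a b h => by simpa using h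
  rw [prabhakarKernel_eq_tsum ht, seriesKernel, tsum_eq_tsum_comp_of_injective he]
  · simp [biCoeff]
  · rintro ⟨n, j⟩ hn
    have : n ≠ 0 := by
      rintro rfl
      exact hn ⟨j, rfl⟩
    simp [biCoeff, PowerSeries.coeff_C, this]

/-- The relaxation function `∑ E_{α,ρn+1}^{γn}(ω t^α) (-l)^n t^{ρn}`, written as one minus the
primitive of the decay kernel. -/
def relaxation (ρ α ω γ l t : ℝ) : ℝ :=
  1 - ∫ s in (0 : ℝ)..t, seriesKernel ρ α (decaySeries ω γ l) ρ s

lemma relaxation_eq (hρ : 0 < ρ) (hα : 0 < α) (hγ : 0 ≤ γ) (l : ℝ) {t : ℝ} (ht : 0 < t) :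
    relaxation ρ α ω γ l t = seriesKernel ρ α (resolventSeries ω γ l) 1 t := by
  rw [seriesKernel_resolventSeries hρ hα hγ l ht, relaxation, intervalIntegral.integral_of_le ht.le]

lemma relaxation_zero (l : ℝ) : relaxation ρ α ω γ l 0 = 1 := by simp [relaxation]

lemma mittagLeffler_zero (z : ℝ) : mittagLeffler α 1 0 z = 1 := by
  rw [mittagLeffler, tsum_eq_single 0]
  · simp
  · intro j hj
    simp [ascPochhammer_ne_zero_eval_zero ℝ hj]

/-- Summation by rows of the absolutely convergent double series: each row in `j` is one
Mittag-Leffler function. At `t = 0` the factor `0^{ρn}` leaves only the term `n = 0`. -/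
lemma hasSum_relaxation (hρ : 0 < ρ) (hα : 0 < α) (hγ : 0 ≤ γ) (l : ℝ) {t : ℝ} (ht : 0 ≤ t) :
    HasSum (fun n : ℕ => mittagLeffler α (ρ * n + 1) (γ * n) (ω * t ^ α) * (-l) ^ n *
      t ^ (ρ * n)) (relaxation ρ α ω γ l t) := by
  rcases ht.eq_or_lt with rfl | ht
  · rw [relaxation_zero]
    have h := hasSum_single (f := fun n : ℕ => mittagLeffler α (ρ * n + 1) (γ * n)
      (ω * (0 : ℝ) ^ α) * (-l) ^ n * (0 : ℝ) ^ (ρ * n)) 0 fun n hn => by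
        have : ρ * (n : ℝ) ≠ 0 := mul_ne_zero hρ.ne' (Nat.cast_ne_zero.2 hn)
        simp [Real.zero_rpow this]
    simpa [mittagLeffler_zero] using h
  · rw [relaxation_eq hρ hα hγ l ht]
    have hs := (isTame_resolventSeries ω l hγ).hasSum hρ hα one_pos ht
    have h := hs.prod_fiberwise (fun n => (hs.summable.prod_factor n).hasSum)
    convert h using 2 with n
    have h1 := prabhakarKernel_eq_tsum (α := α) (ω := ω) ht (ρ * n + 1) (γ * n)
    rw [prabhakarKernel, add_sub_cancel_right] at h1
    rw [mul_right_comm, mul_comm (mittagLeffler _ _ _ _), h1, mul_comm, ← tsum_mul_left]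
    refine tsum_congr fun j => ?_
    simp only [biCoeff]
    rw [coeff_resolventSeries, PowerSeries.coeff_C_mul,
      show α * (j : ℝ) + (ρ * n + 1) = ρ * n + α * j + 1 by ring]
    ring

lemma hasSum_heatTerm (hρ : 0 < ρ) (hα : 0 < α) (hγ : 0 ≤ γ) (N : ℝ) (g : ℝ → ℂ) (x : ℝ)
    {t : ℝ} (ht : 0 ≤ t) (k : ℝ) :
    HasSum (heatTerm α ω γ ρ N g x t k)
      (Complex.exp (-Complex.I * k * x) *
        ((relaxation ρ α ω γ (N * k ^ 2) t : ℂ) * fourierStar g k)) := by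
  have h := Complex.hasSum_ofReal.2 (hasSum_relaxation (ω := ω) hρ hα hγ (N * k ^ 2) ht)
  have h2 := (h.mul_right (fourierStar g k)).mul_left (Complex.exp (-Complex.I * k * x))
  have e : heatTerm α ω γ ρ N g x t k = fun n : ℕ => Complex.exp (-Complex.I * k * x) *
      (((mittagLeffler α (ρ * n + 1) (γ * n) (ω * t ^ α) * (-(N * k ^ 2)) ^ n *
        t ^ (ρ * n) : ℝ) : ℂ) * fourierStar g k) := by
    funext n
    simp only [heatTerm]
    push_cast
    rw [neg_mul (N : ℂ)]
    ring
  rw [e]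
  exact h2

/-- The order of a fractional integral is positive, or the integral is the identity. -/
def IsOrder (σ c : ℝ) : Prop := 0 < σ ∨ σ = 0 ∧ c = 0

/-- The term `j = 0` carries `1/Γ(0)`, which is `0`, and `(0)_j = 0` for `j ≥ 1`. Hence at order
zero and parameter zero only the Dirac part of the integral acts. -/
lemma prabhakarKernel_zero_zero (t : ℝ) : prabhakarKernel α 0 0 ω t = 0 := by
  have : mittagLeffler α 0 0 (ω * t ^ α) = 0 := by
    rw [mittagLeffler]
    refine (tsum_congr fun j => ?_).trans tsum_zero
    rcases Nat.eq_zero_or_pos j with rfl | hj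
    · simp
    · simp [ascPochhammer_ne_zero_eval_zero ℝ hj.ne']
  rw [prabhakarKernel, this, mul_zero]

lemma prabhakarIntegral_zero_zero (f : ℝ → ℂ) (t : ℝ) : prabhakarIntegral α 0 0 ω f t = f t := by
  simp [prabhakarIntegral, prabhakarKernel_zero_zero]

lemma prabhakarIntegrable_zero_zero (f : ℝ → ℂ) (t : ℝ) : PrabhakarIntegrable α 0 0 ω f t := by
  simp [PrabhakarIntegrable, prabhakarKernel_zero_zero]

lemma prabhakarIntegral_of_pos {σ : ℝ} (hσ : 0 < σ) (c : ℝ) (f : ℝ → ℂ) (t : ℝ) :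
    prabhakarIntegral α σ c ω f t = causalConv (prabhakarKernel α σ c ω) f t := by
  simp [prabhakarIntegral, causalConv, hσ.ne']

lemma prabhakarIntegral_congr {σ c t : ℝ} (ht : 0 < t) {f f' : ℝ → ℂ}
    (h : ∀ s, 0 < s → s ≤ t → f s = f' s) :
    prabhakarIntegral α σ c ω f t = prabhakarIntegral α σ c ω f' t := by
  rw [prabhakarIntegral, prabhakarIntegral, h t ht le_rfl]
  congr 1
  rw [intervalIntegral.integral_of_le ht.le, intervalIntegral.integral_of_le ht.le]
  exact setIntegral_congr_fun measurableSet_Ioc fun s hs => by simp only [h s hs.1 hs.2]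

lemma prabhakarIntegrable_congr {σ c t : ℝ} (ht : 0 < t) {f f' : ℝ → ℂ}
    (h : ∀ s, 0 < s → s ≤ t → f s = f' s) (hf : PrabhakarIntegrable α σ c ω f t) :
    PrabhakarIntegrable α σ c ω f' t := by
  refine hf.congr fun s hs => ?_
  rw [uIoc_of_le ht.le] at hs
  simp only [h s hs.1 hs.2]

/-- The action of a Prabhakar integral on a series kernel. -/
lemma prabhakarIntegral_seriesKernel (hρ : 0 < ρ) (hα : 0 < α) {σ c τ t : ℝ} (h : IsOrder σ c)
    (hτ : 0 < τ) (ht : 0 < t) {A : PowerSeries (PowerSeries ℝ)} (hA : IsTame A) :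
    prabhakarIntegral α σ c ω (fun s => (seriesKernel ρ α A τ s : ℂ)) t =
      (seriesKernel ρ α (PowerSeries.C (pochSeries ω c) * A) (σ + τ) t : ℂ) := by
  rcases h with hσ | ⟨rfl, rfl⟩
  · rw [prabhakarIntegral_of_pos hσ, ← (isTame_C_pochSeries ω c).causalConv_seriesKernel hA hρ hα hσ
      hτ ht]
    rw [causalConv_congr_left ht.le _ fun s hs _ =>
      prabhakarKernel_eq_seriesKernel (ρ := ρ) hs σ c, causalConv, causalConv,
      ← intervalIntegral.integral_ofReal]
    simp
  · rw [prabhakarIntegral_zero_zero, pochSeries_zero, map_one, one_mul, zero_add]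

/-- Bound for a weakly singular convolution. -/
lemma integral_rpow_mul_abs_le {σ A B t : ℝ} (hσ : 0 < σ) (hσ1 : σ ≤ 1) (ht : 0 < t) {f : ℝ → ℝ}
    (hf : ContinuousOn f (Ioi 0)) (hfi : IntegrableOn f (Ioc 0 t))
    (hA : ∫ s in Ioc 0 t, |f s| ≤ A) (hB : ∀ s, 0 < s → s ≤ t → s * |f s| ≤ B) :
    IntegrableOn (fun s => (t - s) ^ (σ - 1) * |f s|) (Ioc 0 t) ∧
      ∫ s in Ioc 0 t, (t - s) ^ (σ - 1) * |f s| ≤ (t / 2) ^ (σ - 1) * (A + B / σ) := by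
  -- On the first half the weight is at most `(t/2)^{σ-1}` and the `L¹` bound is used; on the second
  -- half `|f| ≤ 2B/t` and the singular weight is integrated exactly.
  have hsplit : Ioc 0 t = Ioc 0 (t / 2) ∪ Ioc (t / 2) t :=
    (Ioc_union_Ioc_eq_Ioc (by linarith) (by linarith)).symm
  have hB0 : 0 ≤ B := le_trans (by positivity) (hB t ht le_rfl)
  have hfi1 : IntegrableOn (fun s => |f s|) (Ioc 0 (t / 2)) :=
    IntegrableOn.mono_set hfi.abs (Ioc_subset_Ioc_right (by linarith))
  have b1 : ∀ s ∈ Ioc 0 (t / 2), (t - s) ^ (σ - 1) * |f s| ≤ (t / 2) ^ (σ - 1) * |f s| := by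
    intro s hs
    refine mul_le_mul_of_nonneg_right ?_ (abs_nonneg _)
    exact Real.rpow_le_rpow_of_nonpos (by linarith) (by linarith [hs.2]) (by linarith)
  have b2 : ∀ s ∈ Ioc (t / 2) t, (t - s) ^ (σ - 1) * |f s| ≤ (2 * B / t) * (t - s) ^ (σ - 1) := by
    intro s hs
    have hs0 : 0 < s := by linarith [hs.1]
    rw [mul_comm]
    refine mul_le_mul_of_nonneg_right ?_ (Real.rpow_nonneg (by linarith [hs.2]) _)
    have h1 := hB s hs0 hs.2
    rw [le_div_iff₀ ht]
    nlinarith [hs.1, abs_nonneg (f s)]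
  have hmeas : ∀ a b : ℝ, 0 ≤ a → b ≤ t →
      AEStronglyMeasurable (fun s => (t - s) ^ (σ - 1) * |f s|) (volume.restrict (Ioc a b)) := by
    intro a b ha hb
    refine AEStronglyMeasurable.mul ?_ ?_
    · exact ((measurable_const.sub measurable_id).pow_const _).aestronglyMeasurable
    · exact ((hf.mono fun s hs => ha.trans_lt hs.1).abs).aestronglyMeasurable measurableSet_Ioc
  have i1 : IntegrableOn (fun s => (t - s) ^ (σ - 1) * |f s|) (Ioc 0 (t / 2)) := by
    refine (hfi1.const_mul ((t / 2) ^ (σ - 1))).mono' (hmeas _ _ le_rfl (by linarith)) ?_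
    filter_upwards [ae_restrict_mem measurableSet_Ioc] with s hs
    rw [Real.norm_of_nonneg (mul_nonneg (Real.rpow_nonneg (by linarith [hs.2]) _) (abs_nonneg _))]
    exact b1 s hs
  have hpow : IntegrableOn (fun s => (2 * B / t) * (t - s) ^ (σ - 1)) (Ioc (t / 2) t) := by
    have h1 : IntervalIntegrable (fun s : ℝ => s ^ (σ - 1)) volume (t - t / 2) (t - t) :=
      intervalIntegral.intervalIntegrable_rpow' (by linarith)
    have h2 := h1.comp_sub_left t
    simp only [sub_sub_cancel] at h2
    exact ((intervalIntegrable_iff_integrableOn_Ioc_of_le (by linarith)).1 h2).const_mul _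
  have i2 : IntegrableOn (fun s => (t - s) ^ (σ - 1) * |f s|) (Ioc (t / 2) t) := by
    refine hpow.mono' (hmeas _ _ (by linarith) le_rfl) ?_
    filter_upwards [ae_restrict_mem measurableSet_Ioc] with s hs
    rw [Real.norm_of_nonneg (mul_nonneg (Real.rpow_nonneg (by linarith [hs.2]) _) (abs_nonneg _))]
    exact b2 s hs
  have i3 : IntegrableOn (fun s => (t - s) ^ (σ - 1) * |f s|) (Ioc 0 t) := by
    rw [hsplit]; exact i1.union i2
  refine ⟨i3, ?_⟩
  rw [hsplit, setIntegral_union (Ioc_disjoint_Ioc_of_le le_rfl) measurableSet_Ioc i1 i2, mul_add]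
  refine add_le_add ?_ ?_
  · calc _ ≤ ∫ s in Ioc 0 (t / 2), (t / 2) ^ (σ - 1) * |f s| :=
          setIntegral_mono_on i1 (hfi1.const_mul _) measurableSet_Ioc b1
      _ = (t / 2) ^ (σ - 1) * ∫ s in Ioc 0 (t / 2), |f s| := integral_const_mul _ _
      _ ≤ (t / 2) ^ (σ - 1) * A := by
          refine mul_le_mul_of_nonneg_left (le_trans ?_ hA) (by positivity)
          exact setIntegral_mono_set hfi.abs (Eventually.of_forall fun _ => abs_nonneg _)
            (Ioc_subset_Ioc_right (by linarith)).eventuallyLE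
  · calc _ ≤ ∫ s in Ioc (t / 2) t, (2 * B / t) * (t - s) ^ (σ - 1) :=
          setIntegral_mono_on i2 hpow measurableSet_Ioc b2
      _ = (2 * B / t) * ((t / 2) ^ σ / σ) := by
          rw [integral_const_mul, ← intervalIntegral.integral_of_le (by linarith),
            intervalIntegral.integral_comp_sub_left (fun s : ℝ => s ^ (σ - 1)), sub_self,
            integral_rpow (Or.inl (by linarith)), sub_add_cancel, Real.zero_rpow hσ.ne',
            sub_zero, sub_half]
      _ = _ := by
          rw [Real.rpow_sub_one (by positivity)]
          field_simp

end link

/-! ### Fourier integrals: differentiation, decay at infinity, inversion -/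

/-- The Fourier integral `∫ e^{-ikx} a(k) dk`. -/
def fourierExp (a : ℝ → ℂ) (x : ℝ) : ℂ := ∫ k : ℝ, Complex.exp (-Complex.I * k * x) * a k

lemma norm_exp_neg_I_mul (k x : ℝ) : ‖Complex.exp (-Complex.I * k * x)‖ = 1 := by
  have : -Complex.I * k * x = ((-k * x : ℝ) : ℂ) * Complex.I := by push_cast; ring
  rw [this, Complex.norm_exp_ofReal_mul_I]

lemma integrable_exp_mul {a : ℝ → ℂ} (ha : Integrable a) (x : ℝ) :
    Integrable fun k : ℝ => Complex.exp (-Complex.I * k * x) * a k := by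
  refine ha.norm.mono' ((by fun_prop : Continuous fun k : ℝ =>
    Complex.exp (-Complex.I * k * x)).aestronglyMeasurable.mul ha.aestronglyMeasurable) ?_
  exact Eventually.of_forall fun k => by rw [norm_mul, norm_exp_neg_I_mul, one_mul]

lemma norm_fourierExp_le (a : ℝ → ℂ) (x : ℝ) : ‖fourierExp a x‖ ≤ ∫ k, ‖a k‖ := by
  refine (norm_integral_le_integral_norm _).trans_eq ?_
  simp only [norm_mul, norm_exp_neg_I_mul, one_mul]

lemma continuous_fourierExp {a : ℝ → ℂ} (ha : Integrable a) : Continuous (fourierExp a) := by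
  refine continuous_of_dominated (bound := fun k => ‖a k‖)
    (fun x => (integrable_exp_mul ha x).aestronglyMeasurable) (fun x => ?_) ha.norm ?_
  · exact Eventually.of_forall fun k => by rw [norm_mul, norm_exp_neg_I_mul, one_mul]
  · exact Eventually.of_forall fun k => by fun_prop

lemma hasDerivAt_fourierExp {a : ℝ → ℂ} (ha : Integrable a)
    (ha' : Integrable fun k : ℝ => -Complex.I * k * a k) (x : ℝ) :
    HasDerivAt (fourierExp a) (fourierExp (fun k : ℝ => -Complex.I * k * a k) x) x := by
  refine (hasDerivAt_integral_of_dominated_loc_of_deriv_le (s := univ)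
    (F := fun (x : ℝ) (k : ℝ) => Complex.exp (-Complex.I * k * x) * a k)
    (F' := fun (x : ℝ) (k : ℝ) => Complex.exp (-Complex.I * k * x) * (-Complex.I * k * a k))
    (bound := fun k => ‖-Complex.I * k * a k‖) univ_mem
    (Eventually.of_forall fun x => (integrable_exp_mul ha x).aestronglyMeasurable)
    (integrable_exp_mul ha x) (integrable_exp_mul ha' x).aestronglyMeasurable ?_ ha'.norm ?_).2
  · exact Eventually.of_forall fun k y _ => by rw [norm_mul, norm_exp_neg_I_mul, one_mul]
  · refine Eventually.of_forall fun k y _ => ?_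
    have h1 : HasDerivAt (fun y : ℝ => -Complex.I * k * (y : ℂ)) (-Complex.I * k) y := by
      simpa using (Complex.ofRealCLM.hasDerivAt (x := y)).const_mul (-Complex.I * k)
    have h2 := (h1.cexp).mul_const (a k)
    exact h2.congr_deriv (by ring)

lemma contDiff_two_fourierExp {a : ℝ → ℂ} (ha : Integrable a)
    (ha1 : Integrable fun k : ℝ => -Complex.I * k * a k)
    (ha2 : Integrable fun k : ℝ => -(k : ℂ) ^ 2 * a k) :
    ContDiff ℝ 2 (fourierExp a) ∧
      iteratedDeriv 2 (fourierExp a) = fourierExp (fun k : ℝ => -(k : ℂ) ^ 2 * a k) := by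
  have e : (fun k : ℝ => -Complex.I * k * (-Complex.I * k * a k)) =
      fun k : ℝ => -(k : ℂ) ^ 2 * a k := by
    funext k
    linear_combination ((k : ℂ) ^ 2 * a k) * Complex.I_mul_I
  have h1 := hasDerivAt_fourierExp ha ha1
  have h2 := hasDerivAt_fourierExp ha1 (by rwa [e])
  rw [e] at h2
  have d1 : deriv (fourierExp a) = fourierExp (fun k : ℝ => -Complex.I * k * a k) :=
    funext fun x => (h1 x).deriv
  have d2 : deriv (fourierExp (fun k : ℝ => -Complex.I * k * a k)) =
      fourierExp (fun k : ℝ => -(k : ℂ) ^ 2 * a k) := funext fun x => (h2 x).deriv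
  constructor
  · rw [show (2 : WithTop ℕ∞) = 1 + 1 by norm_num, contDiff_succ_iff_deriv]
    refine ⟨fun x => (h1 x).differentiableAt, by simp, ?_⟩
    rw [d1, contDiff_one_iff_deriv, d2]
    exact ⟨fun x => (h2 x).differentiableAt, continuous_fourierExp ha2⟩
  · rw [iteratedDeriv_succ, iteratedDeriv_one, d1, d2]

open scoped FourierTransform in
lemma fourierExp_eq_fourier (a : ℝ → ℂ) (x : ℝ) :
    fourierExp a x = 𝓕 a (x / (2 * Real.pi)) := by
  rw [fourierExp, Real.fourier_real_eq_integral_exp_smul]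
  congr 1
  funext k
  rw [smul_eq_mul]
  congr 2
  push_cast
  have : (Real.pi : ℂ) ≠ 0 := Complex.ofReal_ne_zero.2 Real.pi_ne_zero
  field_simp

/-- The Riemann-Lebesgue lemma, which supplies the boundary condition at infinity. -/
lemma tendsto_fourierExp (a : ℝ → ℂ) : Tendsto (fourierExp a) (cocompact ℝ) (𝓝 0) := by
  have h := Real.zero_at_infty_fourier a
  have h2 : Tendsto (fun x : ℝ => x / (2 * Real.pi)) (cocompact ℝ) (cocompact ℝ) :=
    (Homeomorph.mulRight₀ (2 * Real.pi)⁻¹ (by positivity)).isClosedEmbedding.tendsto_cocompact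
  exact (h.comp h2).congr fun x => (fourierExp_eq_fourier a x).symm

open scoped FourierTransform in
lemma fourierStar_eq_fourier (g : ℝ → ℂ) (k : ℝ) :
    fourierStar g k = 𝓕 g (-(k / (2 * Real.pi))) := by
  rw [← neg_div, ← fourierExp_eq_fourier, fourierStar, fourierExp]
  congr 1
  funext x
  rw [mul_comm]
  congr 2
  push_cast
  ring

lemma continuous_fourierStar {g : ℝ → ℂ} (hg : Integrable g) : Continuous (fourierStar g) := by
  have h : fourierStar g = fun k => fourierExp g (-k) := by
    funext k
    rw [fourierStar_eq_fourier, fourierExp_eq_fourier, neg_div]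
  rw [h]
  exact (continuous_fourierExp hg).comp continuous_neg

open scoped FourierTransform in
lemma fourierExp_fourierStar {g : ℝ → ℂ} (hc : Continuous g) (hg : Integrable g)
    (hs : Integrable (fourierStar g)) (x : ℝ) :
    fourierExp (fourierStar g) x = 2 * Real.pi * g x := by
  have hpi : (0 : ℝ) < 2 * Real.pi := by positivity
  -- The two normalizations of the transform differ by the substitution `k = -2π ξ`, which is also
  -- the source of the factor `2π`.
  have hF : 𝓕 g = fun ξ => fourierStar g (-(2 * Real.pi) * ξ) := by
    funext ξ
    rw [fourierStar_eq_fourier]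
    field_simp
  have hFi : Integrable (𝓕 g) := by
    rw [hF]
    exact hs.comp_mul_left' (by linarith)
  have h := hc.fourierInv_fourier_eq hg hFi
  have h2 : 𝓕⁻ (𝓕 g) x = (2 * Real.pi : ℝ)⁻¹ • fourierExp (fourierStar g) x := by
    rw [Real.fourierInv_eq', fourierExp]
    have := Measure.integral_comp_mul_left (fun k : ℝ =>
      Complex.exp (-Complex.I * k * x) * fourierStar g k) (-(2 * Real.pi))
    rw [abs_inv, abs_neg, abs_of_pos hpi] at this
    rw [← this, hF]
    refine integral_congr_ae (Eventually.of_forall fun v => ?_)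
    simp only
    rw [smul_eq_mul]
    congr 2
    simp
    ring
  rw [h] at h2
  rw [h2, Complex.real_smul]
  push_cast
  have : (Real.pi : ℂ) ≠ 0 := Complex.ofReal_ne_zero.2 Real.pi_ne_zero
  field_simp

/-! ### The family of modes: fractional integrals and interchange with the frequency integral -/

section family

variable {ρ α ω γ : ℝ}

lemma C_pochSeries_mul_decaySeries (ω γ c l : ℝ) :
    PowerSeries.C (pochSeries ω c) * decaySeries ω γ l =
      biConst l * PowerSeries.rescale (PowerSeries.C (-l)) (pochFamily ω γ (c + γ)) := by
  rw [← C_pochSeries_mul_resolventSeries, decaySeries, pochSeries_add, map_mul]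
  ring

lemma continuousOn_decayKernel (hρ : 0 < ρ) (hα : 0 < α) (hγ : 0 ≤ γ) (c : ℝ) {σ : ℝ}
    (hσ : 0 < σ) :
    ContinuousOn (fun z : ℝ × ℝ =>
      seriesKernel ρ α (PowerSeries.C (pochSeries ω c) * decaySeries ω γ z.1) σ z.2)
      {z | 0 < z.2} := by
  have h := ((isTame_pochFamily ω (c + γ) hγ).continuousOn_rescale hρ hα hσ).comp
    (f := fun z : ℝ × ℝ => (-z.1, z.2)) (s := {z | 0 < z.2}) (by fun_prop) (fun z hz => hz)
  simp only [C_pochSeries_mul_decaySeries, seriesKernel_biConst_mul]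
  exact continuousOn_fst.mul h

lemma continuous_relaxation (hρ : 0 < ρ) (hα : 0 < α) (hγ : 0 ≤ γ) {t : ℝ} (ht : 0 ≤ t) :
    Continuous fun l => relaxation ρ α ω γ l t := by
  rcases ht.eq_or_lt with rfl | ht
  · simp only [relaxation_zero]
    exact continuous_const
  have h := ((isTame_pochFamily ω 0 hγ).continuousOn_rescale hρ hα one_pos).comp
    (f := fun l : ℝ => (-l, t)) (s := univ) (by fun_prop) (fun z _ => ht)
  rw [← continuousOn_univ]
  refine h.congr fun l _ => ?_
  rw [relaxation_eq hρ hα hγ l ht]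
  rfl

lemma isTame_C_pochSeries_mul_decaySeries (hγ : 0 ≤ γ) (c l : ℝ) :
    IsTame (PowerSeries.C (pochSeries ω c) * decaySeries ω γ l) :=
  (isTame_C_pochSeries ω c).mul (isTame_decaySeries ω l hγ)

/-- The `L¹` bound and the `O(1/t)` bound on the decay kernels are exactly the two inputs of
`integral_rpow_mul_abs_le`. -/
lemma exists_integral_rpow_mul_decayKernel_le (hρ : ρ ∈ Ioo (0 : ℝ) 1) (hα : 0 < α) (hγ : 0 ≤ γ)
    {σ : ℝ} (hσ : 0 < σ) (hσ1 : σ ≤ 1) (T : ℝ) :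
    ∃ C : ℝ, 0 ≤ C ∧ ∀ l : ℝ, 0 ≤ l → ∀ t : ℝ, 0 < t → t ≤ T →
      IntegrableOn (fun s => (t - s) ^ (σ - 1) * |seriesKernel ρ α (decaySeries ω γ l) ρ s|)
        (Ioc 0 t) ∧
      ∫ s in Ioc 0 t, (t - s) ^ (σ - 1) * |seriesKernel ρ α (decaySeries ω γ l) ρ s| ≤
        C * t ^ (σ - 1) := by
  obtain ⟨A, hA0, hA⟩ := exists_integral_abs_decayKernel_le (ω := ω) hρ hα hγ T
  obtain ⟨B, hB0, hB⟩ := exists_mul_abs_decayKernel_le (ω := ω) hρ hα hγ T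
  refine ⟨(1 / 2) ^ (σ - 1) * (A + B / σ), by positivity, fun l hl t ht htT => ?_⟩
  have hQ := isTame_decaySeries ω l hγ
  have hi := hQ.integrableOn_seriesKernel hρ.1 hα hρ.1 T
  have h := integral_rpow_mul_abs_le hσ hσ1 ht (hQ.continuousOn_seriesKernel hρ.1 hα hρ.1)
    (hi.mono_set (Ioc_subset_Ioc_right htT))
    ((setIntegral_mono_set hi.abs (Eventually.of_forall fun _ => abs_nonneg _)
      (Ioc_subset_Ioc_right htT).eventuallyLE).trans (hA l hl))
    (fun s hs hst => hB l hl s hs (hst.trans htT))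
  refine ⟨h.1, h.2.trans_eq ?_⟩
  rw [show t / 2 = (1 / 2) * t by ring, Real.mul_rpow (by norm_num) ht.le]
  ring

/-- Fractional integrals of the decay kernels are bounded uniformly in the rate. -/
lemma exists_abs_fractional_decayKernel_le (hρ : ρ ∈ Ioo (0 : ℝ) 1) (hα : 0 < α) (hγ : 0 ≤ γ)
    {σ : ℝ} (hσ : 0 < σ) (hσ1 : σ ≤ 1) (c T : ℝ) :
    ∃ C : ℝ, 0 ≤ C ∧ ∀ l : ℝ, 0 ≤ l → ∀ t : ℝ, 0 < t → t ≤ T →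
      |seriesKernel ρ α (PowerSeries.C (pochSeries ω c) * decaySeries ω γ l) (σ + ρ) t| ≤
        C * t ^ (σ - 1) := by
  obtain ⟨C, hC0, hC⟩ := exists_integral_rpow_mul_decayKernel_le (ω := ω) hρ hα hγ hσ hσ1 T
  have hP := isTame_C_pochSeries ω c
  obtain ⟨D, hD0, hD⟩ := hP.seriesKernel_bound hρ.1 hα hσ T
  refine ⟨D * C, by positivity, fun l hl t ht htT => ?_⟩
  obtain ⟨h1, h2⟩ := hC l hl t ht htT
  rw [← hP.causalConv_seriesKernel (isTame_decaySeries ω l hγ) hρ.1 hα hσ hρ.1 ht, causalConv,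
    intervalIntegral.integral_of_le ht.le, ← Real.norm_eq_abs]
  calc _ ≤ ∫ s in Ioc 0 t, D * ((t - s) ^ (σ - 1) *
          |seriesKernel ρ α (decaySeries ω γ l) ρ s|) := by
        rw [integral_Ioc_eq_integral_Ioo, integral_Ioc_eq_integral_Ioo]
        refine norm_integral_le_of_norm_le
          (IntegrableOn.mono_set (h1.const_mul D) Ioo_subset_Ioc_self) ?_
        filter_upwards [ae_restrict_mem measurableSet_Ioo] with s hs
        rw [norm_smul, Real.norm_eq_abs, Real.norm_eq_abs, ← mul_assoc]
        gcongr
        exact hD _ (by linarith [hs.2]) (by linarith [hs.1])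
    _ = D * ∫ s in Ioc 0 t, (t - s) ^ (σ - 1) *
          |seriesKernel ρ α (decaySeries ω γ l) ρ s| := integral_const_mul _ _
    _ ≤ D * (C * t ^ (σ - 1)) := by gcongr
    _ = _ := by ring

lemma exists_abs_relaxation_le (hρ : ρ ∈ Ioo (0 : ℝ) 1) (hα : 0 < α) (hγ : 0 ≤ γ) (T : ℝ) :
    ∃ C : ℝ, 0 ≤ C ∧ ∀ l : ℝ, 0 ≤ l → ∀ t ∈ Icc 0 T, |relaxation ρ α ω γ l t| ≤ C := by
  obtain ⟨A, hA0, hA⟩ := exists_integral_abs_decayKernel_le (ω := ω) hρ hα hγ T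
  refine ⟨1 + A, by positivity, fun l hl t ht => ?_⟩
  have hi := (isTame_decaySeries ω l hγ).integrableOn_seriesKernel hρ.1 hα hρ.1 T
  rw [relaxation, intervalIntegral.integral_of_le ht.1]
  refine (abs_sub _ _).trans ?_
  rw [abs_one]
  gcongr
  refine abs_integral_le_integral_abs.trans (le_trans ?_ (hA l hl))
  exact setIntegral_mono_set hi.abs (Eventually.of_forall fun _ => abs_nonneg _)
    (Ioc_subset_Ioc_right ht.2).eventuallyLE

/-- The mode equation in time. The order is left as `1 - ρ + ρ` to fit
`exists_abs_fractional_decayKernel_le`; the resulting bound on `l` times the relaxation function is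
the source of smoothness in `x`. -/
lemma mul_relaxation_eq (hρ : ρ ∈ Ioo (0 : ℝ) 1) (hα : 0 < α) (hγ : 0 ≤ γ) (l : ℝ) {t : ℝ}
    (ht : 0 < t) :
    l * relaxation ρ α ω γ l t =
      seriesKernel ρ α (PowerSeries.C (pochSeries ω (-γ)) * decaySeries ω γ l) (1 - ρ + ρ) t := by
  rw [pochSeries_neg_mul_decaySeries, seriesKernel_biConst_mul, sub_add_cancel,
    relaxation_eq hρ.1 hα hγ l ht]

lemma exists_mul_abs_relaxation_le (hρ : ρ ∈ Ioo (0 : ℝ) 1) (hα : 0 < α) (hγ : 0 ≤ γ) {t : ℝ}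
    (ht : 0 < t) : ∃ C : ℝ, 0 ≤ C ∧ ∀ l : ℝ, 0 ≤ l → l * |relaxation ρ α ω γ l t| ≤ C := by
  obtain ⟨C, hC0, hC⟩ := exists_abs_fractional_decayKernel_le (ω := ω) hρ hα hγ (σ := 1 - ρ)
    (by linarith [hρ.2]) (by linarith [hρ.1]) (-γ) t
  refine ⟨C * t ^ (1 - ρ - 1), by positivity, fun l hl => ?_⟩
  have := hC l hl t ht le_rfl
  rwa [← mul_relaxation_eq hρ hα hγ l ht, abs_mul, abs_of_nonneg hl] at this

lemma hasDerivAt_relaxation (hρ : 0 < ρ) (hα : 0 < α) (hγ : 0 ≤ γ) (l : ℝ) {t : ℝ} (ht : 0 < t) :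
    HasDerivAt (relaxation ρ α ω γ l) (-seriesKernel ρ α (decaySeries ω γ l) ρ t) t := by
  have hQ := isTame_decaySeries ω l hγ
  have hc := hQ.continuousOn_seriesKernel hρ hα hρ
  have h := intervalIntegral.integral_hasDerivAt_right
    ((intervalIntegrable_iff_integrableOn_Ioc_of_le ht.le).2
      (hQ.integrableOn_seriesKernel hρ hα hρ t))
    (hc.stronglyMeasurableAtFilter isOpen_Ioi t ht) (hc.continuousAt (Ioi_mem_nhds ht))
  exact HasDerivAt.const_sub 1 h

lemma continuousOn_relaxation (hρ : 0 < ρ) (hα : 0 < α) (hγ : 0 ≤ γ) (l T : ℝ) :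
    ContinuousOn (relaxation ρ α ω γ l) (Icc 0 T) := by
  rcases lt_or_ge T 0 with h | h
  · rw [Icc_eq_empty (not_le.2 h)]; exact continuousOn_empty _
  have hi := (isTame_decaySeries ω l hγ).integrableOn_seriesKernel hρ hα hρ T
  have hi' : IntegrableOn (seriesKernel ρ α (decaySeries ω γ l) ρ) (uIcc 0 T) volume := by
    rw [uIcc_of_le h]
    exact (integrableOn_Icc_iff_integrableOn_Ioc).2 hi
  have := intervalIntegral.continuousOn_primitive_interval hi'
  rw [uIcc_of_le h] at this
  exact continuousOn_const.sub this

/-- Interchange of a Prabhakar integral in time and an integral over a parameter. -/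
lemma prabhakarIntegral_integral (hρ : 0 < ρ) (hα : 0 < α) {w : ℝ → ℂ} (hw : Integrable w)
    {f : ℝ → ℝ → ℝ} (hf : ContinuousOn (fun z : ℝ × ℝ => f z.1 z.2) {z | 0 < z.2})
    {σ c t C : ℝ} (hσ : IsOrder σ c) (ht : 0 < t)
    (hb : 0 < σ → ∀ k, IntegrableOn (fun s => (t - s) ^ (σ - 1) * |f k s|) (Ioc 0 t) ∧
      ∫ s in Ioc 0 t, (t - s) ^ (σ - 1) * |f k s| ≤ C) :
    PrabhakarIntegrable α σ c ω (fun s => ∫ k, w k * (f k s : ℂ)) t ∧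
      prabhakarIntegral α σ c ω (fun s => ∫ k, w k * (f k s : ℂ)) t =
        ∫ k, w k * prabhakarIntegral α σ c ω (fun s => (f k s : ℂ)) t := by
  rcases hσ with hσ | ⟨rfl, rfl⟩
  swap
  · exact ⟨prabhakarIntegrable_zero_zero _ _, by simp only [prabhakarIntegral_zero_zero]⟩
  have hP := isTame_C_pochSeries ω c
  obtain ⟨D, hD0, hD⟩ := hP.seriesKernel_bound hρ hα hσ t
  have hκ : ∀ u, 0 < u → prabhakarKernel α σ c ω u =
      seriesKernel ρ α (PowerSeries.C (pochSeries ω c)) σ u := fun u hu =>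
    prabhakarKernel_eq_seriesKernel hu σ c
  have hκc : ContinuousOn (prabhakarKernel α σ c ω) (Ioi 0) :=
    (hP.continuousOn_seriesKernel hρ hα hσ).congr hκ
  set Φ : ℝ × ℝ → ℂ := fun z =>
    w z.1 * ((prabhakarKernel α σ c ω (t - z.2) * f z.1 z.2 : ℝ) : ℂ) with hΦ
  have hprod : (volume : Measure ℝ).prod (volume.restrict (Ioo 0 t)) =
      ((volume : Measure ℝ).prod volume).restrict (univ ×ˢ Ioo 0 t) := by
    rw [← Measure.prod_restrict, Measure.restrict_univ]
  have hmeas : AEStronglyMeasurable Φ ((volume : Measure ℝ).prod (volume.restrict (Ioo 0 t))) := by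
    refine hw.aestronglyMeasurable.comp_fst.mul ?_
    refine Complex.continuous_ofReal.comp_aestronglyMeasurable ?_
    rw [hprod]
    refine ContinuousOn.aestronglyMeasurable ?_ (MeasurableSet.univ.prod measurableSet_Ioo)
    refine ContinuousOn.mul ?_ (hf.mono fun z hz => hz.2.1)
    exact hκc.comp (by fun_prop) fun z hz => sub_pos.2 hz.2.2
  have hbd : ∀ k, ∀ s ∈ Ioo 0 t, ‖Φ (k, s)‖ ≤ ‖w k‖ * (D * ((t - s) ^ (σ - 1) * |f k s|)) := by
    intro k s hs
    simp only [hΦ]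
    rw [norm_mul, Complex.norm_real, norm_mul, Real.norm_eq_abs, Real.norm_eq_abs,
      hκ _ (sub_pos.2 hs.2), ← mul_assoc D]
    gcongr
    exact hD _ (sub_pos.2 hs.2) (by linarith [hs.1])
  have hint1 : ∀ k, IntegrableOn (fun s => ‖w k‖ * (D * ((t - s) ^ (σ - 1) * |f k s|)))
      (Ioo 0 t) := fun k =>
    (((hb hσ k).1.mono_set Ioo_subset_Ioc_self).const_mul D).const_mul _
  have hsec : ∀ k, IntegrableOn (fun s => Φ (k, s)) (Ioo 0 t) := by
    intro k
    refine (hint1 k).mono' ?_ ?_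
    · simp only [hΦ]
      refine AEStronglyMeasurable.const_mul ?_ _
      refine Complex.continuous_ofReal.comp_aestronglyMeasurable ?_
      refine ContinuousOn.aestronglyMeasurable ?_ measurableSet_Ioo
      refine ContinuousOn.mul ?_ ?_
      · exact hκc.comp (by fun_prop) fun z hz => sub_pos.2 hz.2
      · exact hf.comp (f := fun s : ℝ => (k, s)) (by fun_prop) fun s hs => hs.1
    · filter_upwards [ae_restrict_mem measurableSet_Ioo] with s hs
      exact hbd k s hs
  -- Tonelli: the time integral at frequency `k` is at most `‖w k‖ D C`, with constants independent
  -- of `k`.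
  have hΦi : Integrable Φ ((volume : Measure ℝ).prod (volume.restrict (Ioo 0 t))) := by
    rw [integrable_prod_iff hmeas]
    refine ⟨Eventually.of_forall hsec, ?_⟩
    refine (hw.norm.mul_const (D * C)).mono' hmeas.norm.integral_prod_right' ?_
    refine Eventually.of_forall fun k => ?_
    rw [Real.norm_of_nonneg (integral_nonneg fun s => norm_nonneg _)]
    calc ∫ s in Ioo 0 t, ‖Φ (k, s)‖
        ≤ ∫ s in Ioo 0 t, ‖w k‖ * (D * ((t - s) ^ (σ - 1) * |f k s|)) :=
          setIntegral_mono_on (hsec k).norm (hint1 k) measurableSet_Ioo (hbd k)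
      _ = ‖w k‖ * (D * ∫ s in Ioc 0 t, (t - s) ^ (σ - 1) * |f k s|) := by
          rw [integral_const_mul, integral_const_mul, integral_Ioc_eq_integral_Ioo]
      _ ≤ ‖w k‖ * (D * C) := by
          gcongr
          exact (hb hσ k).2
  have hinner : ∀ s, ∫ k, Φ (k, s) =
      (prabhakarKernel α σ c ω (t - s) : ℂ) * ∫ k, w k * (f k s : ℂ) := by
    intro s
    rw [← integral_const_mul]
    refine integral_congr_ae (Eventually.of_forall fun k => ?_)
    simp only [hΦ]
    push_cast
    ring
  constructor
  · rw [PrabhakarIntegrable, intervalIntegrable_iff_integrableOn_Ioo_of_le ht.le]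
    have := hΦi.integral_prod_right
    simp only [hinner] at this
    exact this
  · have hswap := integral_integral_swap (f := fun k s => Φ (k, s)) hΦi
    simp only [hinner] at hswap
    rw [prabhakarIntegral, if_neg hσ.ne', zero_add, intervalIntegral.integral_of_le ht.le,
      integral_Ioc_eq_integral_Ioo, ← hswap]
    refine integral_congr_ae (Eventually.of_forall fun k => ?_)
    simp only [hΦ]
    rw [integral_const_mul, prabhakarIntegral, if_neg hσ.ne', zero_add,
      intervalIntegral.integral_of_le ht.le, integral_Ioc_eq_integral_Ioo]
    simp only [Complex.ofReal_mul]

end family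

/-! ### The Fourier formula: time derivative and majorants -/

section existence

variable {ρ α ω γ ν N : ℝ} {g : ℝ → ℂ}

/-- The Fourier weight of the frequency `k` in the time derivative of the heat solution. -/
def heatWeight (g : ℝ → ℂ) (x k : ℝ) : ℂ :=
  -(1 / (2 * Real.pi)) * (Complex.exp (-Complex.I * k * x) * fourierStar g k)

lemma integrable_heatWeight (hg : Integrable (fourierStar g)) (x : ℝ) :
    Integrable (heatWeight g x) :=
  (integrable_exp_mul hg x).const_mul _

lemma norm_heatWeight (g : ℝ → ℂ) (x k : ℝ) :
    ‖heatWeight g x k‖ = 1 / (2 * Real.pi) * ‖fourierStar g k‖ := by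
  rw [heatWeight, norm_mul, norm_mul, norm_exp_neg_I_mul, one_mul, norm_neg]
  congr 1
  rw [show (1 / (2 * (Real.pi : ℂ))) = ((1 / (2 * Real.pi) : ℝ) : ℂ) by push_cast; ring,
    Complex.norm_real, Real.norm_of_nonneg (by positivity)]

lemma continuous_heatWeight (hg : Integrable g) :
    Continuous fun z : ℝ × ℝ => heatWeight g z.1 z.2 := by
  have := continuous_fourierStar hg
  unfold heatWeight
  fun_prop

/-- The decay kernel of the frequency `k`, after a fractional integration. -/
lemma continuousOn_heatKernel (hρ : 0 < ρ) (hα : 0 < α) (hγ : 0 ≤ γ) (N c : ℝ) {σ : ℝ}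
    (hσ : 0 < σ) :
    ContinuousOn (fun z : ℝ × ℝ =>
      seriesKernel ρ α (PowerSeries.C (pochSeries ω c) * decaySeries ω γ (N * z.1 ^ 2)) σ z.2)
      {z | 0 < z.2} :=
  (continuousOn_decayKernel hρ hα hγ c hσ).comp (f := fun z : ℝ × ℝ => (N * z.1 ^ 2, z.2))
    (by fun_prop) fun z hz => hz

lemma continuousOn_heatKernel_zero (hρ : 0 < ρ) (hα : 0 < α) (hγ : 0 ≤ γ) (N : ℝ) :
    ContinuousOn (fun z : ℝ × ℝ => seriesKernel ρ α (decaySeries ω γ (N * z.1 ^ 2)) ρ z.2)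
      {z | 0 < z.2} := by
  simpa only [pochSeries_zero, map_one, one_mul] using
    continuousOn_heatKernel (ω := ω) hρ hα hγ N 0 hρ

lemma integrable_relaxation_mul (hρ : ρ ∈ Ioo (0 : ℝ) 1) (hα : 0 < α) (hγ : 0 ≤ γ) (hN : 0 < N)
    {a : ℝ → ℂ} (ha : Integrable a) {t : ℝ} (ht : 0 ≤ t) :
    Integrable fun k => (relaxation ρ α ω γ (N * k ^ 2) t : ℂ) * a k := by
  obtain ⟨C, hC0, hC⟩ := exists_abs_relaxation_le (ω := ω) hρ hα hγ t
  refine ha.bdd_mul (c := C) ?_ ?_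
  · exact (Complex.continuous_ofReal.comp ((continuous_relaxation hρ.1 hα hγ ht).comp
      (by fun_prop))).aestronglyMeasurable
  · refine Eventually.of_forall fun k => ?_
    rw [Complex.norm_real]
    exact hC _ (by positivity) t ⟨ht, le_rfl⟩

lemma heatSolution_eq_fourierExp (hρ : 0 < ρ) (hα : 0 < α) (hγ : 0 ≤ γ) (N : ℝ) (g : ℝ → ℂ)
    (x : ℝ) {t : ℝ} (ht : 0 ≤ t) :
    heatSolution α ω γ ρ N g x t = 1 / (2 * Real.pi) *
      fourierExp (fun k => (relaxation ρ α ω γ (N * k ^ 2) t : ℂ) * fourierStar g k) x := by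
  rw [heatSolution, fourierExp]
  simp only [(hasSum_heatTerm hρ hα hγ N g x ht _).tsum_eq]

lemma heatSolution_eq_integral (hρ : 0 < ρ) (hα : 0 < α) (hγ : 0 ≤ γ) (N : ℝ) (g : ℝ → ℂ)
    (x : ℝ) {t : ℝ} (ht : 0 ≤ t) :
    heatSolution α ω γ ρ N g x t =
      ∫ k, -heatWeight g x k * (relaxation ρ α ω γ (N * k ^ 2) t : ℂ) := by
  rw [heatSolution_eq_fourierExp hρ hα hγ N g x ht, fourierExp, ← integral_const_mul]
  refine integral_congr_ae (Eventually.of_forall fun k => ?_)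
  simp only [heatWeight]
  ring

/-- Differentiation under the integral sign on a ball away from `t = 0`, where the `O(1/s)` bound,
uniform in the rate, dominates every decay kernel. -/
lemma hasDerivAt_heatSolution (hρ : ρ ∈ Ioo (0 : ℝ) 1) (hα : 0 < α) (hγ : 0 ≤ γ) (hN : 0 < N)
    (hs : Integrable (fourierStar g)) (x : ℝ) {t : ℝ} (ht : 0 < t) :
    HasDerivAt (heatSolution α ω γ ρ N g x)
      (∫ k, heatWeight g x k * (seriesKernel ρ α (decaySeries ω γ (N * k ^ 2)) ρ t : ℂ)) t := by
  obtain ⟨B, hB0, hB⟩ := exists_mul_abs_decayKernel_le (ω := ω) hρ hα hγ (2 * t)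
  have hw := integrable_heatWeight hs x
  have hball : ∀ s ∈ Metric.ball t (t / 2), t / 2 < s ∧ s ≤ 2 * t := by
    intro s hs
    rw [Metric.mem_ball, Real.dist_eq, abs_lt] at hs
    constructor <;> linarith [hs.1, hs.2]
  have hint : ∀ s, 0 ≤ s → Integrable fun k =>
      -heatWeight g x k * (relaxation ρ α ω γ (N * k ^ 2) s : ℂ) := fun s hs => by
    simpa only [mul_comm] using
      integrable_relaxation_mul (ω := ω) (a := fun k => -heatWeight g x k) hρ hα hγ hN hw.neg hs
  have key := (hasDerivAt_integral_of_dominated_loc_of_deriv_le (s := Metric.ball t (t / 2))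
    (μ := (volume : Measure ℝ)) (x₀ := t)
    (F := fun (s k : ℝ) => -heatWeight g x k * (relaxation ρ α ω γ (N * k ^ 2) s : ℂ))
    (F' := fun (s k : ℝ) => heatWeight g x k *
      (seriesKernel ρ α (decaySeries ω γ (N * k ^ 2)) ρ s : ℂ))
    (bound := fun k => ‖heatWeight g x k‖ * (B / (t / 2)))
    (Metric.ball_mem_nhds t (by positivity)) ?_ (hint t ht.le) ?_ ?_ ?_ ?_).2
  · refine key.congr_of_eventuallyEq ?_
    filter_upwards [Ioi_mem_nhds ht] with s hs
    exact heatSolution_eq_integral hρ.1 hα hγ N g x (le_of_lt hs)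
  · filter_upwards [Ioi_mem_nhds ht] with s hs
    exact (hint s (le_of_lt hs)).aestronglyMeasurable
  · refine hw.aestronglyMeasurable.mul (Continuous.aestronglyMeasurable ?_)
    refine Complex.continuous_ofReal.comp (continuousOn_univ.1 ?_)
    exact (continuousOn_heatKernel_zero hρ.1 hα hγ N).comp (f := fun k : ℝ => (k, t))
      (by fun_prop) fun k _ => ht
  · refine Eventually.of_forall fun k s hs => ?_
    obtain ⟨h1, h2⟩ := hball s hs
    rw [norm_mul, Complex.norm_real, Real.norm_eq_abs]
    have h0 : 0 < s := by linarith
    have := hB (N * k ^ 2) (by positivity) s h0 h2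
    gcongr
    rw [le_div_iff₀ (by positivity)]
    nlinarith [abs_nonneg (seriesKernel ρ α (decaySeries ω γ (N * k ^ 2)) ρ s)]
  · exact hw.norm.mul_const _
  · refine Eventually.of_forall fun k s hs => ?_
    obtain ⟨h1, h2⟩ := hball s hs
    have := ((hasDerivAt_relaxation (ω := ω) hρ.1 hα hγ (N * k ^ 2)
      (by linarith : 0 < s)).ofReal_comp).const_mul (-heatWeight g x k)
    exact this.congr_deriv (by push_cast; ring)

/-- A majorant of the time derivative of the heat solution that does not depend on `x`. -/
lemma exists_integrable_bound_heatSolution (hρ : ρ ∈ Ioo (0 : ℝ) 1) (hα : 0 < α) (hγ : 0 ≤ γ)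
    (hN : 0 < N) (hs : Integrable (fourierStar g)) (T : ℝ) :
    ∃ v : ℝ → ℝ, IntegrableOn v (Ioc 0 T) ∧ ∀ x t,
      ‖∫ k, heatWeight g x k * (seriesKernel ρ α (decaySeries ω γ (N * k ^ 2)) ρ t : ℂ)‖ ≤ v t := by
  obtain ⟨A, hA0, hA⟩ := exists_integral_abs_decayKernel_le (ω := ω) hρ hα hγ T
  -- The modulus of the weight does not depend on `x`, so `x = 0` represents all points.
  -- Integrability in time up to `0` comes from the uniform `L¹` bound; a bound `O(1/t)` would not
  -- give it.
  set Φ : ℝ × ℝ → ℝ := fun z => ‖heatWeight g 0 z.1‖ *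
    |seriesKernel ρ α (decaySeries ω γ (N * z.1 ^ 2)) ρ z.2| with hΦ
  have hw := integrable_heatWeight hs 0
  have hprod : (volume : Measure ℝ).prod (volume.restrict (Ioc 0 T)) =
      ((volume : Measure ℝ).prod volume).restrict (univ ×ˢ Ioc 0 T) := by
    rw [← Measure.prod_restrict, Measure.restrict_univ]
  have hmeas : AEStronglyMeasurable Φ ((volume : Measure ℝ).prod (volume.restrict (Ioc 0 T))) := by
    refine hw.aestronglyMeasurable.norm.comp_fst.mul ?_
    rw [hprod]
    refine ContinuousOn.aestronglyMeasurable ?_ (MeasurableSet.univ.prod measurableSet_Ioc)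
    exact ((continuousOn_heatKernel_zero hρ.1 hα hγ N).mono fun z hz => hz.2.1).abs
  have hq : ∀ k, IntegrableOn (seriesKernel ρ α (decaySeries ω γ (N * k ^ 2)) ρ) (Ioc 0 T) :=
    fun k => (isTame_decaySeries ω (N * k ^ 2) hγ).integrableOn_seriesKernel hρ.1 hα hρ.1 T
  have hi : Integrable Φ ((volume : Measure ℝ).prod (volume.restrict (Ioc 0 T))) := by
    rw [integrable_prod_iff hmeas]
    refine ⟨Eventually.of_forall fun k =>
      Integrable.const_mul (Integrable.abs (hq k)) ‖heatWeight g 0 k‖, ?_⟩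
    refine (hw.norm.mul_const A).mono' hmeas.norm.integral_prod_right' ?_
    refine Eventually.of_forall fun k => ?_
    rw [Real.norm_of_nonneg (integral_nonneg fun s => norm_nonneg _)]
    have e : ∀ s, ‖Φ (k, s)‖ = ‖heatWeight g 0 k‖ *
        |seriesKernel ρ α (decaySeries ω γ (N * k ^ 2)) ρ s| := fun s =>
      Real.norm_of_nonneg (by positivity)
    simp only [e]
    rw [integral_const_mul]
    gcongr
    exact hA _ (by positivity)
  refine ⟨fun t => ∫ k, Φ (k, t), hi.integral_prod_right, fun x t => ?_⟩
  refine (norm_integral_le_integral_norm _).trans_eq ?_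
  refine integral_congr_ae (Eventually.of_forall fun k => ?_)
  simp only [hΦ, norm_mul, Complex.norm_real, Real.norm_eq_abs, norm_heatWeight]

lemma continuousOn_heatSolution (hρ : ρ ∈ Ioo (0 : ℝ) 1) (hα : 0 < α) (hγ : 0 ≤ γ) (hN : 0 < N)
    (hs : Integrable (fourierStar g)) (x T : ℝ) :
    ContinuousOn (heatSolution α ω γ ρ N g x) (Icc 0 T) := by
  obtain ⟨C, hC0, hC⟩ := exists_abs_relaxation_le (ω := ω) hρ hα hγ T
  have hw := integrable_heatWeight hs x
  refine ContinuousOn.congr (f := fun t => ∫ k, -heatWeight g x k *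
    (relaxation ρ α ω γ (N * k ^ 2) t : ℂ)) ?_ fun t ht =>
      heatSolution_eq_integral hρ.1 hα hγ N g x ht.1
  refine continuousOn_of_dominated (bound := fun k => ‖heatWeight g x k‖ * C) (fun t ht => ?_)
    (fun t ht => Eventually.of_forall fun k => ?_) (hw.norm.mul_const _)
    (Eventually.of_forall fun k => ?_)
  · have := integrable_relaxation_mul (ω := ω) (a := fun k => -heatWeight g x k)
      hρ hα hγ hN hw.neg ht.1
    simpa only [mul_comm] using this.aestronglyMeasurable
  · rw [norm_mul, norm_neg, Complex.norm_real]
    gcongr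
    exact hC _ (by positivity) t ht
  · exact continuousOn_const.mul (Complex.continuous_ofReal.comp_continuousOn
      (continuousOn_relaxation hρ.1 hα hγ _ T))

lemma stronglyMeasurable_deriv_heatSolution (hρ : ρ ∈ Ioo (0 : ℝ) 1) (hα : 0 < α) (hγ : 0 ≤ γ)
    (hg : Integrable g) (μ : Measure ℝ) [SFinite μ] (T : ℝ) :
    AEStronglyMeasurable (fun z : ℝ × ℝ => ∫ k, heatWeight g z.1 k *
      (seriesKernel ρ α (decaySeries ω γ (N * k ^ 2)) ρ z.2 : ℂ))
      (μ.prod (volume.restrict (Ioc 0 T))) := by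
  have h : AEStronglyMeasurable (fun z : (ℝ × ℝ) × ℝ => heatWeight g z.1.1 z.2 *
      (seriesKernel ρ α (decaySeries ω γ (N * z.2 ^ 2)) ρ z.1.2 : ℂ))
      ((μ.prod (volume.restrict (Ioc 0 T))).prod (volume : Measure ℝ)) := by
    refine ((continuous_heatWeight hg).comp (by fun_prop :
      Continuous fun z : (ℝ × ℝ) × ℝ => (z.1.1, z.2))).aestronglyMeasurable.mul ?_
    have hp : (μ.prod (volume.restrict (Ioc 0 T))).prod (volume : Measure ℝ) =
        ((μ.prod volume).prod volume).restrict ((univ ×ˢ Ioc 0 T) ×ˢ univ) := by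
      rw [← Measure.prod_restrict, ← Measure.prod_restrict, Measure.restrict_univ,
        Measure.restrict_univ]
    rw [hp]
    refine ContinuousOn.aestronglyMeasurable ?_
      ((MeasurableSet.univ.prod measurableSet_Ioc).prod MeasurableSet.univ)
    refine Complex.continuous_ofReal.comp_continuousOn ?_
    exact (continuousOn_heatKernel_zero hρ.1 hα hγ N).comp
      (f := fun z : (ℝ × ℝ) × ℝ => (z.2, z.1.2)) (by fun_prop) fun z hz => hz.1.2.1
  exact h.integral_prod_right'

end existence

/-! ### Absolutely continuous complex functions -/

section absolutelyContinuous

lemma AbsolutelyContinuousOnInterval.of_dist_le {X Y : Type*} [PseudoMetricSpace X]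
    [PseudoMetricSpace Y] {f : ℝ → X} {F : ℝ → Y} {a b : ℝ}
    (hF : AbsolutelyContinuousOnInterval F a b)
    (h : ∀ x ∈ uIcc a b, ∀ y ∈ uIcc a b, dist (f x) (f y) ≤ dist (F x) (F y)) :
    AbsolutelyContinuousOnInterval f a b := by
  rw [absolutelyContinuousOnInterval_iff] at hF ⊢
  intro ε hε
  obtain ⟨δ, hδ, H⟩ := hF ε hε
  refine ⟨δ, hδ, fun E hE hd => lt_of_le_of_lt ?_ (H E hE hd)⟩
  exact Finset.sum_le_sum fun i hi => h _ (hE.1 i hi).1 _ (hE.1 i hi).2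

/-- The fundamental theorem of calculus for absolutely continuous complex functions. -/
lemma AbsolutelyContinuousOnInterval.integral_deriv_complex {f : ℝ → ℂ} {a b : ℝ}
    (hf : AbsolutelyContinuousOnInterval f a b) :
    IntervalIntegrable (deriv f) volume a b ∧ ∫ x in a..b, deriv f x = f b - f a := by
  have hre : AbsolutelyContinuousOnInterval (fun x => (f x).re) a b :=
    hf.of_dist_le fun x _ y _ => by
      rw [Real.dist_eq, dist_eq_norm, ← Complex.sub_re]
      exact Complex.abs_re_le_norm _
  have him : AbsolutelyContinuousOnInterval (fun x => (f x).im) a b :=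
    hf.of_dist_le fun x _ y _ => by
      rw [Real.dist_eq, dist_eq_norm, ← Complex.sub_im]
      exact Complex.abs_im_le_norm _
  -- The real and imaginary parts are absolutely continuous, hence differentiable almost everywhere;
  -- `u` is assembled from their derivatives and agrees with `deriv f` almost everywhere.
  set u : ℝ → ℂ := fun x => ((deriv (fun x => (f x).re) x : ℝ) : ℂ) +
    ((deriv (fun x => (f x).im) x : ℝ) : ℂ) * Complex.I with hu
  have hd : ∀ᵐ x, x ∈ uIoc a b → u x = deriv f x := by
    filter_upwards [hre.ae_differentiableAt, him.ae_differentiableAt] with x h1 h2 hx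
    have h := (h1 (uIoc_subset_uIcc hx)).hasDerivAt.ofReal_comp.add
      ((h2 (uIoc_subset_uIcc hx)).hasDerivAt.ofReal_comp.mul_const Complex.I)
    have e : f = (fun x => ((f x).re : ℂ)) + fun x => ((f x).im : ℂ) * Complex.I := by
      funext y
      exact (Complex.re_add_im (f y)).symm
    rw [← e] at h
    exact h.deriv.symm
  have h1 := hre.intervalIntegrable_deriv
  have h2 := him.intervalIntegrable_deriv
  have h1c : IntervalIntegrable (fun x => ((deriv (fun x => (f x).re) x : ℝ) : ℂ)) volume a b :=
    ⟨h1.1.ofReal, h1.2.ofReal⟩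
  have h2c : IntervalIntegrable (fun x => ((deriv (fun x => (f x).im) x : ℝ) : ℂ) * Complex.I)
      volume a b := IntervalIntegrable.mul_const ⟨h2.1.ofReal, h2.2.ofReal⟩ _
  refine ⟨(h1c.add h2c).congr_ae ((ae_restrict_iff' measurableSet_uIoc).2 hd), ?_⟩
  rw [← intervalIntegral.integral_congr_ae hd, hu, intervalIntegral.integral_add h1c h2c,
    intervalIntegral.integral_mul_const, intervalIntegral.integral_ofReal,
    intervalIntegral.integral_ofReal, hre.integral_deriv_eq_sub, him.integral_deriv_eq_sub]
  apply Complex.ext <;> simp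

/-- A primitive of an integrable complex function is absolutely continuous. -/
lemma absolutelyContinuousOnInterval_of_integral {f u : ℝ → ℂ} {T : ℝ} (hT : 0 ≤ T)
    (hu : IntervalIntegrable u volume 0 T)
    (h : ∀ t ∈ Icc 0 T, f t = f 0 + ∫ s in (0 : ℝ)..t, u s) :
    AbsolutelyContinuousOnInterval f 0 T := by
  -- The increments of `f` are dominated by those of the primitive of `‖u‖`.
  refine (hu.norm.absolutelyContinuousOnInterval_intervalIntegral (c := 0)
    (by simp)).of_dist_le fun x hx y hy => ?_
  have hI : ∀ z ∈ uIcc 0 T, IntervalIntegrable u volume 0 z := fun z hz =>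
    hu.mono_set (uIcc_subset_uIcc_left hz)
  have hx' := hx
  have hy' := hy
  rw [uIcc_of_le hT] at hx' hy'
  rw [dist_eq_norm, Real.dist_eq, h x hx', h y hy', add_sub_add_left_eq_sub,
    intervalIntegral.integral_interval_sub_left (hI x hx) (hI y hy),
    intervalIntegral.integral_interval_sub_left (hI x hx).norm (hI y hy).norm]
  exact intervalIntegral.norm_integral_le_abs_of_norm_le (Eventually.of_forall fun _ => le_rfl)
    (hu.norm.mono_set (uIcc_subset_uIcc hy hx))

end absolutelyContinuous

/-! ### The Fourier formula solves the problem -/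

section existence

variable {ρ α ω γ ν N : ℝ} {g : ℝ → ℂ}

lemma isOrder_left (hρ : ρ ∈ Ioo (0 : ℝ) 1) (hν : ν ∈ Icc (0 : ℝ) 1) (γ : ℝ) :
    IsOrder ((1 - ν) * (1 - ρ)) (-γ * (1 - ν)) := by
  have h1 : 0 < 1 - ρ := by linarith [hρ.2]
  rcases hν.2.eq_or_lt with rfl | h
  · exact Or.inr ⟨by ring, by ring⟩
  · exact Or.inl (mul_pos (by linarith) h1)

lemma isOrder_right (hρ : ρ ∈ Ioo (0 : ℝ) 1) (hν : ν ∈ Icc (0 : ℝ) 1) (γ : ℝ) :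
    IsOrder (ν * (1 - ρ)) (-γ * ν) := by
  have h1 : 0 < 1 - ρ := by linarith [hρ.2]
  rcases hν.1.eq_or_lt with rfl | h
  · exact Or.inr ⟨by ring, by ring⟩
  · exact Or.inl (mul_pos h h1)

/-- The regularized derivative of a superposition of decay kernels. -/
lemma regHilferPrabhakar_heatSolution (hρ : ρ ∈ Ioo (0 : ℝ) 1) (hα : 0 < α) (hγ : 0 ≤ γ)
    (hν : ν ∈ Icc (0 : ℝ) 1) (hN : 0 < N) (hs : Integrable (fourierStar g)) (x : ℝ) {t : ℝ}
    (ht : 0 < t) :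
    RegHilferPrabhakarExists α ω γ ρ ν (heatSolution α ω γ ρ N g x) t ∧
      regHilferPrabhakar α ω γ ρ ν (heatSolution α ω γ ρ N g x) t =
        ∫ k, heatWeight g x k * ((N * k ^ 2 * relaxation ρ α ω γ (N * k ^ 2) t : ℝ) : ℂ) := by
  have h1ρ : 0 < 1 - ρ := by linarith [hρ.2]
  set σ₁ := (1 - ν) * (1 - ρ) with hσ₁
  set σ₂ := ν * (1 - ρ) with hσ₂
  set c₁ := -γ * (1 - ν) with hc₁
  set c₂ := -γ * ν with hc₂
  have ho1 : IsOrder σ₁ c₁ := isOrder_left hρ hν γ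
  have ho2 : IsOrder σ₂ c₂ := isOrder_right hρ hν γ
  have hσ1 : σ₁ ≤ 1 := by nlinarith [hν.1, hν.2, hρ.1]
  have hσ2 : σ₂ ≤ 1 := by nlinarith [hν.1, hν.2, hρ.1]
  have hσ1' : 0 ≤ σ₁ := mul_nonneg (by linarith [hν.2]) h1ρ.le
  have hw := integrable_heatWeight hs x
  set q : ℝ → PowerSeries (PowerSeries ℝ) := fun k => decaySeries ω γ (N * k ^ 2) with hq
  have hqt : ∀ k, IsTame (q k) := fun k => isTame_decaySeries ω _ hγ
  set q₁ : ℝ → PowerSeries (PowerSeries ℝ) := fun k => PowerSeries.C (pochSeries ω c₁) * q k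
    with hq₁
  have hq1t : ∀ k, IsTame (q₁ k) := fun k => isTame_C_pochSeries_mul_decaySeries hγ _ _
  have hderiv : ∀ s, 0 < s → s ≤ t → (∫ k, heatWeight g x k * (seriesKernel ρ α (q k) ρ s : ℂ)) =
      deriv (heatSolution α ω γ ρ N g x) s := fun s hs0 _ =>
    (hasDerivAt_heatSolution hρ hα hγ hN hs x hs0).deriv.symm
  have step1 : ∀ s, 0 < s →
      PrabhakarIntegrable α σ₁ c₁ ω
        (fun s => ∫ k, heatWeight g x k * (seriesKernel ρ α (q k) ρ s : ℂ)) s ∧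
      prabhakarIntegral α σ₁ c₁ ω
        (fun s => ∫ k, heatWeight g x k * (seriesKernel ρ α (q k) ρ s : ℂ)) s =
        ∫ k, heatWeight g x k * (seriesKernel ρ α (q₁ k) (σ₁ + ρ) s : ℂ) := by
    intro s hs0
    have hex : ∃ C : ℝ, 0 < σ₁ → ∀ k : ℝ,
        IntegrableOn (fun u => (s - u) ^ (σ₁ - 1) * |seriesKernel ρ α (q k) ρ u|) (Ioc 0 s) ∧
        ∫ u in Ioc 0 s, (s - u) ^ (σ₁ - 1) * |seriesKernel ρ α (q k) ρ u| ≤ C := by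
      by_cases h : 0 < σ₁
      · obtain ⟨C, _, hC⟩ := exists_integral_rpow_mul_decayKernel_le (ω := ω) hρ hα hγ h hσ1 s
        exact ⟨_, fun _ k => hC (N * k ^ 2) (by positivity) s hs0 le_rfl⟩
      · exact ⟨0, fun h' => absurd h' h⟩
    obtain ⟨C, hC⟩ := hex
    obtain ⟨h1, h2⟩ := prabhakarIntegral_integral (ω := ω) hρ.1 hα hw
      (f := fun k s => seriesKernel ρ α (q k) ρ s)
      (continuousOn_heatKernel_zero hρ.1 hα hγ N) ho1 hs0 hC
    refine ⟨h1, h2.trans ?_⟩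
    simp only [prabhakarIntegral_seriesKernel hρ.1 hα ho1 hρ.1 hs0 (hqt _), hq₁]
  have step2 : PrabhakarIntegrable α σ₂ c₂ ω
        (fun s => ∫ k, heatWeight g x k * (seriesKernel ρ α (q₁ k) (σ₁ + ρ) s : ℂ)) t ∧
      prabhakarIntegral α σ₂ c₂ ω
        (fun s => ∫ k, heatWeight g x k * (seriesKernel ρ α (q₁ k) (σ₁ + ρ) s : ℂ)) t =
        ∫ k, heatWeight g x k * ((N * k ^ 2 * relaxation ρ α ω γ (N * k ^ 2) t : ℝ) : ℂ) := by
    have hex : ∃ C : ℝ, 0 < σ₂ → ∀ k : ℝ,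
        IntegrableOn (fun u => (t - u) ^ (σ₂ - 1) * |seriesKernel ρ α (q₁ k) (σ₁ + ρ) u|)
          (Ioc 0 t) ∧
        ∫ u in Ioc 0 t, (t - u) ^ (σ₂ - 1) * |seriesKernel ρ α (q₁ k) (σ₁ + ρ) u| ≤ C := by
      by_cases h : 0 < σ₂
      swap
      · exact ⟨0, fun h' => absurd h' h⟩
      -- If `σ₁ > 0`, the inner integral is `O(u^{σ₁-1})` uniformly in `k`, and its product with the
      -- outer weight has a finite Beta integral. If `σ₁ = 0`, the inner operator is the identity
      -- and the bound for the decay kernel itself applies.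
      rcases ho1 with h1 | ⟨h1, h1c⟩
      · obtain ⟨C, hC0, hC⟩ := exists_abs_fractional_decayKernel_le (ω := ω) hρ hα hγ h1 hσ1 c₁ t
        have hi : IntegrableOn (fun u => C * ((t - u) ^ (σ₂ - 1) * u ^ (σ₁ - 1))) (Ioc 0 t) := by
          have hr := (intervalIntegrable_iff_integrableOn_Ioc_of_le ht.le).1
            (integrable_rlKernel_mul h h1 ht)
          refine IntegrableOn.congr_fun (Integrable.const_mul hr
            (C * (Real.Gamma σ₂ * Real.Gamma σ₁))) (fun u _ => ?_) measurableSet_Ioc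
          have := (Real.Gamma_pos_of_pos h).ne'
          have := (Real.Gamma_pos_of_pos h1).ne'
          simp only [rlKernel]
          field_simp
        refine ⟨∫ u in Ioc 0 t, C * ((t - u) ^ (σ₂ - 1) * u ^ (σ₁ - 1)), fun _ k => ?_⟩
        have hle : ∀ u ∈ Ioc 0 t, (t - u) ^ (σ₂ - 1) * |seriesKernel ρ α (q₁ k) (σ₁ + ρ) u| ≤
            C * ((t - u) ^ (σ₂ - 1) * u ^ (σ₁ - 1)) := by
          intro u hu
          have h0 : 0 ≤ t - u := sub_nonneg.2 hu.2
          rw [mul_left_comm]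
          gcongr
          exact hC (N * k ^ 2) (by positivity) u hu.1 hu.2
        have hint : IntegrableOn (fun u => (t - u) ^ (σ₂ - 1) *
            |seriesKernel ρ α (q₁ k) (σ₁ + ρ) u|) (Ioc 0 t) := by
          refine Integrable.mono' hi ?_ ?_
          · refine AEStronglyMeasurable.mul (Measurable.aestronglyMeasurable (by fun_prop)) ?_
            exact ((((hq1t k).continuousOn_seriesKernel hρ.1 hα (by linarith [hρ.1])).mono
              fun u hu => hu.1).abs).aestronglyMeasurable measurableSet_Ioc
          · filter_upwards [ae_restrict_mem measurableSet_Ioc] with u hu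
            have h0 : 0 ≤ t - u := sub_nonneg.2 hu.2
            rw [Real.norm_of_nonneg (by positivity)]
            exact hle u hu
        exact ⟨hint, setIntegral_mono_on hint hi measurableSet_Ioc hle⟩
      · obtain ⟨C, _, hC⟩ := exists_integral_rpow_mul_decayKernel_le (ω := ω) hρ hα hγ h hσ2 t
        refine ⟨C * t ^ (σ₂ - 1), fun _ k => ?_⟩
        have := hC (N * k ^ 2) (by positivity) t ht le_rfl
        simpa only [hq₁, h1, h1c, pochSeries_zero, map_one, one_mul, zero_add] using this
    obtain ⟨C, hC⟩ := hex
    obtain ⟨h1, h2⟩ := prabhakarIntegral_integral (ω := ω) hρ.1 hα hw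
      (f := fun k s => seriesKernel ρ α (q₁ k) (σ₁ + ρ) s)
      (continuousOn_heatKernel hρ.1 hα hγ N c₁ (by linarith [hρ.1])) ho2 ht hC
    refine ⟨h1, h2.trans ?_⟩
    refine integral_congr_ae (Eventually.of_forall fun k => ?_)
    simp only
    rw [prabhakarIntegral_seriesKernel hρ.1 hα ho2 (by linarith [hρ.1]) ht (hq1t _),
      mul_relaxation_eq hρ hα hγ _ ht]
    simp only [hq₁]
    -- The two integrals combine: the parameters add to `-γ` and the orders to `1 - ρ`, whatever `ν`
    -- is.
    rw [← mul_assoc, ← map_mul, ← pochSeries_add, show c₂ + c₁ = -γ by rw [hc₁, hc₂]; ring,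
      show σ₂ + (σ₁ + ρ) = 1 - ρ + ρ by rw [hσ₁, hσ₂]; ring]
  have hstep1 : ∀ s, 0 < s → s ≤ t →
      ∫ k, heatWeight g x k * (seriesKernel ρ α (q₁ k) (σ₁ + ρ) s : ℂ) =
      prabhakarIntegral α σ₁ c₁ ω (deriv (heatSolution α ω γ ρ N g x)) s := by
    intro s hs0 hst
    rw [← (step1 s hs0).2]
    exact prabhakarIntegral_congr hs0 fun u hu hus => hderiv u hu (hus.trans hst)
  refine ⟨⟨prabhakarIntegrable_congr ht hderiv (step1 t ht).1,
    prabhakarIntegrable_congr ht hstep1 step2.1⟩, ?_⟩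
  rw [regHilferPrabhakar, ← step2.2]
  exact (prabhakarIntegral_congr ht hstep1).symm

/-- `N k²` is the rate, and rate times relaxation is bounded at each `t > 0`; the factor `k²` is
therefore free. -/
lemma integrable_sq_mul_relaxation_mul (hρ : ρ ∈ Ioo (0 : ℝ) 1) (hα : 0 < α) (hγ : 0 ≤ γ)
    (hN : 0 < N) {a : ℝ → ℂ} (ha : Integrable a) {t : ℝ} (ht : 0 < t) :
    Integrable fun k : ℝ => -(k : ℂ) ^ 2 *
      ((relaxation ρ α ω γ (N * k ^ 2) t : ℂ) * a k) := by
  obtain ⟨C, hC0, hC⟩ := exists_mul_abs_relaxation_le (ω := ω) hρ hα hγ ht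
  simp only [← mul_assoc]
  refine ha.bdd_mul (c := C / N) (Continuous.aestronglyMeasurable ?_) ?_
  · exact (by fun_prop : Continuous fun k : ℝ => -(k : ℂ) ^ 2).mul
      (Complex.continuous_ofReal.comp ((continuous_relaxation hρ.1 hα hγ ht.le).comp
        (by fun_prop)))
  · refine Eventually.of_forall fun k => ?_
    rw [norm_mul, norm_neg, norm_pow, Complex.norm_real, Complex.norm_real, Real.norm_eq_abs,
      Real.norm_eq_abs, sq_abs, le_div_iff₀ hN]
    linarith [hC (N * k ^ 2) (by positivity)]

lemma contDiff_two_relaxation (hρ : ρ ∈ Ioo (0 : ℝ) 1) (hα : 0 < α) (hγ : 0 ≤ γ)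
    (hN : 0 < N) {a : ℝ → ℂ} (ha : Integrable a) {t : ℝ} (ht : 0 < t) :
    ContDiff ℝ 2 (fourierExp fun k => (relaxation ρ α ω γ (N * k ^ 2) t : ℂ) * a k) ∧
      iteratedDeriv 2 (fourierExp fun k => (relaxation ρ α ω γ (N * k ^ 2) t : ℂ) * a k) =
        fourierExp fun k : ℝ => -(k : ℂ) ^ 2 *
          ((relaxation ρ α ω γ (N * k ^ 2) t : ℂ) * a k) := by
  have h0 := integrable_relaxation_mul (ω := ω) hρ hα hγ hN ha ht.le
  have h2 := integrable_sq_mul_relaxation_mul (ω := ω) hρ hα hγ hN ha ht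
  -- The first moment is controlled by the zeroth and second ones through `|k| ≤ 1 + k²`.
  refine contDiff_two_fourierExp h0 ((h0.norm.add h2.norm).mono' ?_ ?_) h2
  · exact (by fun_prop : Continuous fun k : ℝ => -Complex.I * k).aestronglyMeasurable.mul
      h0.aestronglyMeasurable
  · refine Eventually.of_forall fun k => ?_
    simp only [Pi.add_apply]
    rw [norm_mul, norm_mul, norm_mul (-(k : ℂ) ^ 2), norm_neg, norm_neg, Complex.norm_I, one_mul,
      norm_pow, Complex.norm_real]
    nlinarith [norm_nonneg ((relaxation ρ α ω γ (N * k ^ 2) t : ℂ) * a k), sq_nonneg (‖k‖ - 1),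
      norm_nonneg k, mul_nonneg (norm_nonneg ((relaxation ρ α ω γ (N * k ^ 2) t : ℂ) * a k))
        (sq_nonneg (‖k‖ - 1)), mul_nonneg (norm_nonneg ((relaxation ρ α ω γ (N * k ^ 2) t : ℂ) * a k))
        (sq_nonneg (‖k‖ + 1))]

theorem isHeatSolution_heatSolution (hρ : ρ ∈ Ioo (0 : ℝ) 1) (hα : 0 < α) (hγ : 0 ≤ γ)
    (hν : ν ∈ Icc (0 : ℝ) 1) (hN : 0 < N) (hc : Continuous g) (hg : Integrable g)
    (hs : Integrable (fourierStar g)) :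
    IsHeatSolution α ω γ ρ ν N g (heatSolution α ω γ ρ N g) where
  abs_cont x T hT := by
    obtain ⟨v, hv, hvb⟩ := exists_integrable_bound_heatSolution (ω := ω) hρ hα hγ hN hs T
    have hd : ∀ t, 0 < t → HasDerivAt (heatSolution α ω γ ρ N g x) _ t := fun t ht =>
      hasDerivAt_heatSolution hρ hα hγ hN hs x ht
    set u : ℝ → ℂ := fun t => ∫ k, heatWeight g x k *
      (seriesKernel ρ α (decaySeries ω γ (N * k ^ 2)) ρ t : ℂ) with hu
    -- On `(0, T]` the function `u` coincides with a derivative, and derivatives are measurable.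
    have hum : AEStronglyMeasurable u (volume.restrict (Ioc 0 T)) := by
      refine AEStronglyMeasurable.congr
        (stronglyMeasurable_deriv (heatSolution α ω γ ρ N g x)).aestronglyMeasurable ?_
      filter_upwards [ae_restrict_mem measurableSet_Ioc] with t ht
      exact (hd t ht.1).deriv
    have hui : IntervalIntegrable u volume 0 T :=
      (intervalIntegrable_iff_integrableOn_Ioc_of_le hT.le).2
        (Integrable.mono' hv hum (Eventually.of_forall fun t => hvb x t))
    -- The derivative is available only for `t > 0`; continuity on the closed interval and
    -- integrability of `u` carry the fundamental theorem down to `t = 0`.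
    have hftc : ∀ t ∈ Icc 0 T, heatSolution α ω γ ρ N g x t =
        heatSolution α ω γ ρ N g x 0 + ∫ s in (0 : ℝ)..t, u s := by
      intro t ht
      rw [intervalIntegral.integral_eq_sub_of_hasDerivAt_of_le ht.1
        ((continuousOn_heatSolution hρ hα hγ hN hs x T).mono (Icc_subset_Icc_right ht.2))
        (fun s hs' => hd s hs'.1)
        (hui.mono_set (by rw [uIcc_of_le ht.1, uIcc_of_le hT.le]; exact Icc_subset_Icc_right ht.2))]
      ring
    exact absolutelyContinuousOnInterval_of_integral hT.le hui hftc
  time_deriv_integrable R T hR hT := by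
    obtain ⟨v, hv, hvb⟩ := exists_integrable_bound_heatSolution (ω := ω) hρ hα hγ hN hs T
    rw [IntegrableOn, Measure.volume_eq_prod, ← Measure.prod_restrict]
    have hm := stronglyMeasurable_deriv_heatSolution (ω := ω) (N := N) hρ hα hγ hg
      (volume.restrict (Icc (-R) R)) T
    have hvi : Integrable (fun p : ℝ × ℝ => v p.2)
        ((volume.restrict (Icc (-R) R)).prod (volume.restrict (Ioc 0 T))) :=
      Integrable.comp_snd hv _
    refine (hvi.mono' hm (Eventually.of_forall fun p => hvb p.1 p.2)).congr ?_
    rw [Measure.prod_restrict]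
    filter_upwards [ae_restrict_mem (measurableSet_Icc.prod measurableSet_Ioc)] with p hp
    exact (hasDerivAt_heatSolution hρ hα hγ hN hs p.1 hp.2.1).deriv.symm
  bounded T := by
    obtain ⟨C, hC0, hC⟩ := exists_abs_relaxation_le (ω := ω) hρ hα hγ T
    refine ⟨∫ k, C * ‖heatWeight g 0 k‖, fun x t ht => ?_⟩
    rw [heatSolution_eq_integral hρ.1 hα hγ N g x ht.1]
    refine norm_integral_le_of_norm_le ((integrable_heatWeight hs 0).norm.const_mul C) ?_
    refine Eventually.of_forall fun k => ?_
    rw [norm_mul, norm_neg, Complex.norm_real, norm_heatWeight, ← norm_heatWeight g 0, mul_comm]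
    gcongr
    exact hC _ (by positivity) t ht
  space_smooth t ht := by
    have := (contDiff_two_relaxation (ω := ω) hρ hα hγ hN hs ht).1
    simp only [heatSolution_eq_fourierExp hρ.1 hα hγ N g _ ht.le]
    exact contDiff_const.mul this
  deriv_exists x t ht := (regHilferPrabhakar_heatSolution hρ hα hγ hν hN hs x ht).1
  equation x t ht := by
    obtain ⟨h1, h2⟩ := contDiff_two_relaxation (ω := ω) hρ hα hγ hN hs ht
    rw [(regHilferPrabhakar_heatSolution hρ hα hγ hν hN hs x ht).2]
    simp only [heatSolution_eq_fourierExp hρ.1 hα hγ N g _ ht.le]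
    rw [iteratedDeriv_const_mul _ h1.contDiffAt, h2, fourierExp, ← integral_const_mul,
      ← integral_const_mul]
    refine integral_congr_ae (Eventually.of_forall fun k => ?_)
    simp only [heatWeight]
    push_cast
    ring
  initial x := by
    rw [heatSolution_eq_fourierExp hρ.1 hα hγ N g x le_rfl]
    simp only [relaxation_zero, Complex.ofReal_one, one_mul]
    rw [fourierExp_fourierStar hc hg hs]
    have : (Real.pi : ℂ) ≠ 0 := Complex.ofReal_ne_zero.2 Real.pi_ne_zero
    field_simp
  vanishing t ht := by
    simp only [heatSolution_eq_fourierExp hρ.1 hα hγ N g _ ht]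
    simpa using (tendsto_fourierExp _).const_mul (1 / (2 * (Real.pi : ℂ)))

end existence

/-! ### Fubini's theorem for causal convolutions with a parameter -/

section parametric

variable {X : Type*} [MeasurableSpace X] {μ : Measure X} [SFinite μ] {T : ℝ}

lemma integral_trunc_mul {t : ℝ} (ht : t ∈ Ioc 0 T) (κ : ℝ → ℝ) (f : ℝ → ℂ) :
    ∫ s in Ioc 0 T, trunc T κ (t - s) • f s = causalConv κ f t := by
  have h : ∀ s ∈ Ioc 0 T, trunc T κ (t - s) • f s =
      indicator (Ioo 0 t) (fun s => κ (t - s) • f s) s := fun s hs => by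
    rw [← trunc_conv_integrand ht.2, trunc, trunc, indicator_of_mem hs]
  rw [setIntegral_congr_fun measurableSet_Ioc h, setIntegral_indicator measurableSet_Ioo,
    inter_eq_right.2 (Ioo_subset_Ioc_self.trans (Ioc_subset_Ioc_right ht.2)), causalConv,
    intervalIntegral.integral_of_le ht.1.le, integral_Ioc_eq_integral_Ioo]

lemma prod_volume_restrict (μ : Measure X) [SFinite μ] (S : Set ℝ) :
    μ.prod (volume.restrict S) = (μ.prod volume).restrict (univ ×ˢ S) := by
  rw [← Measure.prod_restrict, Measure.restrict_univ]

/-- The shear `(s, t) ↦ (s, t - s)` preserves measure and turns the integrand into a tensor product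
of integrable functions. -/
lemma integrable_causal_integrand {κ : ℝ → ℝ} (hκ : IntegrableOn κ (Ioc 0 T)) {F : X × ℝ → ℂ}
    (hF : Integrable F (μ.prod (volume.restrict (Ioc 0 T)))) :
    Integrable (fun z : (X × ℝ) × ℝ => trunc T κ (z.2 - z.1.2) • F z.1)
      ((μ.prod (volume.restrict (Ioc 0 T))).prod (volume.restrict (Ioc 0 T))) := by
  have h1 : Integrable (fun z : (X × ℝ) × ℝ => trunc T κ z.2 • F z.1)
      ((μ.prod (volume.restrict (Ioc 0 T))).prod volume) := by
    have h := Integrable.mul_prod (L := ℂ) hF (integrable_trunc hκ).ofReal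
    refine h.congr (Eventually.of_forall fun z => ?_)
    exact mul_comm _ _
  have hmp : MeasurePreserving (fun z : (X × ℝ) × ℝ => (z.1, z.2 - z.1.2))
      ((μ.prod (volume.restrict (Ioc 0 T))).prod volume)
      ((μ.prod (volume.restrict (Ioc 0 T))).prod volume) :=
    (MeasurePreserving.id _).skew_product (g := fun (z : X × ℝ) (t : ℝ) => t - z.2)
      (by unfold Function.uncurry; fun_prop)
      (Eventually.of_forall fun z => (measurePreserving_sub_right volume z.2).map_eq)
  have h2 := (hmp.integrable_comp h1.aestronglyMeasurable).2 h1
  rw [prod_volume_restrict (μ.prod (volume.restrict (Ioc 0 T)))]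
  exact h2.integrableOn

/-- Fubini's theorem for a causal convolution with a parameter. -/
lemma integral_causalConv {κ : ℝ → ℝ} (hκ : IntegrableOn κ (Ioc 0 T)) {F : X × ℝ → ℂ}
    (hF : Integrable F (μ.prod (volume.restrict (Ioc 0 T)))) :
    Integrable (fun z : X × ℝ => causalConv κ (fun s => F (z.1, s)) z.2)
      (μ.prod (volume.restrict (Ioc 0 T))) ∧
    ∀ᵐ t, t ∈ Ioc 0 T → ∫ x, causalConv κ (fun s => F (x, s)) t ∂μ =
      causalConv κ (fun s => ∫ x, F (x, s) ∂μ) t := by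
  have hG := integrable_causal_integrand hκ hF
  constructor
  · have he := ((measurePreserving_prodAssoc μ (volume.restrict (Ioc 0 T))
      (volume.restrict (Ioc 0 T))).symm _).comp
      (((MeasurePreserving.id μ).prod (Measure.measurePreserving_swap
        (μ := volume.restrict (Ioc 0 T)) (ν := volume.restrict (Ioc 0 T)))).comp
      (measurePreserving_prodAssoc μ (volume.restrict (Ioc 0 T)) (volume.restrict (Ioc 0 T))))
    have hH := (he.integrable_comp hG.aestronglyMeasurable).2 hG
    refine hH.integral_prod_left.congr ?_
    rw [prod_volume_restrict μ]
    filter_upwards [ae_restrict_mem (MeasurableSet.univ.prod measurableSet_Ioc)] with z hz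
    exact integral_trunc_mul hz.2 κ fun s => F (z.1, s)
  · rw [← ae_restrict_iff' measurableSet_Ioc]
    filter_upwards [hG.prod_left_ae, ae_restrict_mem measurableSet_Ioc] with t ht htT
    have := integral_integral_swap (f := fun x s => trunc T κ (t - s) • F (x, s)) ht
    simp only [integral_trunc_mul htT κ, integral_smul] at this
    exact this

end parametric

/-! ### Semigroup law and inversion of the Prabhakar integrals -/

section prabhakar

variable {ρ α ω γ ν N : ℝ} {X : Type*} [MeasurableSpace X] {μ : Measure X} [SFinite μ] {T : ℝ}

lemma integrableOn_prabhakarKernel (hα : 0 < α) {σ : ℝ} (hσ : 0 < σ) (c ω T : ℝ) :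
    IntegrableOn (prabhakarKernel α σ c ω) (Ioc 0 T) :=
  -- The series is constant in the first variable, so the value of its exponent is immaterial and is
  -- set to `1`.
  ((isTame_C_pochSeries ω c).integrableOn_seriesKernel one_pos hα hσ T).congr_fun
    (fun _ ht => (prabhakarKernel_eq_seriesKernel ht.1 σ c).symm) measurableSet_Ioc

/-- Fubini's theorem for a Prabhakar integral with a parameter. -/
lemma integral_prabhakarIntegral (hα : 0 < α) {σ c : ℝ} (h : IsOrder σ c) {F : X × ℝ → ℂ}
    (hF : Integrable F (μ.prod (volume.restrict (Ioc 0 T)))) :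
    Integrable (fun z : X × ℝ => prabhakarIntegral α σ c ω (fun s => F (z.1, s)) z.2)
      (μ.prod (volume.restrict (Ioc 0 T))) ∧
    ∀ᵐ t, t ∈ Ioc 0 T → ∫ x, prabhakarIntegral α σ c ω (fun s => F (x, s)) t ∂μ =
      prabhakarIntegral α σ c ω (fun s => ∫ x, F (x, s) ∂μ) t := by
  rcases h with hσ | ⟨rfl, rfl⟩
  · simp only [prabhakarIntegral_of_pos hσ]
    exact integral_causalConv (integrableOn_prabhakarKernel hα hσ c ω T) hF
  · simp only [prabhakarIntegral_zero_zero]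
    exact ⟨hF, Eventually.of_forall fun _ _ => trivial⟩

lemma prabhakarIntegral_congr_ae {σ c : ℝ} (h : IsOrder σ c) {f f' : ℝ → ℂ}
    (hf : ∀ᵐ s, s ∈ Ioc 0 T → f s = f' s) :
    ∀ᵐ t, t ∈ Ioc 0 T → prabhakarIntegral α σ c ω f t = prabhakarIntegral α σ c ω f' t := by
  rcases h with hσ | ⟨rfl, rfl⟩
  · simp only [prabhakarIntegral_of_pos hσ]
    exact Eventually.of_forall fun t ht => causalConv_congr_ae ht.1.le ht.2 _ hf
  · simpa only [prabhakarIntegral_zero_zero] using hf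

lemma prabhakarIntegral_const_mul (σ c : ℝ) (a : ℂ) (f : ℝ → ℂ) (t : ℝ) :
    prabhakarIntegral α σ c ω (fun s => a * f s) t = a * prabhakarIntegral α σ c ω f t := by
  simp only [prabhakarIntegral]
  rw [mul_add, ← intervalIntegral.integral_const_mul]
  congr 1
  · split_ifs <;> simp
  · exact intervalIntegral.integral_congr fun s _ => by ring

lemma integrableOn_prabhakarIntegral (hα : 0 < α) {σ c : ℝ} (h : IsOrder σ c) {f : ℝ → ℂ}
    (hf : IntegrableOn f (Ioc 0 T)) : IntegrableOn (prabhakarIntegral α σ c ω f) (Ioc 0 T) := by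
  rcases h with hσ | ⟨rfl, rfl⟩
  · have := integrableOn_causalConv (integrableOn_prabhakarKernel hα hσ c ω T) hf
    exact this.congr_fun (fun t _ => (prabhakarIntegral_of_pos hσ c f t).symm) measurableSet_Ioc
  · exact hf.congr_fun (fun t _ => (prabhakarIntegral_zero_zero f t).symm) measurableSet_Ioc

/-- The semigroup property of the Prabhakar integrals. -/
lemma causalConv_prabhakarIntegral (hα : 0 < α) {σ c : ℝ} (h : IsOrder σ c) {τ : ℝ} (hτ : 0 < τ)
    (d : ℝ) {f : ℝ → ℂ} (hf : IntegrableOn f (Ioc 0 T)) :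
    ∀ᵐ t, t ∈ Ioc 0 T → causalConv (prabhakarKernel α τ d ω) (prabhakarIntegral α σ c ω f) t =
      causalConv (prabhakarKernel α (τ + σ) (d + c) ω) f t := by
  rcases h with hσ | ⟨rfl, rfl⟩
  · filter_upwards [causalConv_assoc (integrableOn_prabhakarKernel hα hτ d ω T)
      (integrableOn_prabhakarKernel hα hσ c ω T) hf] with t ht htT
    have e : prabhakarIntegral α σ c ω f = causalConv (prabhakarKernel α σ c ω) f :=
      funext fun t => prabhakarIntegral_of_pos hσ c f t
    rw [e, ht htT]
    refine causalConv_congr_left htT.1.le _ fun s hs _ => ?_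
    rw [prabhakarKernel_eq_seriesKernel (ρ := 1) hs, pochSeries_add, map_mul,
      ← (isTame_C_pochSeries ω d).causalConv_seriesKernel (isTame_C_pochSeries ω c) one_pos hα hτ
        hσ hs]
    rw [causalConv_congr_left hs.le _ fun u hu _ =>
      prabhakarKernel_eq_seriesKernel (ρ := 1) hu τ d]
    refine causalConv_congr_ae hs.le le_rfl _ (Eventually.of_forall fun u hu => ?_)
    exact prabhakarKernel_eq_seriesKernel hu.1 σ c
  · refine Eventually.of_forall fun t _ => ?_
    rw [add_zero, add_zero, funext (prabhakarIntegral_zero_zero (α := α) (ω := ω) f)]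

lemma prabhakarKernel_one_zero (ω t : ℝ) : prabhakarKernel α 1 0 ω t = 1 := by
  rw [prabhakarKernel, mittagLeffler_zero, sub_self, Real.rpow_zero, one_mul]

/-- The inversion formula for the regularized derivative. -/
lemma causalConv_prabhakarKernel_inverse (hρ : ρ ∈ Ioo (0 : ℝ) 1) (hα : 0 < α)
    (hν : ν ∈ Icc (0 : ℝ) 1) {f : ℝ → ℂ} (hf : IntegrableOn f (Ioc 0 T)) :
    ∀ᵐ t, t ∈ Ioc 0 T → causalConv (prabhakarKernel α ρ γ ω)
      (prabhakarIntegral α (ν * (1 - ρ)) (-γ * ν) ω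
        (prabhakarIntegral α ((1 - ν) * (1 - ρ)) (-γ * (1 - ν)) ω f)) t =
      ∫ s in (0 : ℝ)..t, f s := by
  have h1 := isOrder_left hρ hν γ
  have h2 := isOrder_right hρ hν γ
  have h0 : 0 ≤ ν * (1 - ρ) := mul_nonneg hν.1 (by linarith [hρ.2])
  filter_upwards [causalConv_prabhakarIntegral (ω := ω) hα h2 hρ.1 γ
      (integrableOn_prabhakarIntegral (ω := ω) hα h1 hf),
    causalConv_prabhakarIntegral (ω := ω) hα h1 (add_pos_of_pos_of_nonneg hρ.1 h0) (γ + -γ * ν) hf]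
    with t ht1 ht2 ht
  -- The three orders add up to `1` and the three parameters to `0`, so the composite kernel is
  -- constantly `1` and the convolution is a plain primitive.
  rw [ht1 ht, ht2 ht, show ρ + ν * (1 - ρ) + (1 - ν) * (1 - ρ) = 1 by ring,
    show γ + -γ * ν + -γ * (1 - ν) = 0 by ring, causalConv]
  simp only [prabhakarKernel_one_zero, one_smul]

end prabhakar

/-! ### The problem tested in space and integrated in time -/

section weak

/-- Integration by parts, twice, against a compactly supported function. -/
lemma integral_mul_iteratedDeriv_two {φ u : ℝ → ℂ} (hφ : ContDiff ℝ 2 φ)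
    (hc : HasCompactSupport φ) (hu : ContDiff ℝ 2 u) :
    ∫ x, φ x * iteratedDeriv 2 u x = ∫ x, deriv (deriv φ) x * u x := by
  have hφ1 : ContDiff ℝ 1 (deriv φ) := ((contDiff_succ_iff_deriv (n := 1)).1 hφ).2.2
  have hu1 : ContDiff ℝ 1 (deriv u) := ((contDiff_succ_iff_deriv (n := 1)).1 hu).2.2
  have hφ2 : Continuous (deriv (deriv φ)) := hφ1.continuous_deriv le_rfl
  have hu2 : Continuous (deriv (deriv u)) := hu1.continuous_deriv le_rfl
  have d1 : ∀ x, HasDerivAt φ (deriv φ x) x := fun x =>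
    ((hφ.differentiable (by norm_num)) x).hasDerivAt
  have d2 : ∀ x, HasDerivAt (deriv φ) (deriv (deriv φ) x) x := fun x =>
    ((hφ1.differentiable (by norm_num)) x).hasDerivAt
  have d3 : ∀ x, HasDerivAt u (deriv u x) x := fun x =>
    ((hu.differentiable (by norm_num)) x).hasDerivAt
  have d4 : ∀ x, HasDerivAt (deriv u) (deriv (deriv u) x) x := fun x =>
    ((hu1.differentiable (by norm_num)) x).hasDerivAt
  have hc1 := hc.deriv
  have hc2 := hc1.deriv
  have hint : ∀ {a b : ℝ → ℂ}, Continuous a → HasCompactSupport a → Continuous b →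
      Integrable (a * b) := fun ha hac hb =>
    (ha.mul hb).integrable_of_hasCompactSupport hac.mul_right
  rw [show iteratedDeriv 2 u = deriv (deriv u) by rw [iteratedDeriv_succ, iteratedDeriv_one],
    integral_mul_deriv_eq_deriv_mul_of_integrable (fun x _ => d1 x) (fun x _ => d4 x)
    (hint hφ.continuous hc hu2) (hint hφ1.continuous hc1 hu1.continuous)
    (hint hφ.continuous hc hu1.continuous),
    integral_mul_deriv_eq_deriv_mul_of_integrable (fun x _ => d2 x) (fun x _ => d3 x)
    (hint hφ1.continuous hc1 hu1.continuous) (hint hφ2 hc2 hu.continuous)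
    (hint hφ1.continuous hc1 hu.continuous), neg_neg]

/-- The integral of `ψ(·, t)` against a test function. -/
def pairing (φ : ℝ → ℂ) (ψ : ℝ → ℝ → ℂ) (t : ℝ) : ℂ := ∫ x, φ x * ψ x t

variable {ρ α ω γ ν N : ℝ} {g : ℝ → ℂ} {ψ : ℝ → ℝ → ℂ} {T : ℝ}

/-- The problem, integrated in time and tested against a compactly supported function. -/
lemma IsHeatSolution.causalConv_pairing (h : IsHeatSolution α ω γ ρ ν N g ψ)
    (hρ : ρ ∈ Ioo (0 : ℝ) 1) (hα : 0 < α) (hν : ν ∈ Icc (0 : ℝ) 1) (hT : 0 < T) {φ : ℝ → ℂ}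
    (hφ : ContDiff ℝ 2 φ) (hc : HasCompactSupport φ) :
    ∀ᵐ t, t ∈ Ioc 0 T →
      causalConv (prabhakarKernel α ρ γ ω) (fun s => N * pairing (deriv (deriv φ)) ψ s) t =
        ∫ x, φ x * (ψ x t - g x) := by
  obtain ⟨R, hR, hφR⟩ : ∃ R : ℝ, 0 < R ∧ ∀ x, x ∉ Icc (-R) R → φ x = 0 := by
    obtain ⟨R, hR⟩ := hc.isCompact.isBounded.subset_closedBall 0
    refine ⟨max R 1, by positivity, fun x hx => ?_⟩
    by_contra h0
    have := hR (subset_tsupport _ h0)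
    rw [Metric.mem_closedBall, dist_zero_right, Real.norm_eq_abs] at this
    exact hx (abs_le.1 (this.trans (le_max_left _ _)))
  have hint : ∀ u : ℝ → ℂ, ∫ x in Icc (-R) R, φ x * u x = ∫ x, φ x * u x := fun u =>
    setIntegral_eq_integral_of_forall_compl_eq_zero fun x hx => by rw [hφR x hx, zero_mul]
  set μ : Measure ℝ := volume.restrict (Icc (-R) R) with hμ
  have hf : Integrable (fun z : ℝ × ℝ => deriv (ψ z.1) z.2)
      (μ.prod (volume.restrict (Ioc 0 T))) := by
    rw [hμ, Measure.prod_restrict]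
    exact h.time_deriv_integrable R T hR hT
  obtain ⟨M, hM⟩ := hφ.continuous.bounded_above_of_compact_support hc
  set F : ℝ × ℝ → ℂ := fun z => φ z.1 * deriv (ψ z.1) z.2 with hFdef
  have hF : Integrable F (μ.prod (volume.restrict (Ioc 0 T))) :=
    hf.bdd_mul (c := M) (hφ.continuous.comp continuous_fst).aestronglyMeasurable
      (Eventually.of_forall fun z => hM z.1)
  have o1 := isOrder_left hρ hν γ
  have o2 := isOrder_right hρ hν γ
  obtain ⟨hF1, hA1⟩ := integral_prabhakarIntegral (ω := ω) hα o1 hF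
  obtain ⟨-, hA2⟩ := integral_prabhakarIntegral (ω := ω) hα o2 hF1
  have hA3 := prabhakarIntegral_congr_ae (α := α) (ω := ω) o2 hA1
  -- Both Prabhakar integrals are pulled out of the space integral, each at the price of a null set
  -- of times; the equation is then inserted and its space derivatives are moved onto `φ`.
  have hpair : ∀ᵐ t, t ∈ Ioc 0 T → N * pairing (deriv (deriv φ)) ψ t =
      prabhakarIntegral α (ν * (1 - ρ)) (-γ * ν) ω
        (prabhakarIntegral α ((1 - ν) * (1 - ρ)) (-γ * (1 - ν)) ω
          fun s => ∫ x, F (x, s) ∂μ) t := by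
    filter_upwards [hA2, hA3] with t h2 h3 ht
    rw [← h3 ht, ← h2 ht]
    simp only [hFdef, prabhakarIntegral_const_mul]
    rw [hint, pairing, ← integral_mul_iteratedDeriv_two hφ hc (h.space_smooth t ht.1),
      ← integral_const_mul]
    refine integral_congr_ae (Eventually.of_forall fun x => ?_)
    have := h.equation x t ht.1
    rw [regHilferPrabhakar] at this
    simp only
    rw [this]
    ring
  have hD : IntegrableOn (fun s => ∫ x, F (x, s) ∂μ) (Ioc 0 T) := hF.integral_prod_right
  filter_upwards [causalConv_prabhakarKernel_inverse (γ := γ) (ω := ω) hρ hα hν hD] with t ht htT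
  rw [causalConv_congr_ae htT.1.le htT.2 _ hpair, ht htT]
  have hFt : Integrable F (μ.prod (volume.restrict (Ioc 0 t))) := by
    have : volume.restrict (Ioc 0 t) ≤ volume.restrict (Ioc (0 : ℝ) T) :=
      Measure.restrict_mono (Ioc_subset_Ioc_right htT.2) le_rfl
    exact hF.mono_measure (Measure.prod_mono le_rfl this)
  -- After the inversion, Fubini's theorem and absolute continuity at each fixed `x` recover `ψ x t
  -- - g x`.
  rw [intervalIntegral.integral_of_le htT.1.le,
    ← integral_integral_swap (f := fun x s => F (x, s)) hFt, ← hint]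
  refine integral_congr_ae (Eventually.of_forall fun x => ?_)
  simp only [hFdef]
  rw [integral_const_mul, ← intervalIntegral.integral_of_le htT.1.le,
    (h.abs_cont x t htT.1).integral_deriv_complex.2, h.initial]

end weak

/-! ### Weak null solutions and the extension to integrable test functions -/

section weakNull

/-- A function on the strip `ℝ × [0, T]` that is bounded by `C` and separately continuous. -/
structure IsBoundedOnStrip (T C : ℝ) (w : ℝ → ℝ → ℂ) : Prop where
  bound : ∀ x, ∀ t ∈ Icc 0 T, ‖w x t‖ ≤ C
  continuous_space : ∀ t ∈ Icc 0 T, Continuous fun x => w x t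
  continuous_time : ∀ x, ContinuousOn (w x) (Icc 0 T)

/-- A bounded function on a strip which satisfies the homogeneous problem with memory kernel `κ`,
tested against compactly supported functions. -/
structure IsWeakNull (κ : ℝ → ℝ) (T C : ℝ) (w : ℝ → ℝ → ℂ) : Prop extends
    IsBoundedOnStrip T C w where
  weak : ∀ φ : ℝ → ℂ, ContDiff ℝ 2 φ → HasCompactSupport φ → ∀ᵐ t, t ∈ Ioc 0 T →
    pairing φ w t = causalConv κ (pairing (deriv (deriv φ)) w) t

variable {κ : ℝ → ℝ} {T C : ℝ} {w : ℝ → ℝ → ℂ}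

lemma IsBoundedOnStrip.continuousOn_pairing (h : IsBoundedOnStrip T C w) {φ : ℝ → ℂ} (hφ : Integrable φ) :
    ContinuousOn (pairing φ w) (Icc 0 T) := by
  refine continuousOn_of_dominated (bound := fun x => ‖φ x‖ * C) (fun t ht => ?_)
    (fun t ht => Eventually.of_forall fun x => ?_) (hφ.norm.mul_const C)
    (Eventually.of_forall fun x => continuousOn_const.mul (h.continuous_time x))
  · exact hφ.aestronglyMeasurable.mul (h.continuous_space t ht).aestronglyMeasurable
  · rw [norm_mul]
    gcongr
    exact h.bound x t ht

lemma IsBoundedOnStrip.norm_pairing_le (h : IsBoundedOnStrip T C w) {φ : ℝ → ℂ} {b : ℝ → ℝ}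
    (hb : Integrable b) (hφ : ∀ x, ‖φ x‖ ≤ b x) {t : ℝ} (ht : t ∈ Icc 0 T) :
    ‖pairing φ w t‖ ≤ C * ∫ x, b x := by
  rw [← integral_const_mul]
  refine norm_integral_le_of_norm_le (hb.const_mul C) (Eventually.of_forall fun x => ?_)
  rw [norm_mul, mul_comm]
  have := h.bound x t ht
  have := norm_nonneg (w x t)
  gcongr
  · linarith
  · exact hφ x

lemma IsBoundedOnStrip.tendsto_pairing (h : IsBoundedOnStrip T C w) {φ : ℝ → ℂ} {φs : ℕ → ℝ → ℂ} {b : ℝ → ℝ}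
    (hb : Integrable b) (hm : ∀ n, AEStronglyMeasurable (φs n)) (hφ : ∀ n x, ‖φs n x‖ ≤ b x)
    (hl : ∀ x, Tendsto (fun n => φs n x) atTop (𝓝 (φ x))) {t : ℝ} (ht : t ∈ Icc 0 T) :
    Tendsto (fun n => pairing (φs n) w t) atTop (𝓝 (pairing φ w t)) := by
  refine tendsto_integral_of_dominated_convergence (fun x => b x * C) (fun n => ?_)
    (hb.mul_const C) (fun n => Eventually.of_forall fun x => ?_)
    (Eventually.of_forall fun x => (hl x).mul_const _)
  · exact (hm n).mul (h.continuous_space t ht).aestronglyMeasurable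
  · rw [norm_mul]
    have := norm_nonneg (φs n x)
    have := hφ n x
    gcongr
    · linarith
    · exact h.bound x t ht

lemma contDiff_two_of_hasDerivAt {f f₁ f₂ : ℝ → ℂ} (h1 : ∀ x, HasDerivAt f (f₁ x) x)
    (h2 : ∀ x, HasDerivAt f₁ (f₂ x) x) (hc : Continuous f₂) :
    ContDiff ℝ 2 f ∧ deriv (deriv f) = f₂ := by
  have d1 : deriv f = f₁ := funext fun x => (h1 x).deriv
  have d2 : deriv f₁ = f₂ := funext fun x => (h2 x).deriv
  refine ⟨?_, by rw [d1, d2]⟩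
  rw [show (2 : WithTop ℕ∞) = 1 + 1 by norm_num, contDiff_succ_iff_deriv]
  refine ⟨fun x => (h1 x).differentiableAt, by simp, ?_⟩
  rw [d1, contDiff_one_iff_deriv, d2]
  exact ⟨fun x => (h2 x).differentiableAt, hc⟩

/-- A smooth cutoff function with its first two derivatives. -/
lemma exists_cutoff : ∃ θ θ₁ θ₂ : ℝ → ℂ, (∀ x, HasDerivAt θ (θ₁ x) x) ∧
    (∀ x, HasDerivAt θ₁ (θ₂ x) x) ∧ Continuous θ₂ ∧ HasCompactSupport θ ∧ θ 0 = 1 ∧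
    (∀ x, 2 < |x| → θ x = 0) ∧
    ∃ M : ℝ, ∀ x, ‖θ x‖ ≤ M ∧ ‖θ₁ x‖ ≤ M ∧ ‖θ₂ x‖ ≤ M := by
  let χ : ContDiffBump (0 : ℝ) := ⟨1, 2, one_pos, one_lt_two⟩
  set θ : ℝ → ℂ := fun x => (χ x : ℂ) with hθ
  have hs : ContDiff ℝ 2 θ := Complex.ofRealCLM.contDiff.comp χ.contDiff
  have hs1 : ContDiff ℝ 1 (deriv θ) := ((contDiff_succ_iff_deriv (n := 1)).1 hs).2.2
  have hs2 : Continuous (deriv (deriv θ)) := hs1.continuous_deriv le_rfl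
  have hc : HasCompactSupport θ := χ.hasCompactSupport.comp_left Complex.ofReal_zero
  obtain ⟨M0, hM0⟩ := hs.continuous.bounded_above_of_compact_support hc
  obtain ⟨M1, hM1⟩ := hs1.continuous.bounded_above_of_compact_support hc.deriv
  obtain ⟨M2, hM2⟩ := hs2.bounded_above_of_compact_support hc.deriv.deriv
  refine ⟨θ, deriv θ, deriv (deriv θ), fun x => ((hs.differentiable (by norm_num)) x).hasDerivAt,
    fun x => ((hs1.differentiable (by norm_num)) x).hasDerivAt, hs2, hc, ?_, fun x hx => ?_,
    max M0 (max M1 M2), fun x => ⟨(hM0 x).trans (le_max_left _ _),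
      (hM1 x).trans ((le_max_left _ _).trans (le_max_right _ _)),
      (hM2 x).trans ((le_max_right _ _).trans (le_max_right _ _))⟩⟩
  · have : χ 0 = 1 := χ.one_of_mem_closedBall (by simp [χ.rIn_pos.le])
    simp [hθ, this]
  · have : χ x = 0 := χ.zero_of_le_dist (by rw [dist_zero_right, Real.norm_eq_abs]; exact hx.le)
    simp [hθ, this]

/-- The weak problem extends to test functions that are integrable with two derivatives. -/
lemma IsWeakNull.weak_of_integrable (h : IsWeakNull κ T C w) (hκ : IntegrableOn κ (Ioc 0 T))
    {φ φ₁ φ₂ : ℝ → ℂ} (h1 : ∀ x, HasDerivAt φ (φ₁ x) x) (h2 : ∀ x, HasDerivAt φ₁ (φ₂ x) x)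
    (hc : Continuous φ₂) (hi : Integrable φ) (hi1 : Integrable φ₁) (hi2 : Integrable φ₂) :
    ∀ᵐ t, t ∈ Ioc 0 T → pairing φ w t = causalConv κ (pairing φ₂ w) t := by
  obtain ⟨θ, θ₁, θ₂, d1, d2, hθ2, hθc, hθ0, -, M, hM⟩ := exists_cutoff
  have hcθ : Continuous θ := continuous_iff_continuousAt.2 fun x => (d1 x).continuousAt
  have hcθ1 : Continuous θ₁ := continuous_iff_continuousAt.2 fun x => (d2 x).continuousAt
  have hcφ : Continuous φ := continuous_iff_continuousAt.2 fun x => (h1 x).continuousAt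
  have hcφ1 : Continuous φ₁ := continuous_iff_continuousAt.2 fun x => (h2 x).continuousAt
  have hM0 : 0 ≤ M := (norm_nonneg _).trans (hM 0).1
  set ε : ℕ → ℝ := fun n => 1 / ((n : ℝ) + 1) with hε
  have hε0 : ∀ n, 0 < ε n := fun n => by positivity
  have hε1 : ∀ n, ε n ≤ 1 := fun n => by
    rw [hε, div_le_one (by positivity)]
    linarith [(Nat.cast_nonneg n : (0 : ℝ) ≤ n)]
  have hεl : Tendsto ε atTop (𝓝 0) := tendsto_one_div_add_atTop_nhds_zero_nat
  have hεc : Tendsto (fun n => (ε n : ℂ)) atTop (𝓝 0) := by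
    have := (Complex.continuous_ofReal.tendsto 0).comp hεl
    rwa [Complex.ofReal_zero] at this
  -- The cutoff is spread out at scale `1/ε`. Each derivative falling on it brings a factor `ε`, so
  -- `f₂ n` tends to `φ₂`; and `ε ≤ 1` gives a majorant independent of `n`.
  set f : ℕ → ℝ → ℂ := fun n x => φ x * θ (ε n • x) with hf
  set f₁ : ℕ → ℝ → ℂ := fun n x => φ₁ x * θ (ε n • x) + φ x * (ε n * θ₁ (ε n • x)) with hf1
  set f₂ : ℕ → ℝ → ℂ := fun n x => φ₂ x * θ (ε n • x) + 2 * ε n * (φ₁ x * θ₁ (ε n • x)) +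
    ε n ^ 2 * (φ x * θ₂ (ε n • x)) with hf2
  have hscale : ∀ {a b : ℝ → ℂ} (n : ℕ) (x : ℝ), (∀ y, HasDerivAt a (b y) y) →
      HasDerivAt (fun x => a (ε n • x)) (ε n * b (ε n • x)) x := fun {a b} n x hab => by
    have := (hab (ε n • x)).scomp x ((hasDerivAt_id x).const_smul (ε n))
    exact this.congr_deriv (by simp)
  have e1 : ∀ n x, HasDerivAt (f n) (f₁ n x) x := fun n x => (h1 x).mul (hscale n x d1)
  have e2 : ∀ n x, HasDerivAt (f₁ n) (f₂ n x) x := fun n x =>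
    (((h2 x).mul (hscale n x d1)).add ((h1 x).mul ((hscale n x d2).const_mul (ε n : ℂ)))).congr_deriv
      (by simp only [hf2]; ring)
  have hcf2 : ∀ n, Continuous (f₂ n) := fun n => by fun_prop
  have hcf : ∀ n, Continuous (f n) := fun n => by fun_prop
  have hcomp : ∀ n, HasCompactSupport (f n) := fun n => (hθc.comp_smul (hε0 n).ne').mul_left
  have key : ∀ᵐ t, ∀ n, t ∈ Ioc 0 T → pairing (f n) w t = causalConv κ (pairing (f₂ n) w) t := by
    refine ae_all_iff.2 fun n => ?_
    obtain ⟨hs, hd⟩ := contDiff_two_of_hasDerivAt (e1 n) (e2 n) (hcf2 n)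
    have := h.weak (f n) hs (hcomp n)
    rwa [hd] at this
  set b : ℝ → ℝ := fun x => ‖φ₂ x‖ * M + 2 * (‖φ₁ x‖ * M) + ‖φ x‖ * M with hb
  have hbi : Integrable b :=
    ((hi2.norm.mul_const M).add ((hi1.norm.mul_const M).const_mul 2)).add (hi.norm.mul_const M)
  have hb2 : ∀ n x, ‖f₂ n x‖ ≤ b x := fun n x => by
    refine (norm_add₃_le).trans ?_
    simp only [norm_mul, norm_pow, Complex.norm_real, Real.norm_of_nonneg (hε0 n).le,
      Complex.norm_ofNat]
    have hp : ∀ u v : ℝ → ℂ, (∀ y, ‖v y‖ ≤ M) → ‖u x‖ * ‖v (ε n • x)‖ ≤ ‖u x‖ * M :=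
      fun u v hv => by gcongr; exact hv _
    have a0 := hp φ₂ θ fun y => (hM y).1
    have a1 := hp φ₁ θ₁ fun y => (hM y).2.1
    have a2 := hp φ θ₂ fun y => (hM y).2.2
    have q1 : 2 * ε n * (‖φ₁ x‖ * ‖θ₁ (ε n • x)‖) ≤ 2 * 1 * (‖φ₁ x‖ * M) := by
      gcongr
      · exact hε1 n
    have q2 : ε n ^ 2 * (‖φ x‖ * ‖θ₂ (ε n • x)‖) ≤ 1 ^ 2 * (‖φ x‖ * M) := by
      have := (hε0 n).le
      gcongr
      · exact hε1 n
    simp only [hb]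
    linarith
  have hlim : ∀ u : ℝ → ℂ, Continuous u → ∀ x, Tendsto (fun n => u (ε n • x)) atTop (𝓝 (u 0)) :=
    fun u hu x => by
      have : Tendsto (fun n => ε n • x) atTop (𝓝 0) := by simpa using hεl.smul_const x
      exact (hu.tendsto 0).comp this
  have hl : ∀ x, Tendsto (fun n => f n x) atTop (𝓝 (φ x)) := fun x => by
    have := (hlim θ hcθ x).const_mul (φ x)
    rwa [hθ0, mul_one] at this
  have hl2 : ∀ x, Tendsto (fun n => f₂ n x) atTop (𝓝 (φ₂ x)) := fun x => by
    have := (((hlim θ hcθ x).const_mul (φ₂ x)).add ((hεc.const_mul 2).mul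
      ((hlim θ₁ hcθ1 x).const_mul (φ₁ x)))).add
      ((hεc.pow 2).mul ((hlim θ₂ hθ2 x).const_mul (φ x)))
    simpa [hθ0, hf2] using this
  filter_upwards [key] with t ht htT
  have hA := h.tendsto_pairing (hi.norm.mul_const M) (fun n => (hcf n).aestronglyMeasurable)
    (fun n x => by
      simp only [hf, norm_mul]
      gcongr
      exact (hM _).1) hl ⟨htT.1.le, htT.2⟩
  have hB : Tendsto (fun n => causalConv κ (pairing (f₂ n) w) t) atTop
      (𝓝 (causalConv κ (pairing φ₂ w) t)) := by
    have hκt : IntervalIntegrable (fun s => κ (t - s)) volume 0 t := by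
      have := ((intervalIntegrable_iff_integrableOn_Ioc_of_le htT.1.le).2
        (hκ.mono_set (Ioc_subset_Ioc_right htT.2))).comp_sub_left t
      simpa using this.symm
    refine intervalIntegral.tendsto_integral_filter_of_dominated_convergence
      (fun s => ‖κ (t - s)‖ * (C * ∫ x, b x)) (Eventually.of_forall fun n => ?_)
      (Eventually.of_forall fun n => Eventually.of_forall fun s hs => ?_)
      (hκt.norm.mul_const _) (Eventually.of_forall fun s hs => ?_)
    · refine hκt.aestronglyMeasurable_restrict_uIoc.smul ?_
      rw [uIoc_of_le htT.1.le]
      refine ContinuousOn.aestronglyMeasurable ?_ measurableSet_Ioc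
      exact (h.continuousOn_pairing (hbi.mono' (hcf2 n).aestronglyMeasurable
        (Eventually.of_forall (hb2 n)))).mono fun s hs => ⟨hs.1.le, hs.2.trans htT.2⟩
    · rw [uIoc_of_le htT.1.le] at hs
      rw [norm_smul]
      gcongr
      exact h.norm_pairing_le hbi (hb2 n) ⟨hs.1.le, hs.2.trans htT.2⟩
    · rw [uIoc_of_le htT.1.le] at hs
      exact (h.tendsto_pairing hbi (fun n => (hcf2 n).aestronglyMeasurable) hb2 hl2
        ⟨hs.1.le, hs.2.trans htT.2⟩).const_smul _
  exact tendsto_nhds_unique hA (hB.congr fun n => (ht n htT).symm)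

end weakNull

/-! ### Band-limited test functions -/

section band

/-- `a` is twice continuously differentiable, vanishes outside `[-B, B]`, and is bounded by `M`
together with its first two derivatives. -/
def IsBand (B M : ℝ) (a : ℝ → ℂ) : Prop :=
  ∃ a₁ a₂ : ℝ → ℂ, (∀ k, HasDerivAt a (a₁ k) k) ∧ (∀ k, HasDerivAt a₁ (a₂ k) k) ∧
    Continuous a₂ ∧ (∀ k, B < |k| → a k = 0 ∧ a₁ k = 0 ∧ a₂ k = 0) ∧
    ∀ k, ‖a k‖ ≤ M ∧ ‖a₁ k‖ ≤ M ∧ ‖a₂ k‖ ≤ M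

variable {B M : ℝ} {a : ℝ → ℂ}

lemma hasCompactSupport_of_abs_lt (h : ∀ k, B < |k| → a k = 0) : HasCompactSupport a :=
  HasCompactSupport.intro (isCompact_Icc (a := -B) (b := B)) fun k hk => h k <| by
    by_contra hc
    exact hk (abs_le.1 (not_lt.1 hc))

lemma deriv_eq_zero_of_abs_lt (h : ∀ k, B < |k| → a k = 0) (k : ℝ) (hk : B < |k|) :
    deriv a k = 0 := by
  have : a =ᶠ[𝓝 k] fun _ => 0 := by
    filter_upwards [(isOpen_lt continuous_const continuous_abs).mem_nhds hk] with y hy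
    exact h y hy
  rw [this.deriv_eq, deriv_const]

lemma exists_isBand (ha : ContDiff ℝ 2 a) (h : ∀ k, B < |k| → a k = 0) : ∃ M, IsBand B M a := by
  have hs1 : ContDiff ℝ 1 (deriv a) := ((contDiff_succ_iff_deriv (n := 1)).1 ha).2.2
  have hs2 : Continuous (deriv (deriv a)) := hs1.continuous_deriv le_rfl
  have h1 := deriv_eq_zero_of_abs_lt h
  have h2 := deriv_eq_zero_of_abs_lt h1
  obtain ⟨M0, hM0⟩ := ha.continuous.bounded_above_of_compact_support (hasCompactSupport_of_abs_lt h)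
  obtain ⟨M1, hM1⟩ := hs1.continuous.bounded_above_of_compact_support
    (hasCompactSupport_of_abs_lt h1)
  obtain ⟨M2, hM2⟩ := hs2.bounded_above_of_compact_support (hasCompactSupport_of_abs_lt h2)
  exact ⟨max M0 (max M1 M2), deriv a, deriv (deriv a),
    fun x => ((ha.differentiable (by norm_num)) x).hasDerivAt,
    fun x => ((hs1.differentiable (by norm_num)) x).hasDerivAt, hs2,
    fun k hk => ⟨h k hk, h1 k hk, h2 k hk⟩, fun x => ⟨(hM0 x).trans (le_max_left _ _),
      (hM1 x).trans ((le_max_left _ _).trans (le_max_right _ _)),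
      (hM2 x).trans ((le_max_right _ _).trans (le_max_right _ _))⟩⟩

/-- Multiplication by `-i k` is differentiation of the Fourier integral. The worst term is the
second derivative `2 a' + k a''`, of size `(2 + B) M ≤ 3 B M` because `B ≥ 1`. The band is unchanged
and the factor does not depend on `a`, so the operation can be iterated. -/
lemma IsBand.mul_id (hB : 1 ≤ B) (h : IsBand B M a) :
    IsBand B (3 * B * M) fun k : ℝ => -Complex.I * k * a k := by
  obtain ⟨a₁, a₂, h1, h2, hc, hz, hM⟩ := h
  have hM0 : 0 ≤ M := (norm_nonneg _).trans (hM 0).1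
  have hc0 : Continuous a := continuous_iff_continuousAt.2 fun x => (h1 x).continuousAt
  have hc1 : Continuous a₁ := continuous_iff_continuousAt.2 fun x => (h2 x).continuousAt
  have hid : ∀ k : ℝ, HasDerivAt (fun k : ℝ => -Complex.I * (k : ℂ)) (-Complex.I) k := fun k => by
    simpa using (Complex.ofRealCLM.hasDerivAt (x := k)).const_mul (-Complex.I)
  refine ⟨fun k => -Complex.I * a k + -Complex.I * k * a₁ k,
    fun k => -Complex.I * (2 * a₁ k) + -Complex.I * k * a₂ k, fun k => (hid k).mul (h1 k),
    fun k => (((h1 k).const_mul (-Complex.I)).add ((hid k).mul (h2 k))).congr_deriv (by ring),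
    by fun_prop, fun k hk => ?_, fun k => ?_⟩
  · obtain ⟨z0, z1, z2⟩ := hz k hk
    simp [z0, z1, z2]
  · by_cases hk : B < |k|
    · obtain ⟨z0, z1, z2⟩ := hz k hk
      have : 0 ≤ 3 * B * M := by positivity
      simp [z0, z1, z2, this]
    · obtain ⟨b0, b1, b2⟩ := hM k
      have hk' : ‖(k : ℂ)‖ ≤ B := by
        rw [Complex.norm_real]
        exact not_lt.1 hk
      have hI : ‖-Complex.I‖ = 1 := by simp
      have hB0 : (0 : ℝ) ≤ B := by linarith
      have hkb : ∀ z : ℂ, ‖z‖ ≤ M → ‖-Complex.I * k * z‖ ≤ B * M := fun z hz => by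
        rw [norm_mul, norm_mul, hI, one_mul]
        gcongr
      have hBM : M ≤ B * M := le_mul_of_one_le_left hM0 hB
      have hBM0 : 0 ≤ B * M := by positivity
      refine ⟨(hkb _ b0).trans (by linarith), (norm_add_le _ _).trans ?_,
        (norm_add_le _ _).trans ?_⟩
      · have := hkb _ b1
        rw [norm_mul, hI, one_mul]
        linarith
      · have := hkb _ b2
        rw [norm_mul, hI, one_mul, norm_mul, Complex.norm_ofNat]
        linarith

lemma IsBand.continuous (h : IsBand B M a) : Continuous a := by
  obtain ⟨a₁, a₂, h1, -⟩ := h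
  exact continuous_iff_continuousAt.2 fun x => (h1 x).continuousAt

lemma IsBand.integrable (h : IsBand B M a) : Integrable a := by
  have hc := h.continuous
  obtain ⟨a₁, a₂, h1, h2, -, hz, hM⟩ := h
  exact hc.integrable_of_hasCompactSupport (hasCompactSupport_of_abs_lt fun k hk => (hz k hk).1)

lemma integral_norm_le_of_abs_lt (hB : 0 ≤ B) (h : ∀ k, B < |k| → a k = 0)
    (hM : ∀ k, ‖a k‖ ≤ M) : ∫ k, ‖a k‖ ≤ 2 * B * M := by
  have h0 : ∫ k, ‖a k‖ = ∫ k in Icc (-B) B, ‖a k‖ := by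
    refine (setIntegral_eq_integral_of_forall_compl_eq_zero fun k hk => ?_).symm
    rw [h k, norm_zero]
    by_contra hc
    exact hk (abs_le.1 (not_lt.1 hc))
  rw [h0]
  refine (le_abs_self _).trans ?_
  have := norm_setIntegral_le_of_norm_le_const (μ := volume) (s := Icc (-B) B)
    (f := fun k => ‖a k‖) (C := M) (by simp) fun k _ => by rw [norm_norm]; exact hM k
  rw [Real.norm_eq_abs] at this
  refine this.trans_eq ?_
  rw [Real.volume_real_Icc_of_le (by linarith)]
  ring

/-- The Fourier transform of a band-limited amplitude decays quadratically. -/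
lemma IsBand.norm_fourierExp_le (hB : 1 ≤ B) (h : IsBand B M a) (x : ℝ) :
    ‖fourierExp a x‖ ≤ 4 * B * M * (1 + x ^ 2)⁻¹ := by
  have hi := h.integrable
  obtain ⟨a₁, a₂, h1, h2, hc, hz, hM⟩ := h
  have hB0 : (0 : ℝ) ≤ B := by linarith
  have hc1 : Continuous a₁ := continuous_iff_continuousAt.2 fun x => (h2 x).continuousAt
  have hi1 : Integrable a₁ := hc1.integrable_of_hasCompactSupport
    (hasCompactSupport_of_abs_lt fun k hk => (hz k hk).2.1)
  have hi2 : Integrable a₂ := hc.integrable_of_hasCompactSupport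
    (hasCompactSupport_of_abs_lt fun k hk => (hz k hk).2.2)
  have hexp : ∀ k : ℝ, HasDerivAt (fun k : ℝ => Complex.exp (-Complex.I * k * x))
      (Complex.exp (-Complex.I * k * x) * (-Complex.I * x)) k := fun k => by
    have : HasDerivAt (fun k : ℝ => -Complex.I * (k : ℂ) * x) (-Complex.I * x) k := by
      simpa using ((Complex.ofRealCLM.hasDerivAt (x := k)).const_mul (-Complex.I)).mul_const (x : ℂ)
    exact this.cexp
  have hstep : ∀ {b b₁ : ℝ → ℂ}, (∀ k, HasDerivAt b (b₁ k) k) → Integrable b → Integrable b₁ →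
      fourierExp b₁ x = Complex.I * x * fourierExp b x := by
    intro b b₁ hb hbi hbi1
    have hp := integral_mul_deriv_eq_deriv_mul_of_integrable
      (u := fun k : ℝ => Complex.exp (-Complex.I * k * x)) (v := b) (fun k _ => hexp k)
      (fun k _ => hb k) (integrable_exp_mul hbi1 x)
      (((integrable_exp_mul hbi x).mul_const (-Complex.I * x)).congr
        (Eventually.of_forall fun k => by simp only [Pi.mul_apply]; ring))
      (integrable_exp_mul hbi x)
    rw [fourierExp, fourierExp, hp, ← integral_const_mul, ← integral_neg]
    refine integral_congr_ae (Eventually.of_forall fun k => ?_)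
    simp only
    ring
  -- Two integrations by parts turn `x²` into minus the second derivative of the amplitude. Each of
  -- the two terms on the right is at most `2 B M`.
  have e : ((1 + x ^ 2 : ℝ) : ℂ) * fourierExp a x = fourierExp a x - fourierExp a₂ x := by
    rw [hstep h2 hi1 hi2, hstep h1 hi hi1]
    push_cast
    linear_combination ((x : ℂ) ^ 2 * fourierExp a x) * Complex.I_mul_I
  have hn := congrArg norm e
  rw [norm_mul, Complex.norm_real, Real.norm_of_nonneg (by positivity)] at hn
  rw [← div_eq_mul_inv, le_div_iff₀ (by positivity), mul_comm, hn]
  refine (norm_sub_le _ _).trans ?_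
  have b0 := (_root_.norm_fourierExp_le a x).trans
    (integral_norm_le_of_abs_lt hB0 (fun k hk => (hz k hk).1) fun k => (hM k).1)
  have b2 := (_root_.norm_fourierExp_le a₂ x).trans
    (integral_norm_le_of_abs_lt hB0 (fun k hk => (hz k hk).2.2) fun k => (hM k).2.2)
  linarith

lemma IsBand.integrable_fourierExp (hB : 1 ≤ B) (h : IsBand B M a) : Integrable (fourierExp a) :=
  (integrable_inv_one_add_sq.const_mul (4 * B * M)).mono'
    (continuous_fourierExp h.integrable).aestronglyMeasurable
    (Eventually.of_forall fun x => h.norm_fourierExp_le hB x)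

/-- Fourier inversion at the origin; it gives the mass of the approximate identities used for
uniqueness. -/
lemma integral_fourierExp (hc : Continuous a) (ha : Integrable a)
    (hi : Integrable (fourierExp a)) : ∫ x, fourierExp a x = 2 * Real.pi * a 0 := by
  have e : fourierStar a = fun k => fourierExp a (-k) := by
    funext k
    rw [fourierStar_eq_fourier, fourierExp_eq_fourier, neg_div]
  have h := fourierExp_fourierStar hc ha (by rw [e]; exact hi.comp_neg) 0
  rw [← h, e, fourierExp]
  simp only [Complex.ofReal_zero, mul_zero, Complex.exp_zero, one_mul]
  exact (integral_neg_eq_self _ _).symm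

end band

/-! ### Weak null solutions vanish -/

section uniqueness

variable {κ : ℝ → ℝ} {T C : ℝ} {w : ℝ → ℝ → ℂ} {B : ℝ}

lemma norm_causalConv_le_of_ae_le {f : ℝ → ℝ} {G : ℝ → ℂ} {S t : ℝ}
    (hf : IntegrableOn f (Ioc 0 T)) (hG : ∀ᵐ s, s ∈ Ioc 0 T → ‖G s‖ ≤ S) (hS : 0 ≤ S)
    (ht : t ∈ Ioc 0 T) : ‖causalConv f G t‖ ≤ (∫ s in Ioc 0 T, |f s|) * S := by
  have hft : IntervalIntegrable f volume 0 t :=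
    (intervalIntegrable_iff_integrableOn_Ioc_of_le ht.1.le).2
      (hf.mono_set (Ioc_subset_Ioc_right ht.2))
  have hft' : IntervalIntegrable (fun s => f (t - s)) volume 0 t := by
    simpa using (hft.comp_sub_left t).symm
  have h1 : ‖causalConv f G t‖ ≤ ∫ s in (0 : ℝ)..t, |f (t - s)| * S := by
    refine intervalIntegral.norm_integral_le_of_norm_le ht.1.le ?_ (hft'.abs.mul_const S)
    filter_upwards [hG] with s hs hst
    rw [norm_smul, Real.norm_eq_abs]
    gcongr
    exact hs ⟨hst.1, hst.2.trans ht.2⟩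
  refine h1.trans ?_
  rw [intervalIntegral.integral_mul_const,
    intervalIntegral.integral_comp_sub_left (fun s => |f s|) t, sub_self, sub_zero,
    intervalIntegral.integral_of_le ht.1.le]
  exact mul_le_mul_of_nonneg_right (setIntegral_mono_set hf.abs
    (Eventually.of_forall fun _ => abs_nonneg _) (Ioc_subset_Ioc_right ht.2).eventuallyLE) hS

/-- The main estimate: iterating the weak equation in a weighted norm. -/
lemma IsWeakNull.exists_weight (h : IsWeakNull κ T C w) (hκ : IntegrableOn κ (Ioc 0 T))
    (hC : 0 ≤ C) (hB : 1 ≤ B) :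
    ∃ b : ℝ, ∀ (n : ℕ) (a : ℝ → ℂ) (M : ℝ), IsBand B M a → ∀ᵐ t, t ∈ Ioc 0 T →
      ‖Real.exp (-b * t) • pairing (fourierExp a) w t‖ ≤
        C * (4 * B * M * Real.pi) * (1 / 2) ^ n := by
  have hB0 : 0 < B := by linarith
  -- `18 B² = 2 (3B)²`: two multiplications by `-i k` cost `(3B)²`, and the remaining `2` yields the
  -- gain of `1/2` at each iteration.
  obtain ⟨b, hb0, hb⟩ := exists_integral_exp_mul_le hκ (ε := 1 / (18 * B ^ 2)) (by positivity)
  refine ⟨b, fun n => ?_⟩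
  induction n with
  | zero =>
    refine fun a M ha => Eventually.of_forall fun t ht => ?_
    have h1 := h.norm_pairing_le (integrable_inv_one_add_sq.const_mul (4 * B * M))
      (fun x => ha.norm_fourierExp_le hB x) ⟨ht.1.le, ht.2⟩
    rw [integral_const_mul, integral_univ_inv_one_add_sq] at h1
    rw [norm_smul, Real.norm_of_nonneg (Real.exp_pos _).le, pow_zero, mul_one]
    refine (mul_le_of_le_one_left (norm_nonneg _) ?_).trans h1
    rw [Real.exp_le_one_iff]
    nlinarith [ht.1]
  | succ n ih =>
    intro a M ha
    have ha1 := ha.mul_id hB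
    have ha2 := ha1.mul_id hB
    have hM : 0 ≤ M := by
      obtain ⟨_, _, _, _, _, _, hM⟩ := ha
      exact (norm_nonneg _).trans (hM 0).1
    have hw := h.weak_of_integrable hκ (hasDerivAt_fourierExp ha.integrable ha1.integrable)
      (hasDerivAt_fourierExp ha1.integrable ha2.integrable)
      (continuous_fourierExp ha2.integrable) (ha.integrable_fourierExp hB)
      (ha1.integrable_fourierExp hB) (ha2.integrable_fourierExp hB)
    filter_upwards [hw] with t ht htT
    rw [ht htT, exp_smul_causalConv]
    refine (norm_causalConv_le_of_ae_le (integrableOn_exp_smul hκ) (ih _ _ ha2) (by positivity)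
      htT).trans ?_
    simp only [smul_eq_mul, abs_mul, Real.abs_exp]
    refine (mul_le_mul_of_nonneg_right hb (by positivity)).trans_eq ?_
    rw [pow_succ]
    field_simp
    ring

/-- The weight in `exists_weight` is the same for all `n`, so letting `n → ∞` gives zero for almost
every time; continuity of the pairing in time removes the exceptional set. -/
lemma IsWeakNull.pairing_fourierExp_eq_zero (h : IsWeakNull κ T C w)
    (hκ : IntegrableOn κ (Ioc 0 T)) (hC : 0 ≤ C) (hB : 1 ≤ B) {M : ℝ} {a : ℝ → ℂ}
    (ha : IsBand B M a) {t : ℝ} (ht : t ∈ Ioc 0 T) : pairing (fourierExp a) w t = 0 := by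
  obtain ⟨b, hb⟩ := h.exists_weight hκ hC hB
  have h0 : ∀ᵐ t, t ∈ Ioc 0 T → pairing (fourierExp a) w t = 0 := by
    filter_upwards [ae_all_iff.2 fun n => hb n a M ha] with t ht htT
    have hl : Tendsto (fun n : ℕ => C * (4 * B * M * Real.pi) * (1 / 2) ^ n) atTop (𝓝 0) := by
      simpa using (tendsto_pow_atTop_nhds_zero_of_lt_one (by norm_num : (0 : ℝ) ≤ 1 / 2)
        (by norm_num)).const_mul (C * (4 * B * M * Real.pi))
    have := ge_of_tendsto' hl fun n => ht n htT
    have := norm_le_zero_iff.1 this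
    exact (smul_eq_zero.1 this).resolve_left (Real.exp_pos _).ne'
  exact Measure.eqOn_Ioc_of_ae_eq volume (g := fun _ => (0 : ℂ))
    ((ae_restrict_iff' measurableSet_Ioc).2 h0)
    ((h.continuousOn_pairing (ha.integrable_fourierExp hB)).mono Ioc_subset_Icc_self)
    continuousOn_const ht

/-- A weak null solution vanishes. -/
theorem IsWeakNull.eq_zero (h : IsWeakNull κ T C w) (hκ : IntegrableOn κ (Ioc 0 T)) (hC : 0 ≤ C)
    {t : ℝ} (ht : t ∈ Ioc 0 T) (y : ℝ) : w y t = 0 := by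
  obtain ⟨θ, θ₁, θ₂, d1, d2, hθ2, hθc, hθ0, hθz, -⟩ := exists_cutoff
  have hs := (contDiff_two_of_hasDerivAt d1 d2 hθ2).1
  obtain ⟨M, hM⟩ := exists_isBand hs hθz
  have hΦ := hM.integrable_fourierExp one_le_two
  have htI : t ∈ Icc 0 T := ⟨ht.1.le, ht.2⟩
  have hε : ∀ ε : ℝ, 0 < ε → ∫ z, fourierExp θ z * w (y + ε * z) t = 0 := by
    intro ε hε
    -- The Fourier integral of this amplitude is `ε⁻¹` times that of `θ` evaluated at `(x - y)/ε`:
    -- an approximate identity at `y`, up to the constant `2π`, that is still band-limited.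
    set a : ℝ → ℂ := fun k => Complex.exp (Complex.I * k * y) * θ (ε * k) with ha
    have has : ContDiff ℝ 2 a := by
      refine ContDiff.mul ?_ (hs.comp (contDiff_const.mul contDiff_id))
      have : ContDiff ℝ 2 fun k : ℝ => (k : ℂ) := Complex.ofRealCLM.contDiff
      exact ((contDiff_const.mul this).mul contDiff_const).cexp
    have haz : ∀ k, max 1 (2 / ε) < |k| → a k = 0 := fun k hk => by
      have : θ (ε * k) = 0 := hθz _ <| by
        rw [abs_mul, abs_of_pos hε, ← div_lt_iff₀' hε]
        exact (le_max_right _ _).trans_lt hk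
      simp only [ha, this, mul_zero]
    obtain ⟨M', hM'⟩ := exists_isBand has haz
    have h0 := h.pairing_fourierExp_eq_zero hκ hC (le_max_left _ _) hM' ht
    have he : ∀ x, fourierExp a x = (ε⁻¹ : ℝ) * fourierExp θ ((x - y) / ε) := fun x => by
      have := Measure.integral_comp_mul_left
        (fun u : ℝ => Complex.exp (-Complex.I * u * ((x - y) / ε : ℝ)) * θ u) ε
      rw [abs_of_pos (inv_pos.2 hε)] at this
      rw [fourierExp, fourierExp, ← Complex.real_smul, ← this]
      refine integral_congr_ae (Eventually.of_forall fun k => ?_)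
      simp only [ha]
      rw [← mul_assoc, ← Complex.exp_add]
      congr 2
      have : (ε : ℂ) ≠ 0 := Complex.ofReal_ne_zero.2 hε.ne'
      push_cast
      field_simp
      ring
    set H : ℝ → ℂ := fun z => fourierExp θ z * w (y + ε * z) t with hH
    have e1 : pairing (fourierExp a) w t = ((ε⁻¹ : ℝ) : ℂ) * ∫ x, H ((x - y) / ε) := by
      rw [pairing, ← integral_const_mul]
      refine integral_congr_ae (Eventually.of_forall fun x => ?_)
      simp only [hH]
      rw [he, show y + ε * ((x - y) / ε) = x by field_simp; ring, mul_assoc]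
    have e2 : ∫ x, H ((x - y) / ε) = |ε| • ∫ x, H x := by
      rw [integral_sub_right_eq_self (fun x => H (x / ε)) y, Measure.integral_comp_div]
    rw [e1, e2, Complex.real_smul] at h0
    have hne : (ε : ℂ) ≠ 0 := Complex.ofReal_ne_zero.2 hε.ne'
    rw [abs_of_pos hε] at h0
    simpa [hne] using h0
  -- Concentration as `ε → 0` along `1/(n+1)`: `w` is bounded and continuous in space, so the limit
  -- is `w y t` times the total mass `2π θ(0) = 2π`.
  have hl : Tendsto (fun n : ℕ => ∫ z, fourierExp θ z * w (y + 1 / ((n : ℝ) + 1) * z) t) atTop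
      (𝓝 (∫ z, fourierExp θ z * w y t)) := by
    refine tendsto_integral_of_dominated_convergence (fun z => ‖fourierExp θ z‖ * C) (fun n => ?_)
      (hΦ.norm.mul_const C) (fun n => Eventually.of_forall fun z => ?_)
      (Eventually.of_forall fun z => ?_)
    · exact hΦ.aestronglyMeasurable.mul ((h.continuous_space t htI).comp
        (by fun_prop : Continuous fun z : ℝ => y + 1 / ((n : ℝ) + 1) * z)).aestronglyMeasurable
    · rw [norm_mul]
      gcongr
      exact h.bound _ t htI
    · have hz : Tendsto (fun n : ℕ => y + 1 / ((n : ℝ) + 1) * z) atTop (𝓝 y) := by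
        simpa using (tendsto_one_div_add_atTop_nhds_zero_nat.mul_const z).const_add y
      exact (((h.continuous_space t htI).tendsto y).comp hz).const_mul _
  have h0 := tendsto_nhds_unique hl (tendsto_const_nhds.congr fun n : ℕ =>
    (hε (1 / ((n : ℝ) + 1)) (by positivity)).symm)
  rw [integral_mul_const, integral_fourierExp hM.continuous hM.integrable hΦ, hθ0] at h0
  have : (Real.pi : ℂ) ≠ 0 := Complex.ofReal_ne_zero.2 Real.pi_ne_zero
  simpa [this] using h0

end uniqueness

/-! ### Uniqueness for the Cauchy problem -/

section uniqueness

variable {ρ α ω γ ν N : ℝ} {g : ℝ → ℂ} {ψ ψ₁ ψ₂ : ℝ → ℝ → ℂ}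

lemma IsHeatSolution.exists_isBoundedOnStrip (h : IsHeatSolution α ω γ ρ ν N g ψ)
    (hg : Continuous g) {T : ℝ} (hT : 0 < T) : ∃ C, 0 ≤ C ∧ IsBoundedOnStrip T C ψ := by
  obtain ⟨C, hC⟩ := h.bounded T
  refine ⟨C, (norm_nonneg _).trans (hC 0 0 ⟨le_rfl, hT.le⟩), hC, fun t ht => ?_, fun x => ?_⟩
  · rcases ht.1.eq_or_lt with rfl | h0
    · exact hg.congr fun x => (h.initial x).symm
    · exact (h.space_smooth t h0).continuous
  · have := (h.abs_cont x T hT).continuousOn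
    rwa [uIcc_of_le hT.le] at this

/-- The initial datum cancels on subtracting the two tested equations, and the factor `N` is
absorbed into the memory kernel. -/
lemma isWeakNull_sub (h₁ : IsHeatSolution α ω γ ρ ν N g ψ₁) (h₂ : IsHeatSolution α ω γ ρ ν N g ψ₂)
    (hg : Continuous g) (hρ : ρ ∈ Ioo (0 : ℝ) 1) (hα : 0 < α) (hν : ν ∈ Icc (0 : ℝ) 1) {T : ℝ}
    (hT : 0 < T) :
    ∃ C, 0 ≤ C ∧ IsWeakNull (fun s => N * prabhakarKernel α ρ γ ω s) T C
      fun x t => ψ₁ x t - ψ₂ x t := by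
  obtain ⟨C₁, hC₁, b₁⟩ := h₁.exists_isBoundedOnStrip hg hT
  obtain ⟨C₂, hC₂, b₂⟩ := h₂.exists_isBoundedOnStrip hg hT
  have hK := integrableOn_prabhakarKernel hα hρ.1 γ ω T
  refine ⟨C₁ + C₂, by positivity, ⟨fun x t ht => (norm_sub_le _ _).trans
    (add_le_add (b₁.bound x t ht) (b₂.bound x t ht)), fun t ht =>
      (b₁.continuous_space t ht).sub (b₂.continuous_space t ht), fun x =>
      (b₁.continuous_time x).sub (b₂.continuous_time x)⟩, fun φ hφ hc => ?_⟩
  have hi : ∀ {φ : ℝ → ℂ}, Continuous φ → HasCompactSupport φ → ∀ u : ℝ → ℂ, Continuous u →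
      Integrable fun x => φ x * u x := fun hφ hc u hu =>
    (hφ.mul hu).integrable_of_hasCompactSupport hc.mul_right
  have hφ2 : Continuous (deriv (deriv φ)) :=
    (((contDiff_succ_iff_deriv (n := 1)).1 hφ).2.2).continuous_deriv le_rfl
  have hφ2i : Integrable (deriv (deriv φ)) :=
    hφ2.integrable_of_hasCompactSupport hc.deriv.deriv
  have hpi : ∀ {ψ : ℝ → ℝ → ℂ} {C : ℝ}, IsBoundedOnStrip T C ψ →
      IntegrableOn (fun s => N * pairing (deriv (deriv φ)) ψ s) (Ioc 0 T) := fun hb =>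
    ((hb.continuousOn_pairing hφ2i).integrableOn_Icc.mono_set Ioc_subset_Icc_self).const_mul _
  filter_upwards [h₁.causalConv_pairing hρ hα hν hT hφ hc,
    h₂.causalConv_pairing hρ hα hν hT hφ hc, ae_intervalIntegrable_causalConv hK (hpi b₁),
    ae_intervalIntegrable_causalConv hK (hpi b₂)] with t e₁ e₂ i₁ i₂ ht
  have htI : t ∈ Icc 0 T := ⟨ht.1.le, ht.2⟩
  have hl : pairing φ (fun x t => ψ₁ x t - ψ₂ x t) t =
      (∫ x, φ x * (ψ₁ x t - g x)) - ∫ x, φ x * (ψ₂ x t - g x) := by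
    rw [← integral_sub (hi hφ.continuous hc (fun x => ψ₁ x t - g x) ((b₁.continuous_space t htI).sub hg))
      (hi hφ.continuous hc (fun x => ψ₂ x t - g x) ((b₂.continuous_space t htI).sub hg))]
    refine integral_congr_ae (Eventually.of_forall fun x => ?_)
    simp only
    ring
  rw [hl, ← e₁ ht, ← e₂ ht, causalConv, causalConv, causalConv,
    ← intervalIntegral.integral_sub (i₁ ht) (i₂ ht)]
  refine intervalIntegral.integral_congr fun s hs => ?_
  rw [uIcc_of_le ht.1.le] at hs
  have hsI : s ∈ Icc 0 T := ⟨hs.1, hs.2.trans ht.2⟩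
  have hp : pairing (deriv (deriv φ)) (fun x t => ψ₁ x t - ψ₂ x t) s =
      pairing (deriv (deriv φ)) ψ₁ s - pairing (deriv (deriv φ)) ψ₂ s := by
    rw [pairing, pairing, pairing, ← integral_sub
      (hi hφ2 hc.deriv.deriv _ (b₁.continuous_space s hsI))
      (hi hφ2 hc.deriv.deriv _ (b₂.continuous_space s hsI))]
    refine integral_congr_ae (Eventually.of_forall fun x => ?_)
    simp only
    ring
  simp only [hp, Complex.real_smul]
  push_cast
  ring

theorem IsHeatSolution.unique (h₁ : IsHeatSolution α ω γ ρ ν N g ψ₁)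
    (h₂ : IsHeatSolution α ω γ ρ ν N g ψ₂) (hg : Continuous g) (hρ : ρ ∈ Ioo (0 : ℝ) 1)
    (hα : 0 < α) (hν : ν ∈ Icc (0 : ℝ) 1) (x : ℝ) {t : ℝ} (ht : 0 ≤ t) : ψ₁ x t = ψ₂ x t := by
  rcases ht.eq_or_lt with rfl | ht
  · rw [h₁.initial, h₂.initial]
  · obtain ⟨C, hC, hw⟩ := isWeakNull_sub h₁ h₂ hg hρ hα hν ht
    exact sub_eq_zero.1 (hw.eq_zero ((integrableOn_prabhakarKernel hα hρ.1 γ ω t).const_mul N) hC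
      ⟨ht, le_rfl⟩ x)

end uniqueness

end

theorem mainTheorem9 (α ω γ ρ ν N : ℝ) (hα : 0 < α) (hγ : 0 ≤ γ)
    (hρ : ρ ∈ Set.Ioo (0 : ℝ) 1) (hν : ν ∈ Set.Icc (0 : ℝ) 1) (hN : 0 < N)
    (g : ℝ → ℂ) (hg_cont : Continuous g) (hg_int : MeasureTheory.Integrable g)
    (hg_star : MeasureTheory.Integrable (fourierStar g)) :
    (∀ x t k : ℝ, 0 ≤ t → Summable (heatTerm α ω γ ρ N g x t k)) ∧
    (∀ x t : ℝ, 0 ≤ t →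
      MeasureTheory.Integrable (fun k : ℝ => ∑' n : ℕ, heatTerm α ω γ ρ N g x t k n)) ∧
    IsHeatSolution α ω γ ρ ν N g (heatSolution α ω γ ρ N g) ∧
    (∀ ψ : ℝ → ℝ → ℂ, IsHeatSolution α ω γ ρ ν N g ψ →
      ∀ x t : ℝ, 0 ≤ t → ψ x t = heatSolution α ω γ ρ N g x t) := by
  have hsol := isHeatSolution_heatSolution (ω := ω) hρ hα hγ hν hN hg_cont hg_int hg_star
  refine ⟨fun x t k ht => (hasSum_heatTerm hρ.1 hα hγ N g x ht k).summable, fun x t ht => ?_, hsol,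
    fun ψ hψ x t ht => hψ.unique hsol hg_cont hρ hα hν x ht⟩
  simp only [(hasSum_heatTerm hρ.1 hα hγ N g x ht _).tsum_eq]
  exact integrable_exp_mul (integrable_relaxation_mul hρ hα hγ hN hg_star ht) x
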